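/- Let $\mathcal P$ be the set of curves $\gamma=(\gamma_1,\gamma_2):[0,1]\to\mathbb R^2$ such that 1. $\gamma\in C^1([0,1])\cap W^{2,2}_{\mathrm{loc}}((0,1))$; 2. $\gamma_1(0)=\gamma_1(1)=0$ and $\gamma_1(t)>0$ for all $t\in(0,1)$; 3. $|\dot\gamma(t)|=L[\gamma]:=\int_0^1|\dot\gamma|\,ds$ for all $t\in[0,1]$; 4. $\int_0^1(k_1^2+k_2^2)\,2\pi|\dot\gamma|\gamma_1\,dt<\infty$, where $k_1=\dfrac{\ddot\gamma_2\dot\gamma_1-\ddot\gamma_1\dot\gamma_2}{|\dot\gamma|^3}$ and $k_2=\dfrac{\dot\gamma_2}{\gamma_1|\dot\gamma|}$ are the principal curvatures of the surface of revolution $\Sigma_\gamma$ parametrized by $f_\gamma(t,\theta)=(\gamma_1(t)\cos\theta,\gamma_1(t)\sin\theta,\gamma_2(t))$. For $\gamma\in\mathcal P$ put $$\mathcal W[\gamma]=\frac\pi2\int_0^1(k_1+k_2)^2\gamma_1|\dot\gamma|\,dt,\qquad A[\gamma]=2\pi\int_0^1\gamma_1|\dot\gamma|\,dt,\qquad V[\gamma]=\pi\left|\int_0^1\gamma_1^2\dot\gamma_2\,dt\right|,$$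 and for $\sigma\in(0,1]$ let $$\mathcal F_\sigma=\Big\{\gamma\in\mathcal P : A[\gamma]=1,\ V[\gamma]=\frac{\sigma}{6\sqrt\pi}\Big\},\qquad \beta(\sigma)=\inf\{\mathcal W[\gamma] : \gamma\in\mathcal F_\sigma\}.$$ **Theorem.** Let $\sigma\in(0,1]$ and let $\gamma\in\mathcal F_\sigma$ satisfy $\mathcal W[\gamma]=\beta(\sigma)$. Then $\Sigma_\gamma$ is a smooth surface, including at its two points on the axis of rotation. Precisely, there is a $C^\infty$ immersion $F:\mathbb S^2\to\mathbb R^3$ such that $$F\big(\sin(\pi t)\cos\theta,\ \sin(\pi t)\sin\theta,\ -\cos(\pi t)\big)=f_\gamma(t,\theta)\qquad\text{for all }t\in[0,1],\ \theta\in\mathbb R.$$ -/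

import Mathlib

open scoped ContDiff Manifold

namespace ProfileCurve

/-- The plane carrying the profile curves, with its Euclidean norm. -/
abbrev E2 : Type := EuclideanSpace ℝ (Fin 2)

/-- Euclidean three-space. -/
abbrev E3 : Type := EuclideanSpace ℝ (Fin 3)

/-- `v` belongs to `L²_loc((0,1))`: it is square integrable on every `[a, b] ⊂ (0,1)`. -/
def L2loc (v : ℝ → E2) : Prop :=
  ∀ a b : ℝ, 0 < a → b < 1 →
    MeasureTheory.MemLp v 2 (MeasureTheory.volume.restrict (Set.Icc a b))

/-- `v` is the weak derivative of `u` on `(0,1)`: integration by parts holds against every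
`φ ∈ C_c^∞((0,1))`. -/
def IsWeakDeriv (u v : ℝ → E2) : Prop :=
  ∀ φ : ℝ → ℝ, ContDiff ℝ ∞ φ → HasCompactSupport φ → tsupport φ ⊆ Set.Ioo 0 1 →
    ∫ t, deriv φ t • u t = -∫ t, φ t • v t

/-- `w` is an `L²_loc` second weak derivative of `u` on `(0,1)`, obtained as the weak derivative of
an `L²_loc` first weak derivative. -/
def IsWeakDeriv₂ (u w : ℝ → E2) : Prop :=
  L2loc w ∧ ∃ v : ℝ → E2, L2loc v ∧ IsWeakDeriv u v ∧ IsWeakDeriv v w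

/-- The Sobolev space `W^{2,2}_loc((0,1), ℝ²)`. -/
def MemW22loc (u : ℝ → E2) : Prop :=
  L2loc u ∧ ∃ w : ℝ → E2, IsWeakDeriv₂ u w

/-- The velocity on `[0,1]` (one-sided at the endpoints). -/
noncomputable def velocity (γ : ℝ → E2) (t : ℝ) : E2 :=
  derivWithin γ (Set.Icc 0 1) t

open Classical in
/-- The second weak derivative on `(0,1)`. It is determined up to a null set of `(0,1)`, and is only
used inside integrals over `[0,1]`; the value is `0` if there is no such derivative. -/
noncomputable def acceleration (γ : ℝ → E2) : ℝ → E2 :=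
  if h : ∃ w : ℝ → E2, IsWeakDeriv₂ γ w then h.choose else 0

/-- The first principal curvature (in the profile direction) of the surface of revolution. -/
noncomputable def k₁ (γ : ℝ → E2) (t : ℝ) : ℝ :=
  (acceleration γ t 1 * velocity γ t 0 - acceleration γ t 0 * velocity γ t 1) / ‖velocity γ t‖ ^ 3

/-- The second principal curvature (in the direction of rotation). -/
noncomputable def k₂ (γ : ℝ → E2) (t : ℝ) : ℝ :=
  velocity γ t 1 / (γ t 0 * ‖velocity γ t‖)

/-- The length of the profile curve. -/
noncomputable def length (γ : ℝ → E2) : ℝ :=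
  ∫ t in (0 : ℝ)..1, ‖velocity γ t‖

/-- The area of the surface of revolution. -/
noncomputable def area (γ : ℝ → E2) : ℝ :=
  2 * Real.pi * ∫ t in (0 : ℝ)..1, γ t 0 * ‖velocity γ t‖

/-- The volume of the surface of revolution. -/
noncomputable def vol (γ : ℝ → E2) : ℝ :=
  Real.pi * |∫ t in (0 : ℝ)..1, (γ t 0) ^ 2 * velocity γ t 1|

/-- The Willmore energy, a quarter of the integral of the squared mean curvature `H = k₁ + k₂`
against the area measure `2π γ₁ |γ'| dt`. -/
noncomputable def willmore (γ : ℝ → E2) : ℝ :=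
  Real.pi / 2 * ∫ t in (0 : ℝ)..1, (k₁ γ t + k₂ γ t) ^ 2 * (γ t 0 * ‖velocity γ t‖)

/-- Admissible profile curves. Only the restriction of `γ` to `[0,1]` is relevant. -/
structure Admissible (γ : ℝ → E2) : Prop where
  contDiffOn : ContDiffOn ℝ 1 γ (Set.Icc 0 1)
  memW22loc : MemW22loc γ
  left : γ 0 0 = 0
  right : γ 1 0 = 0
  pos : ∀ t ∈ Set.Ioo (0 : ℝ) 1, 0 < γ t 0
  arcLength : ∀ t ∈ Set.Icc (0 : ℝ) 1, ‖velocity γ t‖ = length γ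
  curvature : MeasureTheory.IntegrableOn
    (fun t => ((k₁ γ t) ^ 2 + (k₂ γ t) ^ 2) * (2 * Real.pi * ‖velocity γ t‖ * γ t 0))
    (Set.Ioo 0 1)

/-- The class `F_σ`: admissible profile curves of area `1` and isoperimetric ratio `σ`. -/
def Class (σ : ℝ) : Set (ℝ → E2) :=
  {γ | Admissible γ ∧ area γ = 1 ∧ vol γ = σ / (6 * Real.sqrt Real.pi)}

/-- The infimum `β(σ)` of the Willmore energy over `F_σ`. -/
noncomputable def beta (σ : ℝ) : ℝ :=
  sInf (willmore '' Class σ)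

/-- The parametrization `f_γ` of the surface of revolution `Σ_γ`. -/
noncomputable def revolve (γ : ℝ → E2) (t θ : ℝ) : E3 :=
  !₂[γ t 0 * Real.cos θ, γ t 0 * Real.sin θ, γ t 1]

/-- The point of the unit sphere with polar parameter `t ∈ [0,1]` (from the south to the north pole)
and longitude `θ`. -/
noncomputable def spherePoint (t θ : ℝ) : Metric.sphere (0 : E3) 1 :=
  ⟨!₂[Real.sin (Real.pi * t) * Real.cos θ, Real.sin (Real.pi * t) * Real.sin θ,
      -Real.cos (Real.pi * t)], by
    rw [mem_sphere_zero_iff_norm, EuclideanSpace.norm_eq, Real.sqrt_eq_one]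
    simp only [Fin.sum_univ_three, Real.norm_eq_abs, sq_abs]
    simp
    nlinarith [Real.sin_sq_add_cos_sq θ, Real.sin_sq_add_cos_sq (Real.pi * t)]⟩

/-- `Σ_γ` is a smooth surface: the map from the round sphere to `ℝ³` given in polar coordinates
`(t, θ)` by `f_γ` is well defined and is a smooth immersion, at the two poles included. -/
def GeneratesSmoothSurface (γ : ℝ → E2) : Prop :=
  ∃ F : Metric.sphere (0 : E3) 1 → E3,
    (∀ t ∈ Set.Icc (0 : ℝ) 1, ∀ θ : ℝ, F (spherePoint t θ) = revolve γ t θ) ∧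
    ContMDiff (𝓡 2) 𝓘(ℝ, E3) ∞ F ∧
    ∀ p, Function.Injective (mfderiv (𝓡 2) 𝓘(ℝ, E3) F p)

end ProfileCurve

namespace ProfileCurve

open MeasureTheory Set Filter Topology

/-! Scaling reduces the problem to curves of length one, described by their distance `r` to the
axis, unit tangent `(c, s)` and angular velocity `κ`, with `r' = c`, `c' = -sκ`, `s' = cκ`. The
Willmore energy is scale invariant, so the minimiser minimises `∫ (κ + s/r)² r` at fixed ratio of
`V²` to `A³`.

Competitors are made by rotating the tangent through a test function `Ψ`. This keeps unit speed and
replaces `κ` by `κ + Ψ'`; the price is one further scalar constraint, that the rotated curve closes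
up on the axis. If the differentials of energy, ratio constraint and closing defect were jointly
onto `ℝ³`, then on a suitable three-parameter family the map to `ℝ³` would be open, and the energy
could be lowered with both constraints kept. Hence (`range_variation_ne_top`, `exists_multipliers`)
there are nontrivial multipliers. Those of volume and area, `lam` and `mu`, satisfy `2 mu A + 3 lam
V = 0`, because `V²/A³` is scale invariant.

If the energy has nonzero multiplier, the weak equation makes `r κ` continuously differentiable, and
a bootstrap gives smoothness on `(0,1)`. The equation is nonlocal: it contains a primitive `Q`,
since rotating the tangent at one point moves the curve elsewhere. A conserved quantity with value
`e` expresses `Q c` through local terms. Integrating `(rQ)' = e + 2 mu r + 3 lam r² s` over `[0,1]`,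
where `rQ` vanishes at both ends, gives `e = 0` by the relation between the multipliers. What
remains is a local first order equation for the mean curvature `H = k + s/r`. If the energy has zero
multiplier, the constraint equation alone forces `s` to be proportional to `r`, so the curvatures
are constant and equal, and the same equation holds with zero multipliers.

At a pole, finiteness of the curvature energy forces `s = 0`. The equation for `H` is linear with a
zeroth order coefficient dominated by the energy density, hence integrable, so an integrating factor
extends `H` continuously (`exists_mean_extension`). In the variable `w = 1 - cos πt`, the height
above the south pole of the round sphere, `r/√(w(2-w))` and `s/r` are weighted averages over dilates
of functions of `c` and `H`. Such averages preserve `C^n` up to `w = 0`, while the differential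
equations for `c` and `H` gain a derivative; iteration gives smoothness in `w`
(`exists_contDiffOn_pole`). Since `w` is the restriction of a polynomial on `ℝ³`, the surface is
locally the restriction to the sphere of a smooth map of space, and the unit tangent makes it an
immersion. The other pole follows by reversing the profile. -/

/-! ### Test functions, local integrability and weak derivatives on `(0,1)`. -/

/-- Test functions on `(0,1)`. -/
structure IsTest (ψ : ℝ → ℝ) : Prop where
  contDiff : ContDiff ℝ ∞ ψ
  hasCompactSupport : HasCompactSupport ψ
  tsupport_subset : tsupport ψ ⊆ Ioo 0 1

namespace IsTest

variable {ψ χ : ℝ → ℝ}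

theorem zero : IsTest (fun _ => 0) :=
  ⟨contDiff_const, HasCompactSupport.zero, by
    have : tsupport (fun _ : ℝ => (0 : ℝ)) = ∅ := by
      rw [tsupport_eq_empty_iff]; rfl
    rw [this]; exact empty_subset _⟩

theorem add (hψ : IsTest ψ) (hχ : IsTest χ) : IsTest (fun t => ψ t + χ t) :=
  ⟨hψ.contDiff.add hχ.contDiff, hψ.hasCompactSupport.add hχ.hasCompactSupport,
    (tsupport_add ψ χ).trans (union_subset hψ.tsupport_subset hχ.tsupport_subset)⟩

theorem mul_left (hψ : IsTest ψ) {f : ℝ → ℝ} (hf : ContDiff ℝ ∞ f) :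
    IsTest (fun t => f t * ψ t) :=
  ⟨hf.mul hψ.contDiff, hψ.hasCompactSupport.mul_left,
    (tsupport_mul_subset_right (f := f) (g := ψ)).trans hψ.tsupport_subset⟩

theorem mul_right (hψ : IsTest ψ) {f : ℝ → ℝ} (hf : ContDiff ℝ ∞ f) :
    IsTest (fun t => ψ t * f t) := by
  simpa only [mul_comm] using hψ.mul_left hf

theorem const_mul (hψ : IsTest ψ) (x : ℝ) : IsTest (fun t => x * ψ t) :=
  hψ.mul_left contDiff_const

theorem deriv (hψ : IsTest ψ) : IsTest (deriv ψ) :=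
  ⟨by simpa using (contDiff_infty_iff_deriv.1 hψ.contDiff).2, hψ.hasCompactSupport.deriv,
    tsupport_deriv_subset.trans hψ.tsupport_subset⟩

theorem continuous (hψ : IsTest ψ) : Continuous ψ := hψ.contDiff.continuous

theorem hasDerivAt (hψ : IsTest ψ) (t : ℝ) : HasDerivAt ψ (_root_.deriv ψ t) t :=
  (hψ.contDiff.differentiable (by simp)).differentiableAt.hasDerivAt

/-- The interval is made to contain `1/2` because primitives are based there throughout. -/
theorem exists_support (hψ : IsTest ψ) :
    ∃ a b : ℝ, 0 < a ∧ a < 1 / 2 ∧ 1 / 2 < b ∧ b < 1 ∧ ∀ t ∉ Ioo a b, ψ t = 0 := by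
  -- Adjoining the midpoint makes the compact set nonempty, covering `ψ = 0`, and places `1/2`
  -- between its extremes.
  have hK : IsCompact (insert (1 / 2 : ℝ) (tsupport ψ)) := hψ.hasCompactSupport.isCompact.insert _
  obtain ⟨x, hx, hx'⟩ := hK.exists_isLeast (insert_nonempty _ _)
  obtain ⟨y, hy, hy'⟩ := hK.exists_isGreatest (insert_nonempty _ _)
  have hsub : ∀ t ∈ insert (1 / 2 : ℝ) (tsupport ψ), t ∈ Ioo (0 : ℝ) 1 := by
    intro t ht
    rcases ht with rfl | ht
    · norm_num
    · exact hψ.tsupport_subset ht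
  have h1 := hx' (mem_insert (1 / 2 : ℝ) _)
  have h2 := hy' (mem_insert (1 / 2 : ℝ) _)
  have h3 := (hsub x hx).1
  have h4 := (hsub y hy).2
  refine ⟨x / 2, (y + 1) / 2, by linarith, by linarith, by linarith, by linarith, ?_⟩
  intro t ht
  by_contra h
  have ht' : t ∈ insert (1 / 2 : ℝ) (tsupport ψ) :=
    mem_insert_of_mem _ (subset_tsupport _ (Function.mem_support.2 h))
  have h5 := hx' ht'
  have h6 := hy' ht'
  exact ht ⟨by linarith, by linarith⟩

theorem of_support {ψ : ℝ → ℝ} (h : ContDiff ℝ ∞ ψ) {a b : ℝ} (ha : 0 < a) (hb : b < 1)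
    (hab : ∀ t ∉ Ioo a b, ψ t = 0) : IsTest ψ := by
  have hs : tsupport ψ ⊆ Icc a b := by
    refine closure_minimal ?_ isClosed_Icc
    intro t ht
    by_contra h'
    exact ht (hab t (fun h'' => h' (Ioo_subset_Icc_self h'')))
  exact ⟨h, HasCompactSupport.of_support_subset_isCompact isCompact_Icc
    ((subset_tsupport _).trans hs), hs.trans (Icc_subset_Ioo ha hb)⟩

end IsTest

theorem integral_eq_of_support {f : ℝ → ℝ} {a b : ℝ} (h : ∀ t ∉ Ioo a b, f t = 0) :
    ∫ t, f t = ∫ t in a..b, f t := by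
  symm
  apply intervalIntegral.integral_eq_integral_of_support_subset
  intro t ht
  by_contra h'
  exact ht (h t (fun h'' => h' (Ioo_subset_Ioc_self h'')))

theorem integral_deriv_eq_zero {ψ : ℝ → ℝ} (hψ : IsTest ψ) : ∫ t, deriv ψ t = 0 := by
  obtain ⟨a, b, ha, ha', hb', hb, h⟩ := hψ.exists_support
  have h' : ∀ t ∉ Ioo (a / 2) ((b + 1) / 2), deriv ψ t = 0 := by
    intro t ht
    have : ψ =ᶠ[𝓝 t] fun _ => 0 := by
      have : (Icc a b)ᶜ ∈ 𝓝 t := by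
        apply isClosed_Icc.isOpen_compl.mem_nhds
        intro h''
        exact ht ⟨by linarith [h''.1], by linarith [h''.2]⟩
      filter_upwards [this] with x hx
      exact h x (fun h'' => hx (Ioo_subset_Icc_self h''))
    rw [this.deriv_eq]
    simp
  rw [integral_eq_of_support h', intervalIntegral.integral_deriv_eq_sub (fun t _ => (hψ.hasDerivAt t).differentiableAt)
    (hψ.deriv.continuous.intervalIntegrable _ _), h _ (fun hh => by linarith [hh.2]),
    h _ (fun hh => by linarith [hh.1])]
  simp

/-- Local integrability on `(0,1)`. -/
abbrev LocInt (f : ℝ → ℝ) : Prop := LocallyIntegrableOn f (Ioo (0 : ℝ) 1)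

theorem LocInt.intervalIntegrable {f : ℝ → ℝ} (hf : LocInt f) {a b : ℝ}
    (ha : a ∈ Ioo (0 : ℝ) 1) (hb : b ∈ Ioo (0 : ℝ) 1) : IntervalIntegrable f volume a b := by
  have h := hf.integrableOn_compact_subset (t := uIcc a b)
    ((ordConnected_Ioo).uIcc_subset ha hb) isCompact_uIcc
  exact h.intervalIntegrable

theorem LocInt.of_Icc {f : ℝ → ℝ}
    (h : ∀ a b : ℝ, 0 < a → b < 1 → IntegrableOn f (Icc a b)) : LocInt f := by
  rw [LocInt, locallyIntegrableOn_iff isOpen_Ioo.isLocallyClosed]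
  intro K hK hKc
  rcases K.eq_empty_or_nonempty with rfl | hne
  · simp
  obtain ⟨x, hx, hx'⟩ := hKc.exists_isLeast hne
  obtain ⟨y, hy, hy'⟩ := hKc.exists_isGreatest hne
  exact (h x y (hK hx).1 (hK hy).2).mono_set (fun t ht => ⟨hx' ht, hy' ht⟩)

theorem LocInt.integrableOn {f : ℝ → ℝ} (hf : LocInt f) {a b : ℝ} (ha : 0 < a) (hb : b < 1) :
    IntegrableOn f (Icc a b) :=
  hf.integrableOn_compact_subset (Icc_subset_Ioo ha hb) isCompact_Icc

theorem LocInt.integrable_mul {f ψ : ℝ → ℝ} (hf : LocInt f) (hψ : IsTest ψ) :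
    Integrable (fun t => ψ t * f t) := by
  obtain ⟨a, b, ha, ha', hb', hb, h⟩ := hψ.exists_support
  have h1 : IntegrableOn (fun t => ψ t * f t) (Icc a b) :=
    (hf.integrableOn ha hb).continuousOn_mul hψ.continuous.continuousOn isCompact_Icc
  refine h1.integrable_of_forall_notMem_eq_zero ?_
  intro t ht
  rw [h t (fun h'' => ht (Ioo_subset_Icc_self h'')), zero_mul]

theorem LocInt.of_continuousOn {f : ℝ → ℝ} (hf : ContinuousOn f (Ioo (0 : ℝ) 1)) : LocInt f :=
  hf.locallyIntegrableOn measurableSet_Ioo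

theorem ae_eq_zero_of_test {f : ℝ → ℝ} (hf : LocInt f)
    (h : ∀ ψ, IsTest ψ → ∫ t, ψ t * f t = 0) : ∀ᵐ t, t ∈ Ioo (0 : ℝ) 1 → f t = 0 :=
  isOpen_Ioo.ae_eq_zero_of_integral_contDiff_smul_eq_zero hf
    (fun g h1 h2 h3 => by simpa using h g ⟨h1, h2, h3⟩)

theorem exists_unit_test : ∃ η, IsTest η ∧ ∫ t, η t = 1 := by
  let f : ContDiffBump (1 / 2 : ℝ) := ⟨1 / 8, 1 / 4, by norm_num, by norm_num⟩
  refine ⟨f.normed volume, ⟨f.contDiff_normed, f.hasCompactSupport_normed, ?_⟩,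
    f.integral_normed⟩
  rw [f.tsupport_normed_eq, Real.closedBall_eq_Icc]
  exact Icc_subset_Ioo (by norm_num) (by norm_num)

/-- Vanishing mean is what makes the primitive vanish again to the right of the support. -/
theorem IsTest.exists_primitive {χ : ℝ → ℝ} (hχ : IsTest χ) (h0 : ∫ t, χ t = 0) :
    ∃ Φ, IsTest Φ ∧ _root_.deriv Φ = χ := by
  obtain ⟨a, b, ha, ha', hb', hb, h⟩ := hχ.exists_support
  have hd : ∀ t, HasDerivAt (fun t => ∫ x in a..t, χ x) (χ t) t := fun t =>
    intervalIntegral.integral_hasDerivAt_right (hχ.continuous.intervalIntegrable _ _)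
      hχ.continuous.stronglyMeasurable.stronglyMeasurableAtFilter hχ.continuous.continuousAt
  have hderiv : _root_.deriv (fun t => ∫ x in a..t, χ x) = χ := funext fun t => (hd t).deriv
  refine ⟨fun t => ∫ x in a..t, χ x, IsTest.of_support ?_ ha hb ?_, hderiv⟩
  · rw [contDiff_infty_iff_deriv, hderiv]
    exact ⟨fun t => (hd t).differentiableAt, hχ.contDiff⟩
  · intro t ht
    have hab : ∫ x in a..b, χ x = 0 := by rw [← integral_eq_of_support h, h0]
    by_cases hta : t ≤ a
    · refine (intervalIntegral.integral_congr (g := fun _ => 0) ?_).trans (by simp)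
      intro x hx
      rw [uIcc_of_ge hta] at hx
      exact h x (fun h'' => by linarith [h''.1, hx.2])
    · have htb : b ≤ t := by
        by_contra h'
        exact ht ⟨not_le.1 hta, not_le.1 h'⟩
      have : ∫ x in b..t, χ x = 0 := by
        refine (intervalIntegral.integral_congr (g := fun _ => 0) ?_).trans (by simp)
        intro x hx
        rw [uIcc_of_le htb] at hx
        exact h x (fun h'' => by linarith [h''.2, hx.1])
      show ∫ x in a..t, χ x = 0
      rw [← intervalIntegral.integral_add_adjacent_intervals (hχ.continuous.intervalIntegrable a b)
        (hχ.continuous.intervalIntegrable b t), hab, this, add_zero]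

/-- A locally integrable function with vanishing weak derivative is constant. -/
theorem ae_const_of_weak_deriv_zero {f : ℝ → ℝ} (hf : LocInt f)
    (h : ∀ ψ, IsTest ψ → ∫ t, deriv ψ t * f t = 0) :
    ∃ C, ∀ᵐ t, t ∈ Ioo (0 : ℝ) 1 → f t = C := by
  obtain ⟨η, hη, hη1⟩ := exists_unit_test
  have hC : LocInt (fun _ => ∫ t, η t * f t) := LocInt.of_continuousOn continuousOn_const
  refine ⟨∫ t, η t * f t, ?_⟩
  have key := ae_eq_zero_of_test (f := fun t => f t - ∫ t, η t * f t) (hf.sub hC) ?_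
  · filter_upwards [key] with t ht ht'
    linarith [ht ht']
  intro ψ hψ
  have hint : ∀ {χ : ℝ → ℝ}, IsTest χ → Integrable χ := fun hχ =>
    hχ.continuous.integrable_of_hasCompactSupport hχ.hasCompactSupport
  -- Subtracting a multiple of the unit bump `η` gives mean zero, hence the derivative of a test
  -- function; the constant is therefore the `η`-mean of `f`.
  have hχ : IsTest (fun t => ψ t + -(∫ t, ψ t) * η t) := hψ.add (hη.const_mul _)
  obtain ⟨Φ, hΦ, hΦ'⟩ := hχ.exists_primitive (by
    rw [integral_add (hint hψ) ((hint hη).const_mul _), integral_const_mul, hη1]; ring)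
  have h1 := h Φ hΦ
  rw [hΦ'] at h1
  have e1 : ∀ t, (ψ t + -(∫ t, ψ t) * η t) * f t = ψ t * f t + -(∫ t, ψ t) * (η t * f t) :=
    fun t => by ring
  simp_rw [e1] at h1
  rw [integral_add (hf.integrable_mul hψ) ((hf.integrable_mul hη).const_mul _),
    integral_const_mul] at h1
  simp_rw [mul_sub]
  rw [integral_sub (hf.integrable_mul hψ) ((hint hψ).mul_const _), integral_mul_const]
  linarith

theorem LocInt.absolutelyContinuousOnInterval {g : ℝ → ℝ} (hg : LocInt g) {x a b : ℝ}
    (ha : 0 < a) (hx : x ∈ Icc a b) (hb : b < 1) :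
    AbsolutelyContinuousOnInterval (fun t => ∫ y in x..t, g y) a b := by
  have hab : a ≤ b := hx.1.trans hx.2
  apply IntervalIntegrable.absolutelyContinuousOnInterval_intervalIntegral
  · exact hg.intervalIntegrable ⟨ha, by linarith⟩ ⟨by linarith, hb⟩
  · rwa [uIcc_of_le hab]

theorem LocInt.continuousOn_integral {g : ℝ → ℝ} (hg : LocInt g) {x : ℝ}
    (hx : x ∈ Ioo (0 : ℝ) 1) : ContinuousOn (fun t => ∫ y in x..t, g y) (Ioo 0 1) := by
  intro t ht
  have h1 : 0 < min x t / 2 := by have := lt_min hx.1 ht.1; linarith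
  have h2 : (max x t + 1) / 2 < 1 := by have := max_lt hx.2 ht.2; linarith
  have h3 : min x t / 2 < x := by have := min_le_left x t; linarith [hx.1]
  have h3' : min x t / 2 < t := by have := min_le_right x t; linarith [ht.1]
  have h4 : x < (max x t + 1) / 2 := by have := le_max_left x t; linarith [hx.2]
  have h4' : t < (max x t + 1) / 2 := by have := le_max_right x t; linarith [ht.2]
  have := (hg.absolutelyContinuousOnInterval h1 (x := x) ⟨h3.le, h4.le⟩ h2).continuousOn
  rw [uIcc_of_le (h3.trans h4).le] at this
  exact (this.continuousAt (Icc_mem_nhds h3' h4')).continuousWithinAt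

/-- The primitive is only absolutely continuous, so this is integration by parts for such functions,
its derivative being `g` almost everywhere. -/
theorem integral_test_mul_primitive {g : ℝ → ℝ} (hg : LocInt g) {ψ : ℝ → ℝ} (hψ : IsTest ψ) :
    ∫ t, deriv ψ t * ∫ y in (1 / 2 : ℝ)..t, g y = -∫ t, ψ t * g t := by
  obtain ⟨a', b', ha', ha2, hb2, hb', h⟩ := hψ.exists_support
  obtain ⟨a'', b'', ha'', ha2', hb2', hb'', h'⟩ := hψ.deriv.exists_support
  obtain ⟨a, haa, haa', ha⟩ : ∃ a, a ≤ a' ∧ a ≤ a'' ∧ 0 < a :=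
    ⟨min a' a'', min_le_left _ _, min_le_right _ _, lt_min ha' ha''⟩
  obtain ⟨b, hbb, hbb', hb⟩ : ∃ b, b' ≤ b ∧ b'' ≤ b ∧ b < 1 :=
    ⟨max b' b'', le_max_left _ _, le_max_right _ _, max_lt hb' hb''⟩
  have hz : ∀ t ∉ Ioo a b, ψ t = 0 := fun t ht =>
    h t (fun h2 => ht ⟨by linarith [h2.1], by linarith [h2.2]⟩)
  have hz' : ∀ t ∉ Ioo a b, deriv ψ t = 0 := fun t ht =>
    h' t (fun h2 => ht ⟨by linarith [h2.1], by linarith [h2.2]⟩)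
  have hab : a < b := by linarith
  have hac := hg.absolutelyContinuousOnInterval (x := 1 / 2) ha ⟨by linarith, by linarith⟩ hb
  have hψac : AbsolutelyContinuousOnInterval ψ a b :=
    (hψ.contDiff.of_le (by simp)).contDiffOn.absolutelyContinuousOnInterval
  have ibp := hψac.integral_mul_deriv_eq_deriv_mul hac
  rw [integral_eq_of_support (a := a) (b := b) (fun t ht => by simp [hz' t ht]),
    integral_eq_of_support (a := a) (b := b) (fun t ht => by simp [hz t ht])]
  rw [hz a (by simp), hz b (by simp)] at ibp
  have hcongr : ∫ t in a..b, ψ t * deriv (fun t => ∫ y in (1 / 2 : ℝ)..t, g y) t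
      = ∫ t in a..b, ψ t * g t := by
    apply intervalIntegral.integral_congr_ae
    filter_upwards [(hg.intervalIntegrable (a := a) (b := b) ⟨ha, by linarith⟩
      ⟨by linarith, hb⟩).ae_hasDerivAt_integral] with t ht ht'
    rw [(ht (uIoc_subset_uIcc ht') (1 / 2)
      (by rw [uIcc_of_le hab.le]; constructor <;> linarith)).deriv]
  linarith

/-- A function with a locally integrable weak derivative is a primitive of it. -/
theorem ae_eq_primitive_of_weak_deriv {f g : ℝ → ℝ} (hf : LocInt f) (hg : LocInt g)
    (h : ∀ ψ, IsTest ψ → ∫ t, deriv ψ t * f t = -∫ t, ψ t * g t) :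
    ∃ C, ∀ᵐ t, t ∈ Ioo (0 : ℝ) 1 → f t = C + ∫ y in (1 / 2 : ℝ)..t, g y := by
  have hF : LocInt (fun t => ∫ y in (1 / 2 : ℝ)..t, g y) :=
    LocInt.of_continuousOn (hg.continuousOn_integral (by norm_num))
  obtain ⟨C, hC⟩ := ae_const_of_weak_deriv_zero (hf.sub hF) (fun ψ hψ => by
    simp only [Pi.sub_apply, mul_sub]
    rw [integral_sub (hf.integrable_mul hψ.deriv) (hF.integrable_mul hψ.deriv), h ψ hψ,
      integral_test_mul_primitive hg hψ]
    ring)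
  refine ⟨C, ?_⟩
  filter_upwards [hC] with t ht ht'
  have := ht ht'
  simp only [Pi.sub_apply] at this
  linarith

theorem eqOn_of_ae_eq_of_continuousOn {f g : ℝ → ℝ} (hf : ContinuousOn f (Ioo (0 : ℝ) 1))
    (hg : ContinuousOn g (Ioo (0 : ℝ) 1)) (h : ∀ᵐ t, t ∈ Ioo (0 : ℝ) 1 → f t = g t) :
    EqOn f g (Ioo 0 1) :=
  Measure.eqOn_open_of_ae_eq (μ := volume)
    ((ae_restrict_iff' measurableSet_Ioo).2 h) isOpen_Ioo hf hg

/-- A continuous function with a locally integrable weak derivative is a primitive of it. -/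
theorem eqOn_primitive_of_weak_deriv {f g : ℝ → ℝ} (hf : ContinuousOn f (Ioo (0 : ℝ) 1))
    (hg : LocInt g) (h : ∀ ψ, IsTest ψ → ∫ t, deriv ψ t * f t = -∫ t, ψ t * g t) :
    ∀ t ∈ Ioo (0 : ℝ) 1, f t = f (1 / 2) + ∫ y in (1 / 2 : ℝ)..t, g y := by
  obtain ⟨C, hC⟩ := ae_eq_primitive_of_weak_deriv (LocInt.of_continuousOn hf) hg h
  have := eqOn_of_ae_eq_of_continuousOn hf
    (continuousOn_const.add (hg.continuousOn_integral (by norm_num))) hC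
  intro t ht
  have h1 := this ht
  have h2 := this (show (1 / 2 : ℝ) ∈ Ioo (0 : ℝ) 1 by norm_num)
  simp at h1 h2 ⊢
  linarith

/-! ### Unit speed data and rotation of the tangent. -/

/-- The unit speed data of a profile curve: `(c, s)` is the unit tangent, `κ` its angular velocity
(in the weak sense), and `r` the distance to the axis. -/
structure UnitProfile (r c s κ : ℝ → ℝ) : Prop where
  continuous_c : Continuous c
  continuous_s : Continuous s
  unit : ∀ t, c t ^ 2 + s t ^ 2 = 1
  r_eq : ∀ t, r t = ∫ x in (0 : ℝ)..t, c x
  r_one : r 1 = 0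
  r_pos : ∀ t ∈ Ioo (0 : ℝ) 1, 0 < r t
  locInt : LocInt κ
  locInt_sq : LocInt (fun t => κ t ^ 2)
  weak_c : ∀ ψ, IsTest ψ → ∫ t, deriv ψ t * c t = ∫ t, ψ t * (s t * κ t)
  weak_s : ∀ ψ, IsTest ψ → ∫ t, deriv ψ t * s t = -∫ t, ψ t * (c t * κ t)
  -- These are the two halves of the curvature energy: up to constants `k₁² γ₁` becomes `κ² r` and
  -- `k₂² γ₁` becomes `s²/r`.
  integrable_curv : IntegrableOn (fun t => κ t ^ 2 * r t) (Ioo 0 1)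
  integrable_rot : IntegrableOn (fun t => s t ^ 2 / r t) (Ioo 0 1)

/-- First component of the tangent rotated by the angle `Ψ`. -/
noncomputable def rotC (c s Ψ : ℝ → ℝ) (t : ℝ) : ℝ := c t * Real.cos (Ψ t) - s t * Real.sin (Ψ t)

/-- Second component of the tangent rotated by the angle `Ψ`. -/
noncomputable def rotS (c s Ψ : ℝ → ℝ) (t : ℝ) : ℝ := s t * Real.cos (Ψ t) + c t * Real.sin (Ψ t)

/-- Distance to the axis of the curve with rotated tangent. -/
noncomputable def rotR (c s Ψ : ℝ → ℝ) (t : ℝ) : ℝ := ∫ x in (0 : ℝ)..t, rotC c s Ψ x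

/-- The normalised Willmore energy. -/
noncomputable def unitWillmore (r s κ : ℝ → ℝ) : ℝ :=
  ∫ t in (0 : ℝ)..1, (κ t + s t / r t) ^ 2 * r t

/-- The normalised area. -/
noncomputable def unitArea (r : ℝ → ℝ) : ℝ := ∫ t in (0 : ℝ)..1, r t

/-- The normalised signed volume. -/
noncomputable def unitVol (r s : ℝ → ℝ) : ℝ := ∫ t in (0 : ℝ)..1, r t ^ 2 * s t

theorem LocInt.continuousOn_mul {f g : ℝ → ℝ} (hg : LocInt g)
    (hf : ContinuousOn f (Ioo (0 : ℝ) 1)) : LocInt (fun t => f t * g t) :=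
  LocInt.of_Icc fun _ _ ha hb => (hg.integrableOn ha hb).continuousOn_mul
    (hf.mono (Icc_subset_Ioo ha hb)) isCompact_Icc

theorem LocInt.continuous_mul {f g : ℝ → ℝ} (hg : LocInt g) (hf : Continuous f) :
    LocInt (fun t => f t * g t) := hg.continuousOn_mul hf.continuousOn

theorem LocInt.integrableOn_of_support {f : ℝ → ℝ} (hf : LocInt f) {a b : ℝ} (ha : 0 < a)
    (hb : b < 1) (h : ∀ t ∈ Ioo (0 : ℝ) 1, t ∉ Ioo a b → f t = 0) : IntegrableOn f (Ioo 0 1) := by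
  have h1 := hf.integrableOn ha hb
  refine h1.of_forall_sdiff_eq_zero measurableSet_Ioo ?_
  intro t ht
  exact h t ht.1 (fun h' => ht.2 (Ioo_subset_Icc_self h'))

section rot

variable {c s Ψ : ℝ → ℝ}

theorem continuous_rotC (hc : Continuous c) (hs : Continuous s) (hΨ : Continuous Ψ) :
    Continuous (rotC c s Ψ) :=
  (hc.mul (Real.continuous_cos.comp hΨ)).sub (hs.mul (Real.continuous_sin.comp hΨ))

theorem continuous_rotS (hc : Continuous c) (hs : Continuous s) (hΨ : Continuous Ψ) :
    Continuous (rotS c s Ψ) :=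
  (hs.mul (Real.continuous_cos.comp hΨ)).add (hc.mul (Real.continuous_sin.comp hΨ))

theorem rotC_eq_of_eq_zero {t : ℝ} (h : Ψ t = 0) : rotC c s Ψ t = c t := by simp [rotC, h]

theorem rotS_eq_of_eq_zero {t : ℝ} (h : Ψ t = 0) : rotS c s Ψ t = s t := by simp [rotS, h]

theorem rot_unit (h : ∀ t, c t ^ 2 + s t ^ 2 = 1) (t : ℝ) :
    rotC c s Ψ t ^ 2 + rotS c s Ψ t ^ 2 = 1 := by
  have h1 := Real.sin_sq_add_cos_sq (Ψ t)
  have h2 := h t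
  unfold rotC rotS
  calc _ = (c t ^ 2 + s t ^ 2) * (Real.sin (Ψ t) ^ 2 + Real.cos (Ψ t) ^ 2) := by ring
    _ = 1 := by rw [h1, h2]; ring

end rot

namespace UnitProfile

variable {r c s κ : ℝ → ℝ}

theorem hasDerivAt_r (h : UnitProfile r c s κ) (t : ℝ) : HasDerivAt r (c t) t := by
  have : r = fun t => ∫ x in (0 : ℝ)..t, c x := funext h.r_eq
  rw [this]
  exact intervalIntegral.integral_hasDerivAt_right (h.continuous_c.intervalIntegrable _ _)
    h.continuous_c.stronglyMeasurable.stronglyMeasurableAtFilter h.continuous_c.continuousAt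

theorem continuous_r (h : UnitProfile r c s κ) : Continuous r :=
  continuous_iff_continuousAt.2 fun t => (h.hasDerivAt_r t).continuousAt

theorem r_zero (h : UnitProfile r c s κ) : r 0 = 0 := by rw [h.r_eq]; simp

theorem r_nonneg (h : UnitProfile r c s κ) {t : ℝ} (ht : t ∈ Icc (0 : ℝ) 1) : 0 ≤ r t := by
  rcases eq_or_lt_of_le ht.1 with h0 | h0
  · rw [← h0, h.r_zero]
  rcases eq_or_lt_of_le ht.2 with h1 | h1
  · rw [h1, h.r_one]
  · exact (h.r_pos t ⟨h0, h1⟩).le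

theorem unitArea_pos (h : UnitProfile r c s κ) : 0 < unitArea r :=
  intervalIntegral.intervalIntegral_pos_of_pos_on (h.continuous_r.intervalIntegrable _ _)
    h.r_pos one_pos

theorem rotR_eq_left (h : UnitProfile r c s κ) {Ψ : ℝ → ℝ} {a b : ℝ}
    (hab : ∀ t ∉ Ioo a b, Ψ t = 0) {t : ℝ} (hta : t ≤ a) (ht : 0 ≤ t) : rotR c s Ψ t = r t := by
  rw [h.r_eq, rotR]
  apply intervalIntegral.integral_congr
  intro x hx
  rw [uIcc_of_le ht] at hx
  exact rotC_eq_of_eq_zero (hab x (fun h' => by linarith [h'.1, hx.2]))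

/-- Beyond the support of `Ψ` the tangent is unchanged, so the distance function is only translated,
by the closing defect `rotR c s Ψ 1`. -/
theorem rotR_eq_right (h : UnitProfile r c s κ) {Ψ : ℝ → ℝ} (hΨ : Continuous Ψ) {a b : ℝ}
    (hab : ∀ t ∉ Ioo a b, Ψ t = 0) {t : ℝ} (htb : b ≤ t) (ht : t ≤ 1) :
    rotR c s Ψ t = rotR c s Ψ 1 + r t := by
  have hC := continuous_rotC h.continuous_c h.continuous_s hΨ
  have e1 : ∫ x in t..1, rotC c s Ψ x = ∫ x in t..1, c x := by
    apply intervalIntegral.integral_congr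
    intro x hx
    rw [uIcc_of_le ht] at hx
    exact rotC_eq_of_eq_zero (hab x (fun h' => by linarith [h'.2, hx.1]))
  have e2 := intervalIntegral.integral_add_adjacent_intervals
    (hC.intervalIntegrable 0 t) (hC.intervalIntegrable t 1) (μ := volume)
  have e3 := intervalIntegral.integral_add_adjacent_intervals
    (h.continuous_c.intervalIntegrable 0 t) (h.continuous_c.intervalIntegrable t 1) (μ := volume)
  have e4 := h.r_one
  rw [h.r_eq] at e4
  rw [h.r_eq]
  unfold rotR
  linarith

theorem locInt_mul_curv (h : UnitProfile r c s κ) {f : ℝ → ℝ} (hf : Continuous f) :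
    LocInt (fun t => f t * κ t) := h.locInt.continuous_mul hf

/-- Rotating a unit field by the smooth angle `Ψ` adds `Ψ'` to its angular velocity and keeps it in
`L²_loc`. Once the curve is closed it coincides with the old one near both poles, so finiteness of
the energy is inherited there. This supplies the competitors for the minimiser. -/
theorem rotate (h : UnitProfile r c s κ) {Ψ : ℝ → ℝ} (hΨ : IsTest Ψ)
    (h1 : rotR c s Ψ 1 = 0) (hpos : ∀ t ∈ Ioo (0 : ℝ) 1, 0 < rotR c s Ψ t) :
    UnitProfile (rotR c s Ψ) (rotC c s Ψ) (rotS c s Ψ) (fun t => κ t + deriv Ψ t) := by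
  obtain ⟨a, b, ha, ha', hb', hb, hab⟩ := (hΨ).exists_support
  obtain ⟨a', b', ha2, -, -, hb2, hab'⟩ := (hΨ.deriv).exists_support
  have hC := continuous_rotC h.continuous_c h.continuous_s hΨ.continuous
  have hS := continuous_rotS h.continuous_c h.continuous_s hΨ.continuous
  have hcos : ContDiff ℝ ∞ (fun t => Real.cos (Ψ t)) := Real.contDiff_cos.comp hΨ.contDiff
  have hsin : ContDiff ℝ ∞ (fun t => Real.sin (Ψ t)) := Real.contDiff_sin.comp hΨ.contDiff
  have hR : Continuous (rotR c s Ψ) := by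
    apply continuous_iff_continuousAt.2
    intro t
    exact (intervalIntegral.integral_hasDerivAt_right (hC.intervalIntegrable _ _)
      hC.stronglyMeasurable.stronglyMeasurableAtFilter hC.continuousAt).continuousAt
  have hd : LocInt (deriv Ψ) := LocInt.of_continuousOn hΨ.deriv.continuous.continuousOn
  have hsq : LocInt (fun t => (κ t + deriv Ψ t) ^ 2) := by
    have e : (fun t => (κ t + deriv Ψ t) ^ 2)
        = ((fun t => κ t ^ 2) + fun t => (2 * deriv Ψ t) * κ t) + fun t => deriv Ψ t ^ 2 := by
      ext t; simp only [Pi.add_apply]; ring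
    rw [e]
    exact (h.locInt_sq.add (h.locInt_mul_curv (continuous_const.mul hΨ.deriv.continuous))).add
      (LocInt.of_continuousOn (hΨ.deriv.continuous.pow 2).continuousOn)
  have dcos : ∀ t, HasDerivAt (fun t => Real.cos (Ψ t)) (-Real.sin (Ψ t) * deriv Ψ t) t :=
    fun t => (hΨ.hasDerivAt t).cos
  have dsin : ∀ t, HasDerivAt (fun t => Real.sin (Ψ t)) (Real.cos (Ψ t) * deriv Ψ t) t :=
    fun t => (hΨ.hasDerivAt t).sin
  -- Product rule for a smooth factor times a weakly differentiable one: absorb `cos Ψ` or `sin Ψ`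
  -- into the test function, then use the weak equations for `c` and `s`.
  have weak_aux : ∀ ψ, IsTest ψ →
      (∫ t, deriv ψ t * (Real.cos (Ψ t) * c t) = ∫ t, ψ t * (Real.cos (Ψ t) * (s t * κ t)
        + Real.sin (Ψ t) * deriv Ψ t * c t)) ∧
      (∫ t, deriv ψ t * (Real.sin (Ψ t) * c t) = ∫ t, ψ t * (Real.sin (Ψ t) * (s t * κ t)
        - Real.cos (Ψ t) * deriv Ψ t * c t)) ∧
      (∫ t, deriv ψ t * (Real.cos (Ψ t) * s t) = ∫ t, ψ t * (-(Real.cos (Ψ t) * (c t * κ t))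
        + Real.sin (Ψ t) * deriv Ψ t * s t)) ∧
      (∫ t, deriv ψ t * (Real.sin (Ψ t) * s t) = ∫ t, ψ t * (-(Real.sin (Ψ t) * (c t * κ t))
        - Real.cos (Ψ t) * deriv Ψ t * s t)) := by
    intro ψ hψ
    have dψc : ∀ t, deriv (fun t => ψ t * Real.cos (Ψ t)) t
        = deriv ψ t * Real.cos (Ψ t) + ψ t * (-Real.sin (Ψ t) * deriv Ψ t) := fun t =>
      ((hψ.hasDerivAt t).mul (dcos t)).deriv
    have dψs : ∀ t, deriv (fun t => ψ t * Real.sin (Ψ t)) t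
        = deriv ψ t * Real.sin (Ψ t) + ψ t * (Real.cos (Ψ t) * deriv Ψ t) := fun t =>
      ((hψ.hasDerivAt t).mul (dsin t)).deriv
    have c1 := h.weak_c _ (hψ.mul_right hcos)
    have c2 := h.weak_c _ (hψ.mul_right hsin)
    have s1 := h.weak_s _ (hψ.mul_right hcos)
    have s2 := h.weak_s _ (hψ.mul_right hsin)
    have LC : ∀ {f : ℝ → ℝ}, Continuous f → LocInt f := fun hf =>
      LocInt.of_continuousOn hf.continuousOn
    have I1 : ∀ {f : ℝ → ℝ}, Continuous f → Integrable (fun t => deriv ψ t * f t) := fun hf =>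
      (LC hf).integrable_mul hψ.deriv
    have I2 : ∀ {f : ℝ → ℝ}, Continuous f → Integrable (fun t => ψ t * f t) := fun hf =>
      (LC hf).integrable_mul hψ
    have I3 : ∀ {f : ℝ → ℝ}, Continuous f → Integrable (fun t => ψ t * (f t * κ t)) := fun hf =>
      (h.locInt_mul_curv hf).integrable_mul hψ
    have k1 := hcos.continuous
    have k2 := hsin.continuous
    have k3 := h.continuous_c
    have k4 := h.continuous_s
    have k5 := hΨ.deriv.continuous
    refine ⟨?_, ?_, ?_, ?_⟩
    · have e1 : ∀ t, deriv (fun t => ψ t * Real.cos (Ψ t)) t * c t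
        = deriv ψ t * (Real.cos (Ψ t) * c t) - ψ t * (Real.sin (Ψ t) * deriv Ψ t * c t) := by
        intro t; rw [dψc]; ring
      have e2 : ∀ t, ψ t * Real.cos (Ψ t) * (s t * κ t) = ψ t * ((Real.cos (Ψ t) * s t) * κ t) := by
        intro t; ring
      have e3 : ∀ t, ψ t * (Real.cos (Ψ t) * (s t * κ t) + Real.sin (Ψ t) * deriv Ψ t * c t)
        = ψ t * ((Real.cos (Ψ t) * s t) * κ t) + ψ t * (Real.sin (Ψ t) * deriv Ψ t * c t) := by
        intro t; ring
      simp_rw [e1, e2] at c1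
      rw [integral_sub (I1 (by fun_prop)) (I2 (by fun_prop))] at c1
      simp_rw [e3]
      rw [integral_add (I3 (by fun_prop)) (I2 (by fun_prop))]
      linarith
    · have e1 : ∀ t, deriv (fun t => ψ t * Real.sin (Ψ t)) t * c t
        = deriv ψ t * (Real.sin (Ψ t) * c t) + ψ t * (Real.cos (Ψ t) * deriv Ψ t * c t) := by
        intro t; rw [dψs]; ring
      have e2 : ∀ t, ψ t * Real.sin (Ψ t) * (s t * κ t) = ψ t * ((Real.sin (Ψ t) * s t) * κ t) := by
        intro t; ring
      have e3 : ∀ t, ψ t * (Real.sin (Ψ t) * (s t * κ t) - Real.cos (Ψ t) * deriv Ψ t * c t)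
        = ψ t * ((Real.sin (Ψ t) * s t) * κ t) - ψ t * (Real.cos (Ψ t) * deriv Ψ t * c t) := by
        intro t; ring
      simp_rw [e1, e2] at c2
      rw [integral_add (I1 (by fun_prop)) (I2 (by fun_prop))] at c2
      simp_rw [e3]
      rw [integral_sub (I3 (by fun_prop)) (I2 (by fun_prop))]
      linarith
    · have e1 : ∀ t, deriv (fun t => ψ t * Real.cos (Ψ t)) t * s t
        = deriv ψ t * (Real.cos (Ψ t) * s t) - ψ t * (Real.sin (Ψ t) * deriv Ψ t * s t) := by
        intro t; rw [dψc]; ring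
      have e2 : ∀ t, ψ t * Real.cos (Ψ t) * (c t * κ t) = ψ t * ((Real.cos (Ψ t) * c t) * κ t) := by
        intro t; ring
      have e3 : ∀ t, ψ t * (-(Real.cos (Ψ t) * (c t * κ t)) + Real.sin (Ψ t) * deriv Ψ t * s t)
        = ψ t * (Real.sin (Ψ t) * deriv Ψ t * s t) - ψ t * ((Real.cos (Ψ t) * c t) * κ t) := by
        intro t; ring
      simp_rw [e1, e2] at s1
      rw [integral_sub (I1 (by fun_prop)) (I2 (by fun_prop))] at s1
      simp_rw [e3]
      rw [integral_sub (I2 (by fun_prop)) (I3 (by fun_prop))]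
      linarith
    · have e1 : ∀ t, deriv (fun t => ψ t * Real.sin (Ψ t)) t * s t
        = deriv ψ t * (Real.sin (Ψ t) * s t) + ψ t * (Real.cos (Ψ t) * deriv Ψ t * s t) := by
        intro t; rw [dψs]; ring
      have e2 : ∀ t, ψ t * Real.sin (Ψ t) * (c t * κ t) = ψ t * ((Real.sin (Ψ t) * c t) * κ t) := by
        intro t; ring
      have e3 : ∀ t, ψ t * (-(Real.sin (Ψ t) * (c t * κ t)) - Real.cos (Ψ t) * deriv Ψ t * s t)
        = -(ψ t * ((Real.sin (Ψ t) * c t) * κ t) + ψ t * (Real.cos (Ψ t) * deriv Ψ t * s t)) := by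
        intro t; ring
      simp_rw [e1, e2] at s2
      rw [integral_add (I1 (by fun_prop)) (I2 (by fun_prop))] at s2
      simp_rw [e3]
      rw [integral_neg, integral_add (I3 (by fun_prop)) (I2 (by fun_prop))]
      linarith
  have k1 := hcos.continuous
  have k2 := hsin.continuous
  have k3 := h.continuous_c
  have k4 := h.continuous_s
  have k5 := hΨ.deriv.continuous
  have LC : ∀ {f : ℝ → ℝ}, Continuous f → LocInt f := fun hf =>
    LocInt.of_continuousOn hf.continuousOn
  obtain ⟨A, hA0, hAa, hAa'⟩ : ∃ A, 0 < A ∧ A ≤ a ∧ A ≤ a' :=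
    ⟨min a a', lt_min ha ha2, min_le_left _ _, min_le_right _ _⟩
  obtain ⟨B, hB0, hBb, hBb'⟩ : ∃ B, B < 1 ∧ b ≤ B ∧ b' ≤ B :=
    ⟨max b b', max_lt hb hb2, le_max_left _ _, le_max_right _ _⟩
  have hout : ∀ t ∈ Ioo (0 : ℝ) 1, t ∉ Ioo A B →
      rotR c s Ψ t = r t ∧ Ψ t = 0 ∧ deriv Ψ t = 0 := by
    intro t ht htAB
    have m1 : t ∉ Ioo a b := fun h' => htAB ⟨by linarith [h'.1], by linarith [h'.2]⟩
    have m2 : t ∉ Ioo a' b' := fun h' => htAB ⟨by linarith [h'.1], by linarith [h'.2]⟩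
    refine ⟨?_, hab t m1, hab' t m2⟩
    by_cases hta : t ≤ a
    · exact h.rotR_eq_left hab hta ht.1.le
    · have : b ≤ t := by
        by_contra hb''
        exact m1 ⟨not_le.1 hta, not_le.1 hb''⟩
      rw [h.rotR_eq_right hΨ.continuous hab this ht.2.le, h1, zero_add]
  refine ⟨hC, hS, rot_unit h.unit, fun t => rfl, h1, hpos, h.locInt.add hd, hsq, ?_, ?_, ?_, ?_⟩
  · intro ψ hψ
    obtain ⟨w1, w2, w3, w4⟩ := weak_aux ψ hψ
    have e1 : ∀ t, deriv ψ t * rotC c s Ψ t = deriv ψ t * (Real.cos (Ψ t) * c t)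
      - deriv ψ t * (Real.sin (Ψ t) * s t) := by intro t; unfold rotC; ring
    simp_rw [e1]
    rw [integral_sub ((LC (by fun_prop)).integrable_mul hψ.deriv)
      ((LC (by fun_prop)).integrable_mul hψ.deriv), w1, w4, ← integral_sub]
    · congr 1; ext t; unfold rotS; ring
    · refine LocInt.integrable_mul ?_ hψ
      refine LocallyIntegrableOn.add ?_ (LC (by fun_prop))
      exact (h.locInt_mul_curv k4).continuous_mul k1
    · refine LocInt.integrable_mul ?_ hψ
      refine LocallyIntegrableOn.sub ?_ (LC (by fun_prop))
      exact ((h.locInt_mul_curv k3).continuous_mul k2).neg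
  · intro ψ hψ
    obtain ⟨w1, w2, w3, w4⟩ := weak_aux ψ hψ
    have e1 : ∀ t, deriv ψ t * rotS c s Ψ t = deriv ψ t * (Real.cos (Ψ t) * s t)
      + deriv ψ t * (Real.sin (Ψ t) * c t) := by intro t; unfold rotS; ring
    simp_rw [e1]
    rw [integral_add ((LC (by fun_prop)).integrable_mul hψ.deriv)
      ((LC (by fun_prop)).integrable_mul hψ.deriv), w3, w2, ← integral_add, ← integral_neg]
    · congr 1; ext t; unfold rotC; ring
    · refine LocInt.integrable_mul ?_ hψ
      refine LocallyIntegrableOn.add ?_ (LC (by fun_prop))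
      exact ((h.locInt_mul_curv k3).continuous_mul k1).neg
    · refine LocInt.integrable_mul ?_ hψ
      refine LocallyIntegrableOn.sub ?_ (LC (by fun_prop))
      exact ((h.locInt_mul_curv k4).continuous_mul k2)
  -- The difference of the two densities vanishes outside a compact subinterval, so local
  -- integrability suffices for it; only the old density is singular at the ends.
  · have key : IntegrableOn (fun t => rotR c s Ψ t * (κ t + deriv Ψ t) ^ 2 - r t * κ t ^ 2)
        (Ioo 0 1) := by
      refine LocInt.integrableOn_of_support ?_ hA0 hB0 ?_
      · exact (hsq.continuous_mul hR).sub (h.locInt_sq.continuous_mul h.continuous_r)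
      · intro t ht htAB
        obtain ⟨q1, q2, q3⟩ := hout t ht htAB
        rw [q1, q3]; ring
    refine (key.add h.integrable_curv).congr_fun ?_ measurableSet_Ioo
    intro t ht
    simp only [Pi.add_apply]; ring
  · have key : IntegrableOn (fun t => rotS c s Ψ t ^ 2 / rotR c s Ψ t - s t ^ 2 / r t)
        (Ioo 0 1) := by
      refine LocInt.integrableOn_of_support ?_ hA0 hB0 ?_
      · apply LocInt.of_continuousOn
        exact ((hS.pow 2).continuousOn.div hR.continuousOn (fun t ht => (hpos t ht).ne')).sub
          ((h.continuous_s.pow 2).continuousOn.div h.continuous_r.continuousOn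
            (fun t ht => (h.r_pos t ht).ne'))
      · intro t ht htAB
        obtain ⟨q1, q2, q3⟩ := hout t ht htAB
        rw [q1, rotS_eq_of_eq_zero q2]; ring
    refine (key.add h.integrable_rot).congr_fun ?_ measurableSet_Ioo
    intro t ht
    simp only [Pi.add_apply]; ring

end UnitProfile

/-! ### Passage between admissible plane curves and unit speed data. -/

theorem hasDerivAt_apply {u : ℝ → E2} {v : E2} {t : ℝ} (h : HasDerivAt u v t) (i : Fin 2) :
    HasDerivAt (fun t => u t i) (v i) t :=
  (EuclideanSpace.proj (𝕜 := ℝ) i).hasFDerivAt.comp_hasDerivAt t h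

theorem hasDerivAt_of_apply {u : ℝ → E2} {v : E2} {t : ℝ}
    (h : ∀ i, HasDerivAt (fun t => u t i) (v i) t) : HasDerivAt u v t := by
  have hd : DifferentiableAt ℝ u t :=
    differentiableAt_euclidean.2 fun i => (h i).differentiableAt
  have : deriv u t = v := by
    ext i
    exact (hasDerivAt_apply hd.hasDerivAt i).unique (h i)
  rw [← this]
  exact hd.hasDerivAt

theorem L2loc.memLp {v : ℝ → E2} (h : L2loc v) (i : Fin 2) {a b : ℝ} (ha : 0 < a) (hb : b < 1) :
    MemLp (fun t => v t i) 2 (volume.restrict (Icc a b)) := (h a b ha hb).eval_piLp i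

theorem L2loc.of_apply {v : ℝ → E2} (hv : ∀ i, LocInt (fun t => v t i))
    (hv2 : ∀ i, LocInt (fun t => v t i ^ 2)) : L2loc v := by
  intro a b ha hb
  refine MemLp.of_eval_piLp fun i => ?_
  exact (memLp_two_iff_integrable_sq ((hv i).integrableOn ha hb).aestronglyMeasurable).2
    ((hv2 i).integrableOn ha hb)

theorem L2loc.locInt {v : ℝ → E2} (h : L2loc v) (i : Fin 2) : LocInt (fun t => v t i) :=
  LocInt.of_Icc fun _ _ ha hb => (h.memLp i ha hb).integrable (by norm_num)

theorem L2loc.locInt_sq {v : ℝ → E2} (h : L2loc v) (i : Fin 2) : LocInt (fun t => v t i ^ 2) :=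
  LocInt.of_Icc fun _ _ ha hb => (h.memLp i ha hb).integrable_sq

theorem isWeakDeriv_iff {u v : ℝ → E2} (hu : ∀ i, LocInt (fun t => u t i))
    (hv : ∀ i, LocInt (fun t => v t i)) : IsWeakDeriv u v ↔
      ∀ i ψ, IsTest ψ → ∫ t, deriv ψ t * u t i = -∫ t, ψ t * v t i := by
  have e1 : ∀ ψ, IsTest ψ → ∀ i, (∫ t, deriv ψ t • u t) i = ∫ t, deriv ψ t * u t i :=
    fun ψ hψ i => eval_integral_piLp (fun i => (hu i).integrable_mul hψ.deriv) i
  have e2 : ∀ ψ, IsTest ψ → ∀ i, (∫ t, ψ t • v t) i = ∫ t, ψ t * v t i :=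
    fun ψ hψ i => eval_integral_piLp (fun i => (hv i).integrable_mul hψ) i
  constructor
  · intro h i ψ hψ
    rw [← e1 ψ hψ, ← e2 ψ hψ, h ψ hψ.contDiff hψ.hasCompactSupport hψ.tsupport_subset]
    rfl
  · intro h ψ h1 h2 h3
    ext i
    have hψ : IsTest ψ := ⟨h1, h2, h3⟩
    rw [e1 ψ hψ, h i ψ hψ, PiLp.neg_apply, e2 ψ hψ]

theorem integral_congr_Ioo {f g : ℝ → ℝ} (hf : ∀ t ∉ Ioo (0 : ℝ) 1, f t = 0)
    (hg : ∀ t ∉ Ioo (0 : ℝ) 1, g t = 0) (h : ∀ᵐ t, t ∈ Ioo (0 : ℝ) 1 → f t = g t) :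
    ∫ t, f t = ∫ t, g t := by
  apply integral_congr_ae
  filter_upwards [h] with t ht
  by_cases h' : t ∈ Ioo (0 : ℝ) 1
  · exact ht h'
  · rw [hf t h', hg t h']

theorem IsTest.eq_zero {ψ : ℝ → ℝ} (hψ : IsTest ψ) {t : ℝ} (ht : t ∉ Ioo (0 : ℝ) 1) : ψ t = 0 :=
  image_eq_zero_of_notMem_tsupport fun h => ht (hψ.tsupport_subset h)

theorem integral_test_congr {f g ψ : ℝ → ℝ} (hψ : IsTest ψ)
    (h : ∀ᵐ t, t ∈ Ioo (0 : ℝ) 1 → f t = g t) : ∫ t, ψ t * f t = ∫ t, ψ t * g t := by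
  apply integral_congr_Ioo
  · intro t ht; rw [hψ.eq_zero ht, zero_mul]
  · intro t ht; rw [hψ.eq_zero ht, zero_mul]
  · filter_upwards [h] with t ht ht'
    rw [ht ht']

theorem weak_deriv_of_hasDerivAt {f g : ℝ → ℝ} (h : ∀ t ∈ Ioo (0 : ℝ) 1, HasDerivAt f (g t) t)
    (hg : ContinuousOn g (Ioo 0 1)) {ψ : ℝ → ℝ} (hψ : IsTest ψ) :
    ∫ t, deriv ψ t * f t = -∫ t, ψ t * g t := by
  have hgl := LocInt.of_continuousOn hg
  have e : ∀ t ∈ Ioo (0 : ℝ) 1, f t = f (1 / 2) + ∫ y in (1 / 2 : ℝ)..t, g y := by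
    intro t ht
    have hsub : uIcc (1 / 2) t ⊆ Ioo (0 : ℝ) 1 :=
      ordConnected_Ioo.uIcc_subset (by norm_num) ht
    rw [intervalIntegral.integral_eq_sub_of_hasDerivAt (fun x hx => h x (hsub hx))
      ((hg.mono hsub).intervalIntegrable)]
    ring
  have hF : LocInt (fun t => ∫ y in (1 / 2 : ℝ)..t, g y) :=
    LocInt.of_continuousOn (hgl.continuousOn_integral (by norm_num))
  have e2 : ∫ t, deriv ψ t * f t
      = ∫ t, deriv ψ t * (f (1 / 2) + ∫ y in (1 / 2 : ℝ)..t, g y) :=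
    integral_test_congr hψ.deriv (Eventually.of_forall e)
  rw [e2]
  simp_rw [mul_add]
  rw [integral_add ((LocInt.of_continuousOn continuousOn_const).integrable_mul hψ.deriv)
    (hF.integrable_mul hψ.deriv), integral_test_mul_primitive hgl hψ, integral_mul_const,
    integral_deriv_eq_zero hψ]
  ring

theorem weak_deriv_unique {g₁ g₂ : ℝ → ℝ} (h₁ : LocInt g₁) (h₂ : LocInt g₂)
    (h : ∀ ψ, IsTest ψ → ∫ t, ψ t * g₁ t = ∫ t, ψ t * g₂ t) :
    ∀ᵐ t, t ∈ Ioo (0 : ℝ) 1 → g₁ t = g₂ t := by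
  have := ae_eq_zero_of_test (h₁.sub h₂) (fun ψ hψ => by
    simp only [Pi.sub_apply, mul_sub]
    rw [integral_sub (h₁.integrable_mul hψ) (h₂.integrable_mul hψ), h ψ hψ, sub_self])
  filter_upwards [this] with t ht ht'
  have := ht ht'
  simp only [Pi.sub_apply] at this
  linarith

/-- The second weak derivative of a `C¹` curve is a weak derivative of its velocity. -/
theorem IsWeakDeriv₂.weak_velocity {u w : ℝ → E2} {u' : ℝ → Fin 2 → ℝ} (h : IsWeakDeriv₂ u w)
    (hu : ∀ i, ∀ t ∈ Ioo (0 : ℝ) 1, HasDerivAt (fun t => u t i) (u' t i) t)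
    (hu' : ∀ i, ContinuousOn (fun t => u' t i) (Ioo 0 1)) (i : Fin 2) {ψ : ℝ → ℝ} (hψ : IsTest ψ) :
    ∫ t, deriv ψ t * u' t i = -∫ t, ψ t * w t i := by
  obtain ⟨hw, v, hv, huv, hvw⟩ := h
  have hul : ∀ i, LocInt (fun t => u t i) := fun i => LocInt.of_continuousOn
    fun t ht => (hu i t ht).continuousAt.continuousWithinAt
  rw [isWeakDeriv_iff hul hv.locInt] at huv
  rw [isWeakDeriv_iff hv.locInt hw.locInt] at hvw
  have hae := weak_deriv_unique (LocInt.of_continuousOn (hu' i)) (hv.locInt i) (fun ψ hψ => by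
    have h1 := huv i ψ hψ
    rw [weak_deriv_of_hasDerivAt (hu i) (hu' i) hψ] at h1
    linarith)
  rw [integral_test_congr hψ.deriv hae, hvw i ψ hψ]

/-- A countable exhaustion of `(0,1)` by closed intervals around the midpoint. -/
theorem ae_Ioo_of_forall_Icc {p : ℝ → Prop}
    (h : ∀ a b : ℝ, 0 < a → a < 1 / 2 → 1 / 2 < b → b < 1 → ∀ᵐ t, t ∈ Icc a b → p t) :
    ∀ᵐ t, t ∈ Ioo (0 : ℝ) 1 → p t := by
  -- The shift by `3` gives `1/(n+3) ≤ 1/3`, so every interval of the exhaustion contains `1/2` in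
  -- its interior.
  have h' : ∀ n : ℕ, ∀ᵐ t, t ∈ Icc (1 / (n + 3 : ℝ)) (1 - 1 / (n + 3 : ℝ)) → p t := by
    intro n
    have h1 : (1 : ℝ) / (n + 3) < 1 / 2 := by
      apply one_div_lt_one_div_of_lt <;> [norm_num; (have : (0 : ℝ) ≤ n := n.cast_nonneg; linarith)]
    have h2 : (0 : ℝ) < 1 / (n + 3) := by positivity
    exact h _ _ h2 h1 (by linarith) (by linarith)
  filter_upwards [ae_all_iff.2 h'] with t ht ht'
  have hm : 0 < min t (1 - t) := lt_min ht'.1 (by linarith [ht'.2])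
  obtain ⟨n, hn⟩ := exists_nat_one_div_lt hm
  have h3 : (1 : ℝ) / (n + 3) ≤ 1 / (n + 1) := by
    apply one_div_le_one_div_of_le <;> [positivity; linarith]
  refine ht n ⟨?_, ?_⟩
  · have := min_le_left t (1 - t); linarith
  · have := min_le_right t (1 - t); linarith

theorem ae_hasDerivAt_primitive {f g : ℝ → ℝ} (hg : LocInt g)
    (h : ∀ t ∈ Ioo (0 : ℝ) 1, f t = f (1 / 2) + ∫ y in (1 / 2 : ℝ)..t, g y) :
    ∀ᵐ t, t ∈ Ioo (0 : ℝ) 1 → HasDerivAt f (g t) t := by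
  apply ae_Ioo_of_forall_Icc
  intro a b ha ha' hb' hb
  have hab : a ≤ b := by linarith
  filter_upwards [(hg.intervalIntegrable (a := a) (b := b) ⟨ha, by linarith⟩
      ⟨by linarith, hb⟩).ae_hasDerivAt_integral] with t ht ht'
  have h1 := ht (by rwa [uIcc_of_le hab]) (1 / 2)
    (by rw [uIcc_of_le hab]; constructor <;> linarith)
  refine (h1.const_add (f (1 / 2))).congr_of_eventuallyEq ?_
  filter_upwards [Ioo_mem_nhds (show 0 < t by linarith [ht'.1]) (show t < 1 by linarith [ht'.2])]
    with x hx
  exact h x hx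

/-- The weak derivative of a unit vector field is orthogonal to it. -/
theorem ae_orthogonal_of_unit {c s c' s' : ℝ → ℝ} (hc : Continuous c) (hs : Continuous s)
    (hu : ∀ t, c t ^ 2 + s t ^ 2 = 1) (hc' : LocInt c') (hs' : LocInt s')
    (h1 : ∀ ψ, IsTest ψ → ∫ t, deriv ψ t * c t = -∫ t, ψ t * c' t)
    (h2 : ∀ ψ, IsTest ψ → ∫ t, deriv ψ t * s t = -∫ t, ψ t * s' t) :
    ∀ᵐ t, t ∈ Ioo (0 : ℝ) 1 → c t * c' t + s t * s' t = 0 := by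
  filter_upwards [ae_hasDerivAt_primitive hc' (eqOn_primitive_of_weak_deriv hc.continuousOn hc' h1),
    ae_hasDerivAt_primitive hs' (eqOn_primitive_of_weak_deriv hs.continuousOn hs' h2)]
    with t ht1 ht2 ht
  have h3 := ((ht1 ht).pow 2).add ((ht2 ht).pow 2)
  have h4 : (c ^ 2 + s ^ 2) = fun _ => 1 := funext hu
  rw [h4] at h3
  have := h3.unique (hasDerivAt_const t 1)
  simp at this
  linarith

/-- `γ` is the profile curve of length `L` with unit speed data `r, c, s, κ`. -/
structure HasUnitProfile (γ : ℝ → E2) (L : ℝ) (r c s κ : ℝ → ℝ) : Prop where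
  length_pos : 0 < L
  velocity_zero : ∀ t ∈ Icc (0 : ℝ) 1, velocity γ t 0 = L * c t
  velocity_one : ∀ t ∈ Icc (0 : ℝ) 1, velocity γ t 1 = L * s t
  coord : ∀ t ∈ Icc (0 : ℝ) 1, γ t 0 = L * r t
  norm : ∀ t ∈ Icc (0 : ℝ) 1, ‖velocity γ t‖ = L
  curv : ∀ᵐ t, t ∈ Ioo (0 : ℝ) 1 → k₁ γ t = κ t / L

namespace HasUnitProfile

variable {γ : ℝ → E2} {L : ℝ} {r c s κ : ℝ → ℝ}

theorem k₂_eq (h : HasUnitProfile γ L r c s κ) {t : ℝ} (ht : t ∈ Icc (0 : ℝ) 1) :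
    k₂ γ t = s t / r t / L := by
  have := h.length_pos.ne'
  rw [k₂, h.velocity_one t ht, h.coord t ht, h.norm t ht]
  field_simp

theorem area_eq (h : HasUnitProfile γ L r c s κ) :
    area γ = 2 * Real.pi * (L ^ 2 * unitArea r) := by
  have : ∫ t in (0 : ℝ)..1, γ t 0 * ‖velocity γ t‖ = L ^ 2 * unitArea r := by
    rw [unitArea, ← intervalIntegral.integral_const_mul]
    apply intervalIntegral.integral_congr
    intro t ht
    rw [uIcc_of_le zero_le_one] at ht
    simp only [h.coord t ht, h.norm t ht]
    ring
  rw [area, this]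

theorem vol_eq (h : HasUnitProfile γ L r c s κ) :
    vol γ = Real.pi * (L ^ 3 * |unitVol r s|) := by
  have : ∫ t in (0 : ℝ)..1, (γ t 0) ^ 2 * velocity γ t 1 = L ^ 3 * unitVol r s := by
    rw [unitVol, ← intervalIntegral.integral_const_mul]
    apply intervalIntegral.integral_congr
    intro t ht
    rw [uIcc_of_le zero_le_one] at ht
    simp only [h.coord t ht, h.velocity_one t ht]
    ring
  rw [vol, this, abs_mul, abs_of_pos (pow_pos h.length_pos 3)]

theorem willmore_eq (h : HasUnitProfile γ L r c s κ) :
    willmore γ = Real.pi / 2 * unitWillmore r s κ := by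
  rw [willmore, unitWillmore]
  congr 1
  apply intervalIntegral.integral_congr_ae
  have h1 : ∀ᵐ t : ℝ, t ≠ 1 := by simp [ae_iff, measure_singleton]
  filter_upwards [h.curv, h1] with t ht ht1 ht'
  rw [uIoc_of_le zero_le_one] at ht'
  have ht2 : t ∈ Icc (0 : ℝ) 1 := Ioc_subset_Icc_self ht'
  have := h.length_pos.ne'
  rw [ht ⟨ht'.1, lt_of_le_of_ne ht'.2 ht1⟩, h.k₂_eq ht2, h.coord t ht2, h.norm t ht2]
  field_simp

/-- All powers of `L` cancel: the curvature energy is scale invariant. -/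
theorem curvature_integrand (h : HasUnitProfile γ L r c s κ) (hr : ∀ t ∈ Ioo (0 : ℝ) 1, 0 < r t) :
    ∀ᵐ t, t ∈ Ioo (0 : ℝ) 1 →
      ((k₁ γ t) ^ 2 + (k₂ γ t) ^ 2) * (2 * Real.pi * ‖velocity γ t‖ * γ t 0)
        = 2 * Real.pi * (κ t ^ 2 * r t + s t ^ 2 / r t) := by
  filter_upwards [h.curv] with t ht ht'
  have ht2 : t ∈ Icc (0 : ℝ) 1 := Ioo_subset_Icc_self ht'
  have := h.length_pos.ne'
  have := (hr t ht').ne'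
  rw [ht ht', h.k₂_eq ht2, h.coord t ht2, h.norm t ht2]
  field_simp

end HasUnitProfile

theorem acceleration_spec {γ : ℝ → E2} (h : ∃ w, IsWeakDeriv₂ γ w) :
    IsWeakDeriv₂ γ (acceleration γ) := by
  rw [acceleration, dif_pos h]
  exact h.choose_spec

/-- Every unit profile is realised by an admissible curve of prescribed length. -/
theorem UnitProfile.exists_admissible {r c s κ : ℝ → ℝ} (h : UnitProfile r c s κ) {L : ℝ}
    (hL : 0 < L) : ∃ γ, Admissible γ ∧ HasUnitProfile γ L r c s κ := by
  let z : ℝ → ℝ := fun t => ∫ x in (0 : ℝ)..t, s x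
  have hz : ∀ t, HasDerivAt z (s t) t := fun t =>
    intervalIntegral.integral_hasDerivAt_right (h.continuous_s.intervalIntegrable _ _)
      h.continuous_s.stronglyMeasurable.stronglyMeasurableAtFilter h.continuous_s.continuousAt
  let γ : ℝ → E2 := fun t => !₂[L * r t, L * z t]
  let v : ℝ → E2 := fun t => !₂[L * c t, L * s t]
  let w : ℝ → E2 := fun t => !₂[-(L * s t * κ t), L * c t * κ t]
  have hγ : ∀ t, HasDerivAt γ (v t) t := by
    intro t
    apply hasDerivAt_of_apply
    intro i
    fin_cases i
    · simpa [γ, v] using (h.hasDerivAt_r t).const_mul L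
    · simpa [γ, v] using (hz t).const_mul L
  have hvc : ∀ i, Continuous (fun t => v t i) := by
    intro i
    fin_cases i
    · simpa [v] using h.continuous_c.const_mul L
    · simpa [v] using h.continuous_s.const_mul L
  have hv : Continuous v := by
    have : Continuous fun t => WithLp.ofLp (v t) := continuous_pi hvc
    exact (PiLp.continuous_toLp 2 _).comp this
  have hvel : ∀ t ∈ Icc (0 : ℝ) 1, velocity γ t = v t := by
    intro t ht
    exact (hγ t).hasDerivWithinAt.derivWithin ((uniqueDiffOn_Icc zero_lt_one) t ht)
  have hnorm : ∀ t, ‖v t‖ = L := by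
    intro t
    rw [EuclideanSpace.norm_eq]
    have : ∑ i, ‖v t i‖ ^ 2 = L ^ 2 := by
      simp [v, Fin.sum_univ_two]
      have := h.unit t
      calc (L * c t) ^ 2 + (L * s t) ^ 2 = L ^ 2 * (c t ^ 2 + s t ^ 2) := by ring
        _ = L ^ 2 := by rw [this, mul_one]
    rw [this, Real.sqrt_sq hL.le]
  have hnorm' : ∀ t ∈ Icc (0 : ℝ) 1, ‖velocity γ t‖ = L := fun t ht => by rw [hvel t ht, hnorm]
  have hlen : length γ = L := by
    have : ∫ t in (0 : ℝ)..1, ‖velocity γ t‖ = ∫ t in (0 : ℝ)..1, L := by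
      apply intervalIntegral.integral_congr
      intro t ht
      rw [uIcc_of_le zero_le_one] at ht
      exact hnorm' t ht
    rw [length, this]; simp
  have hwl : ∀ i, LocInt (fun t => w t i) := by
    intro i
    fin_cases i
    · simpa [w] using h.locInt_mul_curv (h.continuous_s.const_mul (-L))
    · simpa [w] using h.locInt_mul_curv (h.continuous_c.const_mul L)
  have hw2 : ∀ i, LocInt (fun t => w t i ^ 2) := by
    intro i
    fin_cases i
    · simpa [w, mul_pow] using (h.locInt_sq.continuous_mul
        ((continuous_const.pow 2).mul (h.continuous_s.pow 2)) (f := fun t => L ^ 2 * s t ^ 2))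
    · simpa [w, mul_pow] using (h.locInt_sq.continuous_mul
        ((continuous_const.pow 2).mul (h.continuous_c.pow 2)) (f := fun t => L ^ 2 * c t ^ 2))
  have hvl : ∀ i, LocInt (fun t => v t i) := fun i => LocInt.of_continuousOn (hvc i).continuousOn
  have hL2 : ∀ u : ℝ → E2, Continuous u → L2loc u := fun u hu => by
    have : ∀ i, Continuous fun t => u t i := fun i =>
      (EuclideanSpace.proj (𝕜 := ℝ) i).continuous.comp hu
    exact L2loc.of_apply (fun i => LocInt.of_continuousOn (this i).continuousOn)
      (fun i => LocInt.of_continuousOn ((this i).pow 2).continuousOn)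
  have hγc : Continuous γ := continuous_iff_continuousAt.2 fun t => (hγ t).continuousAt
  have hw : IsWeakDeriv₂ γ w := by
    refine ⟨L2loc.of_apply hwl hw2, v, hL2 v hv, ?_, ?_⟩
    · rw [isWeakDeriv_iff ((hL2 γ hγc).locInt) hvl]
      intro i ψ hψ
      exact weak_deriv_of_hasDerivAt (fun t _ => hasDerivAt_apply (hγ t) i) (hvc i).continuousOn hψ
    · rw [isWeakDeriv_iff hvl hwl]
      intro i ψ hψ
      fin_cases i
      · have e1 : ∀ t, deriv ψ t * (L * c t) = L * (deriv ψ t * c t) := fun t => by ring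
        have e2 : ∀ t, ψ t * (L * s t * κ t) = L * (ψ t * (s t * κ t)) := fun t => by ring
        simp [v, w, integral_neg, e1, e2, integral_const_mul, h.weak_c ψ hψ]
      · have e1 : ∀ t, deriv ψ t * (L * s t) = L * (deriv ψ t * s t) := fun t => by ring
        have e2 : ∀ t, ψ t * (L * c t * κ t) = L * (ψ t * (c t * κ t)) := fun t => by ring
        simp [v, w, e1, e2, integral_const_mul, h.weak_s ψ hψ]
  have hacc := acceleration_spec ⟨w, hw⟩
  -- `acceleration` is an arbitrary choice of second weak derivative, so it can be identified with
  -- `w` only almost everywhere.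
  have hae : ∀ i, ∀ᵐ t, t ∈ Ioo (0 : ℝ) 1 → acceleration γ t i = w t i := fun i =>
    weak_deriv_unique (hacc.1.locInt i) (hwl i) fun ψ hψ => by
      have h1 := hacc.weak_velocity (u' := fun t => v t) (fun i t _ => hasDerivAt_apply (hγ t) i)
        (fun i => (hvc i).continuousOn) i hψ
      have h2 := hw.weak_velocity (u' := fun t => v t) (fun i t _ => hasDerivAt_apply (hγ t) i)
        (fun i => (hvc i).continuousOn) i hψ
      linarith
  have hprof : HasUnitProfile γ L r c s κ := by
    refine ⟨hL, ?_, ?_, ?_, hnorm', ?_⟩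
    · intro t ht; rw [hvel t ht]; simp [v]
    · intro t ht; rw [hvel t ht]; simp [v]
    · intro t ht; simp [γ]
    · filter_upwards [hae 0, hae 1] with t h0 h1 ht
      rw [k₁, h0 ht, h1 ht, hvel t (Ioo_subset_Icc_self ht), hnorm]
      have := h.unit t
      simp [w, v]
      field_simp
      linear_combination κ t * this
  refine ⟨γ, ⟨?_, ⟨hL2 γ hγc, w, hw⟩, ?_, ?_, ?_, ?_, ?_⟩, hprof⟩
  · have : ContDiff ℝ 1 γ := by
      rw [contDiff_one_iff_deriv]
      refine ⟨fun t => (hγ t).differentiableAt, ?_⟩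
      rw [show deriv γ = v from funext fun t => (hγ t).deriv]
      exact hv
    exact this.contDiffOn
  · simp [γ, h.r_zero]
  · simp [γ, h.r_one]
  · intro t ht
    simpa [γ] using mul_pos hL (h.r_pos t ht)
  · intro t ht
    rw [hnorm' t ht, hlen]
  · refine IntegrableOn.congr_fun_ae
      ((h.integrable_curv.add h.integrable_rot).const_mul (2 * Real.pi)) ?_
    rw [EventuallyEq, ae_restrict_iff' measurableSet_Ioo]
    filter_upwards [hprof.curvature_integrand h.r_pos] with t ht ht'
    rw [ht ht']
    rfl

/-- The unit speed data of an admissible curve. -/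
theorem Admissible.exists_unitProfile {γ : ℝ → E2} (h : Admissible γ) :
    ∃ L r c s κ, UnitProfile r c s κ ∧ HasUnitProfile γ L r c s κ := by
  set L := length γ with hLdef
  have hud := uniqueDiffOn_Icc (zero_lt_one (α := ℝ))
  have hvel : ContinuousOn (velocity γ) (Icc 0 1) :=
    h.contDiffOn.continuousOn_derivWithin hud le_rfl
  have hdw : ∀ t ∈ Icc (0 : ℝ) 1, HasDerivWithinAt γ (velocity γ t) (Icc 0 1) t := fun t ht =>
    ((h.contDiffOn.differentiableOn one_ne_zero) t ht).hasDerivWithinAt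
  have hda : ∀ t ∈ Ioo (0 : ℝ) 1, HasDerivAt γ (velocity γ t) t := fun t ht =>
    (hdw t (Ioo_subset_Icc_self ht)).hasDerivAt (Icc_mem_nhds ht.1 ht.2)
  have hdai : ∀ i, ∀ t ∈ Ioo (0 : ℝ) 1, HasDerivAt (fun t => γ t i) (velocity γ t i) t :=
    fun i t ht => hasDerivAt_apply (hda t ht) i
  have hγc : ∀ i, ContinuousOn (fun t => γ t i) (Icc 0 1) := fun i =>
    (EuclideanSpace.proj (𝕜 := ℝ) i).continuous.comp_continuousOn h.contDiffOn.continuousOn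
  have hvci : ∀ i, ContinuousOn (fun t => velocity γ t i) (Icc 0 1) := fun i =>
    (EuclideanSpace.proj (𝕜 := ℝ) i).continuous.comp_continuousOn hvel
  have hftc : ∀ t ∈ Icc (0 : ℝ) 1, γ t 0 = ∫ x in (0 : ℝ)..t, velocity γ x 0 := by
    intro t ht
    have hsub : Icc 0 t ⊆ Icc (0 : ℝ) 1 := Icc_subset_Icc_right ht.2
    rw [intervalIntegral.integral_eq_sub_of_hasDerivAt_of_le ht.1 ((hγc 0).mono hsub)
      (fun x hx => hdai 0 x ⟨hx.1, hx.2.trans_le ht.2⟩), h.left, sub_zero]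
    apply ContinuousOn.intervalIntegrable
    rw [uIcc_of_le ht.1]
    exact (hvci 0).mono hsub
  have hL : 0 < L := by
    have h0 : 0 ≤ L := by
      rw [hLdef, ← h.arcLength 0 (by simp)]; exact norm_nonneg _
    rcases h0.eq_or_lt with h0 | h0
    -- Zero length would make the velocity vanish, and `γ₁` would stay at its initial value `0`.
    · exfalso
      have hv0 : ∀ t ∈ Icc (0 : ℝ) 1, velocity γ t = 0 := fun t ht => by
        rw [← norm_eq_zero, h.arcLength t ht, ← hLdef, ← h0]
      have h1 := hftc (1 / 2) (by norm_num)
      have h2 := h.pos (1 / 2) (by norm_num)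
      rw [h1, intervalIntegral.integral_congr (g := fun _ => 0)] at h2
      · simp at h2
      · intro t ht
        rw [uIcc_of_le (by norm_num)] at ht
        simp [hv0 t ⟨ht.1, ht.2.trans (by norm_num)⟩]
    · exact h0
  -- Clamping the parameter to `[0,1]` extends the tangent continuously to the whole line.
  let p : ℝ → ℝ := fun t => projIcc (0 : ℝ) 1 zero_le_one t
  have hpc : Continuous p := continuous_subtype_val.comp continuous_projIcc
  have hpm : ∀ t, p t ∈ Icc (0 : ℝ) 1 := fun t => (projIcc (0 : ℝ) 1 zero_le_one t).2
  have hpe : ∀ t ∈ Icc (0 : ℝ) 1, p t = t := fun t ht => by simp [p, projIcc_of_mem zero_le_one ht]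
  let c : ℝ → ℝ := fun t => velocity γ (p t) 0 / L
  let s : ℝ → ℝ := fun t => velocity γ (p t) 1 / L
  let r : ℝ → ℝ := fun t => ∫ x in (0 : ℝ)..t, c x
  let w := acceleration γ
  -- This is `c s' - s c'` with weak derivatives. Since `c c' + s s' = 0` almost everywhere, it
  -- recovers `c' = -sκ` and `s' = cκ`.
  let κ : ℝ → ℝ := fun t => w t 1 / L * c t - w t 0 / L * s t
  have hc : Continuous c := ((hvci 0).comp_continuous hpc hpm).div_const L
  have hs : Continuous s := ((hvci 1).comp_continuous hpc hpm).div_const L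
  have hvc : ∀ t ∈ Icc (0 : ℝ) 1, velocity γ t 0 = L * c t := fun t ht => by
    simp only [c, hpe t ht]; field_simp
  have hvs : ∀ t ∈ Icc (0 : ℝ) 1, velocity γ t 1 = L * s t := fun t ht => by
    simp only [s, hpe t ht]; field_simp
  have hunit : ∀ t, c t ^ 2 + s t ^ 2 = 1 := by
    intro t
    have h1 := h.arcLength (p t) (hpm t)
    rw [EuclideanSpace.norm_eq, ← hLdef] at h1
    have h2 : ∑ i, ‖velocity γ (p t) i‖ ^ 2 = L ^ 2 := by
      rw [← h1, Real.sq_sqrt (Finset.sum_nonneg fun _ _ => sq_nonneg _)]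
    simp [Fin.sum_univ_two] at h2
    simp only [c, s, div_pow]
    field_simp
    exact h2
  have hr : ∀ t ∈ Icc (0 : ℝ) 1, γ t 0 = L * r t := by
    intro t ht
    rw [hftc t ht, ← intervalIntegral.integral_const_mul]
    apply intervalIntegral.integral_congr
    intro x hx
    rw [uIcc_of_le ht.1] at hx
    exact hvc x ⟨hx.1, hx.2.trans ht.2⟩
  have hw : IsWeakDeriv₂ γ w := acceleration_spec h.memW22loc.2
  have hwv : ∀ i ψ, IsTest ψ → ∫ t, deriv ψ t * (velocity γ t i) = -∫ t, ψ t * w t i :=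
    fun i ψ hψ => hw.weak_velocity (u' := fun t => velocity γ t) hdai
      (fun i => (hvci i).mono Ioo_subset_Icc_self) i hψ
  have hc' : LocInt (fun t => w t 0 / L) := by
    simpa [div_eq_inv_mul] using (hw.1.locInt 0).continuous_mul (f := fun _ => L⁻¹) continuous_const
  have hs' : LocInt (fun t => w t 1 / L) := by
    simpa [div_eq_inv_mul] using (hw.1.locInt 1).continuous_mul (f := fun _ => L⁻¹) continuous_const
  have hsq : ∀ i, LocInt (fun t => (w t i / L) ^ 2) := fun i => by
    simpa [div_eq_inv_mul, mul_pow] using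
      (hw.1.locInt_sq i).continuous_mul (f := fun _ => (L ^ 2)⁻¹) continuous_const
  have hwc : ∀ ψ, IsTest ψ → ∫ t, deriv ψ t * c t = -∫ t, ψ t * (w t 0 / L) := by
    intro ψ hψ
    have h1 : ∫ t, deriv ψ t * c t = ∫ t, deriv ψ t * (velocity γ t 0 / L) :=
      integral_test_congr hψ.deriv (Eventually.of_forall fun t ht => by
        rw [hvc t (Ioo_subset_Icc_self ht)]; field_simp)
    rw [h1]
    simp_rw [← mul_div_assoc]
    rw [integral_div, integral_div, hwv 0 ψ hψ, neg_div]
  have hws : ∀ ψ, IsTest ψ → ∫ t, deriv ψ t * s t = -∫ t, ψ t * (w t 1 / L) := by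
    intro ψ hψ
    have h1 : ∫ t, deriv ψ t * s t = ∫ t, deriv ψ t * (velocity γ t 1 / L) :=
      integral_test_congr hψ.deriv (Eventually.of_forall fun t ht => by
        rw [hvs t (Ioo_subset_Icc_self ht)]; field_simp)
    rw [h1]
    simp_rw [← mul_div_assoc]
    rw [integral_div, integral_div, hwv 1 ψ hψ, neg_div]
  have horth := ae_orthogonal_of_unit hc hs hunit hc' hs' hwc hws
  have hκl : LocInt κ := by
    have := (hs'.continuous_mul hc).sub (hc'.continuous_mul hs)
    refine this.congr ?_
    exact Eventually.of_forall fun t => by simp only [κ, Pi.sub_apply]; ring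
  have hprof : HasUnitProfile γ L r c s κ := by
    refine ⟨hL, hvc, hvs, hr, h.arcLength, Eventually.of_forall fun t ht => ?_⟩
    have ht' := Ioo_subset_Icc_self ht
    rw [k₁, h.arcLength t ht', hvc t ht', hvs t ht', ← hLdef]
    simp only [κ, w]
    field_simp
  have hrpos : ∀ t ∈ Ioo (0 : ℝ) 1, 0 < r t := fun t ht => by
    have h1 := h.pos t ht
    rw [hr t (Ioo_subset_Icc_self ht)] at h1
    exact pos_of_mul_pos_right h1 hL.le
  have hrc : Continuous r := by
    apply continuous_iff_continuousAt.2
    intro t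
    exact (intervalIntegral.integral_hasDerivAt_right (hc.intervalIntegrable _ _)
      hc.stronglyMeasurable.stronglyMeasurableAtFilter hc.continuousAt).continuousAt
  have hint : IntegrableOn (fun t => κ t ^ 2 * r t + s t ^ 2 / r t) (Ioo 0 1) := by
    have h1 : IntegrableOn (fun t => 2 * Real.pi * (κ t ^ 2 * r t + s t ^ 2 / r t)) (Ioo 0 1) := by
      refine IntegrableOn.congr_fun_ae h.curvature ?_
      rw [EventuallyEq, ae_restrict_iff' measurableSet_Ioo]
      exact hprof.curvature_integrand hrpos
    have h2 : IntegrableOn (fun t => (2 * Real.pi)⁻¹ *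
        (2 * Real.pi * (κ t ^ 2 * r t + s t ^ 2 / r t))) (Ioo 0 1) := h1.const_mul _
    refine h2.congr_fun ?_ measurableSet_Ioo
    intro t _
    have := Real.pi_pos.ne'
    simp only
    field_simp
  have hκm : AEStronglyMeasurable κ (volume.restrict (Ioo 0 1)) := hκl.aestronglyMeasurable
  have hsm : ContinuousOn (fun t => s t ^ 2 / r t) (Ioo 0 1) :=
    (hs.pow 2).continuousOn.div hrc.continuousOn fun t ht => (hrpos t ht).ne'
  refine ⟨L, r, c, s, κ, ⟨hc, hs, hunit, fun t => rfl, ?_, hrpos, hκl, ?_, ?_, ?_, ?_, ?_⟩, hprof⟩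
  · have h1 := hr 1 (by simp)
    rw [h.right] at h1
    rcases mul_eq_zero.1 h1.symm with h2 | h2
    · exact absurd h2 hL.ne'
    · exact h2
  · refine LocInt.of_Icc fun a b ha hb => ?_
    -- Domination by `(c s' - s c')² ≤ 2 s'² + 2 c'²`.
    have h1 : IntegrableOn (fun t => 2 * (w t 1 / L) ^ 2 + 2 * (w t 0 / L) ^ 2) (Icc a b) :=
      (((hsq 1).integrableOn ha hb).const_mul 2).add (((hsq 0).integrableOn ha hb).const_mul 2)
    refine h1.mono' ((hκl.integrableOn ha hb).aestronglyMeasurable.pow 2) ?_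
    refine Eventually.of_forall fun t => ?_
    rw [Real.norm_eq_abs, abs_of_nonneg (sq_nonneg _)]
    have := hunit t
    simp only [κ]
    nlinarith [sq_nonneg (w t 1 / L * c t + w t 0 / L * s t), sq_nonneg (w t 1 / L * s t),
      sq_nonneg (w t 0 / L * c t), sq_nonneg (w t 1 / L * s t + w t 0 / L * c t),
      sq_nonneg (w t 1 / L), sq_nonneg (w t 0 / L)]
  · intro ψ hψ
    rw [hwc ψ hψ, ← integral_neg]
    simp_rw [← mul_neg]
    apply integral_test_congr hψ
    filter_upwards [horth] with t ht ht'
    have h1 := ht ht'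
    have h2 := hunit t
    simp only [κ]
    linear_combination (-c t) * h1 + w t 0 / L * h2
  · intro ψ hψ
    rw [hws ψ hψ]
    congr 1
    apply integral_test_congr hψ
    filter_upwards [horth] with t ht ht'
    have h1 := ht ht'
    have h2 := hunit t
    simp only [κ]
    linear_combination (s t) * h1 - w t 1 / L * h2
  · refine hint.mono' ((hκm.pow 2).mul hrc.aestronglyMeasurable) ?_
    rw [ae_restrict_iff' measurableSet_Ioo]
    refine Eventually.of_forall fun t ht => ?_
    have h1 := (hrpos t ht).le
    rw [Real.norm_eq_abs, abs_of_nonneg (by positivity)]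
    have : 0 ≤ s t ^ 2 / r t := by positivity
    linarith
  · refine hint.mono' (hsm.aestronglyMeasurable measurableSet_Ioo) ?_
    rw [ae_restrict_iff' measurableSet_Ioo]
    refine Eventually.of_forall fun t ht => ?_
    have h1 := (hrpos t ht).le
    rw [Real.norm_eq_abs, abs_of_nonneg (by positivity)]
    have : 0 ≤ κ t ^ 2 * r t := by positivity
    linarith

/-! ### Reduction to a scale-free minimisation problem. -/

theorem unitWillmore_nonneg {r c s κ : ℝ → ℝ} (h : UnitProfile r c s κ) :
    0 ≤ unitWillmore r s κ := by
  apply intervalIntegral.integral_nonneg zero_le_one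
  intro t ht
  have := h.r_nonneg ht
  positivity

theorem willmore_nonneg {γ : ℝ → E2} (h : Admissible γ) : 0 ≤ willmore γ := by
  obtain ⟨L, r, c, s, κ, h1, h2⟩ := h.exists_unitProfile
  rw [h2.willmore_eq]
  have := unitWillmore_nonneg h1
  positivity

/-- The unit speed data of a minimiser minimise the normalised energy at fixed isoperimetric
ratio. -/
theorem exists_minimal_unitProfile {σ : ℝ} (hσ : 0 < σ) {γ : ℝ → E2} (hγ : γ ∈ Class σ)
    (hmin : willmore γ = beta σ) : ∃ L r c s κ, UnitProfile r c s κ ∧ HasUnitProfile γ L r c s κ ∧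
      unitVol r s ≠ 0 ∧ ∀ r' c' s' κ', UnitProfile r' c' s' κ' →
        unitVol r' s' ^ 2 * unitArea r ^ 3 = unitVol r s ^ 2 * unitArea r' ^ 3 →
        unitWillmore r s κ ≤ unitWillmore r' s' κ' := by
  obtain ⟨hadm, harea, hvol⟩ := hγ
  obtain ⟨L, r, c, s, κ, h1, h2⟩ := hadm.exists_unitProfile
  have hπ := Real.pi_pos
  refine ⟨L, r, c, s, κ, h1, h2, ?_, ?_⟩
  · intro h0
    rw [h2.vol_eq, h0] at hvol
    have : 0 < σ / (6 * Real.sqrt Real.pi) := by positivity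
    rw [← hvol] at this
    simp at this
  intro r' c' s' κ' h' hV
  have hA := h1.unitArea_pos
  have hA' := h'.unitArea_pos
  -- The length for which the competitor has area `1`, since the area is `2π L'²` times the
  -- normalised area.
  have hL' : 0 < (Real.sqrt (2 * Real.pi * unitArea r'))⁻¹ := by positivity
  obtain ⟨γ', hadm', hp'⟩ := h'.exists_admissible hL'
  set L' := (Real.sqrt (2 * Real.pi * unitArea r'))⁻¹ with hL'def
  have hL'sq : L' ^ 2 * (2 * Real.pi * unitArea r') = 1 := by
    rw [hL'def, inv_pow, Real.sq_sqrt (by positivity)]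
    field_simp
  have hLsq : L ^ 2 * (2 * Real.pi * unitArea r) = 1 := by
    rw [h2.area_eq] at harea
    linarith
  -- With both areas equal to `1`, equality of the ratios `V²/A³` says that the squared volumes
  -- agree; squaring also removes the sign of the signed volume.
  have hvolsq : (L' ^ 3 * |unitVol r' s'|) ^ 2 = (L ^ 3 * |unitVol r s|) ^ 2 := by
    rw [mul_pow, mul_pow, sq_abs, sq_abs]
    have e1 : L' ^ 2 = (2 * Real.pi * unitArea r')⁻¹ := eq_inv_of_mul_eq_one_left hL'sq
    have e2 : L ^ 2 = (2 * Real.pi * unitArea r)⁻¹ := eq_inv_of_mul_eq_one_left hLsq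
    have e3 : (L' ^ 3) ^ 2 = (L' ^ 2) ^ 3 := by ring
    have e4 : (L ^ 3) ^ 2 = (L ^ 2) ^ 3 := by ring
    rw [e3, e4, e1, e2]
    field_simp
    linarith
  have hvol' : L' ^ 3 * |unitVol r' s'| = L ^ 3 * |unitVol r s| := by
    have p2 := h2.length_pos
    exact (sq_eq_sq₀ (by positivity) (by positivity)).1 hvolsq
  have hmem : γ' ∈ Class σ := by
    refine ⟨hadm', ?_, ?_⟩
    · rw [hp'.area_eq]; linarith
    · rw [hp'.vol_eq, hvol', ← h2.vol_eq, hvol]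
  have hle : willmore γ ≤ willmore γ' := by
    rw [hmin, beta]
    refine csInf_le ⟨0, ?_⟩ (mem_image_of_mem _ hmem)
    rintro _ ⟨δ, hδ, rfl⟩
    exact willmore_nonneg hδ.1
  rw [h2.willmore_eq, hp'.willmore_eq] at hle
  exact le_of_mul_le_mul_left hle (by positivity)

/-! ### A calculus of strict differentiability at `0`, uniform in a second variable. -/

/-- `f x t` is strictly differentiable in `x` at `0`, uniformly in `t ∈ S`, with derivative `D`. -/
structure UDiff {E : Type*} [NormedAddCommGroup E] (S : Set ℝ) (f D : E → ℝ → ℝ) : Prop where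
  -- Two moving points `x`, `y` are needed because the open mapping argument uses a strict
  -- derivative. `D` need not be linear here; linearity enters only when a strict Fréchet derivative
  -- is extracted.
  approx : ∀ η > 0, ∃ δ > 0, ∀ x y : E, ‖x‖ < δ → ‖y‖ < δ → ∀ t ∈ S,
    |f x t - f y t - D (x - y) t| ≤ η * ‖x - y‖
  bound_deriv : ∃ M, 0 ≤ M ∧ ∀ x, ∀ t ∈ S, |D x t| ≤ M * ‖x‖
  bound : ∃ M, 0 ≤ M ∧ ∀ t ∈ S, |f 0 t| ≤ M

namespace UDiff

variable {E : Type*} [NormedAddCommGroup E] {S : Set ℝ} {f g D D' : E → ℝ → ℝ}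

theorem congr_deriv (h : UDiff S f D) (hD : ∀ x, ∀ t ∈ S, D x t = D' x t) : UDiff S f D' := by
  refine ⟨fun η hη => ?_, ?_, h.bound⟩
  · obtain ⟨δ, hδ, H⟩ := h.approx η hη
    exact ⟨δ, hδ, fun x y hx hy t ht => by rw [← hD _ t ht]; exact H x y hx hy t ht⟩
  · obtain ⟨M, hM, H⟩ := h.bound_deriv
    exact ⟨M, hM, fun x t ht => by rw [← hD _ t ht]; exact H x t ht⟩

theorem congr (h : UDiff S f D) (hf : ∀ x, ∀ t ∈ S, f x t = g x t) : UDiff S g D := by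
  refine ⟨fun η hη => ?_, h.bound_deriv, ?_⟩
  · obtain ⟨δ, hδ, H⟩ := h.approx η hη
    exact ⟨δ, hδ, fun x y hx hy t ht => by
      rw [← hf x t ht, ← hf y t ht]; exact H x y hx hy t ht⟩
  · obtain ⟨M, hM, H⟩ := h.bound
    exact ⟨M, hM, fun t ht => by rw [← hf 0 t ht]; exact H t ht⟩

theorem lipschitz (h : UDiff S f D) : ∃ K > 0, ∃ δ > 0, ∀ x y : E, ‖x‖ < δ → ‖y‖ < δ → ∀ t ∈ S,
    |f x t - f y t| ≤ K * ‖x - y‖ := by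
  obtain ⟨δ, hδ, H⟩ := h.approx 1 one_pos
  obtain ⟨M, hM, H'⟩ := h.bound_deriv
  refine ⟨1 + M, by linarith, δ, hδ, fun x y hx hy t ht => ?_⟩
  have h1 := H x y hx hy t ht
  have h2 := H' (x - y) t ht
  calc |f x t - f y t| = |(f x t - f y t - D (x - y) t) + D (x - y) t| := by ring_nf
    _ ≤ |f x t - f y t - D (x - y) t| + |D (x - y) t| := abs_add_le _ _
    _ ≤ (1 + M) * ‖x - y‖ := by linarith

theorem near (h : UDiff S f D) {η : ℝ} (hη : 0 < η) : ∃ δ > 0, ∀ x : E, ‖x‖ < δ → ∀ t ∈ S,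
    |f x t - f 0 t| ≤ η := by
  obtain ⟨K, hK, δ, hδ, H⟩ := h.lipschitz
  refine ⟨min δ (η / K), lt_min hδ (div_pos hη hK), fun x hx t ht => ?_⟩
  have h1 := H x 0 (hx.trans_le (min_le_left _ _)) (by simpa using hδ) t ht
  have h2 : ‖x‖ ≤ η / K := (hx.trans_le (min_le_right _ _)).le
  rw [sub_zero] at h1
  calc _ ≤ K * ‖x‖ := h1
    _ ≤ K * (η / K) := by gcongr
    _ = η := by field_simp

theorem const {φ : ℝ → ℝ} (hφ : ∃ M, 0 ≤ M ∧ ∀ t ∈ S, |φ t| ≤ M) :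
    UDiff S (fun _ : E => φ) (fun _ _ => 0) :=
  ⟨fun η hη => ⟨1, one_pos, fun x y _ _ t _ => by simp; positivity⟩,
    ⟨0, le_rfl, fun x t _ => by simp⟩, hφ⟩

theorem bounded_of_continuous {a b : ℝ} {φ : ℝ → ℝ} (h : ContinuousOn φ (Icc a b)) :
    ∃ M, 0 ≤ M ∧ ∀ t ∈ Icc a b, |φ t| ≤ M := by
  obtain ⟨M, hM⟩ := isCompact_Icc.exists_bound_of_continuousOn h
  exact ⟨max M 0, le_max_right _ _, fun t ht => (hM t ht).trans (le_max_left _ _)⟩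

theorem add (hf : UDiff S f D) (hg : UDiff S g D') :
    UDiff S (fun x t => f x t + g x t) (fun x t => D x t + D' x t) := by
  refine ⟨fun η hη => ?_, ?_, ?_⟩
  · obtain ⟨δ, hδ, H⟩ := hf.approx (η / 2) (by linarith)
    obtain ⟨δ', hδ', H'⟩ := hg.approx (η / 2) (by linarith)
    refine ⟨min δ δ', lt_min hδ hδ', fun x y hx hy t ht => ?_⟩
    have h1 := H x y (hx.trans_le (min_le_left _ _)) (hy.trans_le (min_le_left _ _)) t ht
    have h2 := H' x y (hx.trans_le (min_le_right _ _)) (hy.trans_le (min_le_right _ _)) t ht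
    calc _ = |(f x t - f y t - D (x - y) t) + (g x t - g y t - D' (x - y) t)| := by ring_nf
      _ ≤ _ := abs_add_le _ _
      _ ≤ η * ‖x - y‖ := by linarith
  · obtain ⟨M, hM, H⟩ := hf.bound_deriv
    obtain ⟨M', hM', H'⟩ := hg.bound_deriv
    refine ⟨M + M', by linarith, fun x t ht => (abs_add_le _ _).trans ?_⟩
    linarith [H x t ht, H' x t ht]
  · obtain ⟨M, hM, H⟩ := hf.bound
    obtain ⟨M', hM', H'⟩ := hg.bound
    exact ⟨M + M', by linarith, fun t ht => (abs_add_le _ _).trans (by linarith [H t ht, H' t ht])⟩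

theorem mul (hf : UDiff S f D) (hg : UDiff S g D') :
    UDiff S (fun x t => f x t * g x t) (fun x t => D x t * g 0 t + f 0 t * D' x t) := by
  obtain ⟨A, hA, HA⟩ := hf.bound
  obtain ⟨B, hB, HB⟩ := hg.bound
  obtain ⟨A', hA', HA'⟩ := hf.bound_deriv
  obtain ⟨B', hB', HB'⟩ := hg.bound_deriv
  refine ⟨fun η hη => ?_, ⟨A' * B + A * B', by positivity, fun x t ht => ?_⟩,
    ⟨A * B, by positivity, fun t ht => ?_⟩⟩
  -- `Q` bounds all factors and derivatives involved, and the smallness `q` satisfies `q * Q ≤ η/4`,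
  -- one quarter for each of the four error terms below.
  · set Q := A + B + A' + B' + 2 with hQ
    have hQ0 : 0 < Q := by positivity
    have hq : 0 < min 1 (η / (4 * Q)) := by positivity
    set q := min 1 (η / (4 * Q)) with hqdef
    have hq1 : q ≤ 1 := min_le_left _ _
    have hqη : q * Q ≤ η / 4 := by
      have : q ≤ η / (4 * Q) := min_le_right _ _
      calc q * Q ≤ η / (4 * Q) * Q := by gcongr
        _ = η / 4 := by field_simp
    obtain ⟨δ₁, hδ₁, H₁⟩ := hf.approx q hq
    obtain ⟨δ₂, hδ₂, H₂⟩ := hg.approx q hq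
    obtain ⟨δ₃, hδ₃, H₃⟩ := hf.near hq
    obtain ⟨δ₄, hδ₄, H₄⟩ := hg.near hq
    refine ⟨min (min δ₁ δ₂) (min δ₃ δ₄), by positivity, fun x y hx hy t ht => ?_⟩
    simp only [lt_min_iff] at hx hy
    have h1 := H₁ x y hx.1.1 hy.1.1 t ht
    have h2 := H₂ x y hx.1.2 hy.1.2 t ht
    have h3 := H₃ y hy.2.1 t ht
    have h4 := H₄ x hx.2.2 t ht
    have n := norm_nonneg (x - y)
    have h5 : |g x t| ≤ Q := by
      have := abs_sub_abs_le_abs_sub (g x t) (g 0 t)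
      have := HB t ht
      linarith
    have h6 : |f y t| ≤ Q := by
      have := abs_sub_abs_le_abs_sub (f y t) (f 0 t)
      have := HA t ht
      linarith
    have h7 : |D (x - y) t| ≤ Q * ‖x - y‖ := (HA' _ t ht).trans (by gcongr; linarith)
    have h8 : |D' (x - y) t| ≤ Q * ‖x - y‖ := (HB' _ t ht).trans (by gcongr; linarith)
    have e : f x t * g x t - f y t * g y t - (D (x - y) t * g 0 t + f 0 t * D' (x - y) t)
      = ((f x t - f y t - D (x - y) t) * g x t + f y t * (g x t - g y t - D' (x - y) t))
        + (D (x - y) t * (g x t - g 0 t) + (f y t - f 0 t) * D' (x - y) t) := by ring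
    have b1 : |(f x t - f y t - D (x - y) t) * g x t| ≤ η / 4 * ‖x - y‖ := by
      rw [abs_mul]
      calc _ ≤ (q * ‖x - y‖) * Q := by gcongr
        _ = (q * Q) * ‖x - y‖ := by ring
        _ ≤ _ := by gcongr
    have b2 : |f y t * (g x t - g y t - D' (x - y) t)| ≤ η / 4 * ‖x - y‖ := by
      rw [abs_mul]
      calc _ ≤ Q * (q * ‖x - y‖) := by gcongr
        _ = (q * Q) * ‖x - y‖ := by ring
        _ ≤ _ := by gcongr
    have b3 : |D (x - y) t * (g x t - g 0 t)| ≤ η / 4 * ‖x - y‖ := by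
      rw [abs_mul]
      calc _ ≤ (Q * ‖x - y‖) * q := by gcongr
        _ = (q * Q) * ‖x - y‖ := by ring
        _ ≤ _ := by gcongr
    have b4 : |(f y t - f 0 t) * D' (x - y) t| ≤ η / 4 * ‖x - y‖ := by
      rw [abs_mul]
      calc _ ≤ q * (Q * ‖x - y‖) := by gcongr
        _ = (q * Q) * ‖x - y‖ := by ring
        _ ≤ _ := by gcongr
    rw [e]
    refine (abs_add_le _ _).trans ?_
    have c1 := abs_add_le ((f x t - f y t - D (x - y) t) * g x t)
      (f y t * (g x t - g y t - D' (x - y) t))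
    have c2 := abs_add_le (D (x - y) t * (g x t - g 0 t)) ((f y t - f 0 t) * D' (x - y) t)
    linarith
  · refine (abs_add_le _ _).trans ?_
    rw [abs_mul, abs_mul]
    calc _ ≤ (A' * ‖x‖) * B + A * (B' * ‖x‖) := by
          gcongr
          exacts [HA' x t ht, HB t ht, HA t ht, HB' x t ht]
      _ = _ := by ring
  · rw [abs_mul]
    gcongr
    exacts [HA t ht, HB t ht]

theorem const_mul {φ : ℝ → ℝ} (hφ : ∃ M, 0 ≤ M ∧ ∀ t ∈ S, |φ t| ≤ M) (hf : UDiff S f D) :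
    UDiff S (fun x t => φ t * f x t) (fun x t => φ t * D x t) :=
  ((const hφ).mul hf).congr_deriv fun x t _ => by ring

theorem inv (hf : UDiff S f D) {m : ℝ} (hm : 0 < m) (h : ∀ t ∈ S, m ≤ f 0 t) :
    UDiff S (fun x t => (f x t)⁻¹) (fun x t => -(D x t) / f 0 t ^ 2) := by
  obtain ⟨A', hA', HA'⟩ := hf.bound_deriv
  have low : ∃ δ > 0, ∀ x : E, ‖x‖ < δ → ∀ t ∈ S, m / 2 ≤ f x t := by
    obtain ⟨δ, hδ, H⟩ := hf.near (half_pos hm)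
    refine ⟨δ, hδ, fun x hx t ht => ?_⟩
    have := abs_le.1 (H x hx t ht)
    linarith [h t ht]
  refine ⟨fun η hη => ?_, ⟨A' / m ^ 2, by positivity, fun x t ht => ?_⟩,
    ⟨m⁻¹, by positivity, fun t ht => ?_⟩⟩
  · obtain ⟨K, hK, δ₁, hδ₁, H₁⟩ := hf.lipschitz
    obtain ⟨δ₂, hδ₂, H₂⟩ := low
    obtain ⟨δ₃, hδ₃, H₃⟩ := hf.approx (η * m ^ 2 / 2) (by positivity)
    set q := η * m ^ 3 / (16 * (A' + 1)) with hq
    have hq0 : 0 < q := by positivity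
    obtain ⟨δ₄, hδ₄, H₄⟩ := hf.near hq0
    set q' := η * m ^ 2 / 8
    obtain ⟨δ₅, hδ₅, H₅⟩ := hf.approx q' (by positivity)
    refine ⟨min (min δ₁ δ₂) (min δ₄ δ₅), by positivity, fun x y hx hy t ht => ?_⟩
    simp only [lt_min_iff] at hx hy
    have hx2 := H₂ x hx.1.2 t ht
    have hy2 := H₂ y hy.1.2 t ht
    have h0 := h t ht
    have hx4 := H₄ x hx.2.1 t ht
    have hy4 := H₄ y hy.2.1 t ht
    have h5 := H₅ x y hx.2.2 hy.2.2 t ht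
    have hD := HA' (x - y) t ht
    have n := norm_nonneg (x - y)
    have px : 0 < f x t := by linarith
    have py : 0 < f y t := by linarith
    have p0 : 0 < f 0 t := by linarith
    -- The remainder is the linearisation error of `f` divided by `f x * f y`, plus `D (x - y)`
    -- times `1/f(0)² - 1/(f x * f y)`.
    have e : (f x t)⁻¹ - (f y t)⁻¹ - -(D (x - y) t) / f 0 t ^ 2
      = -(f x t - f y t - D (x - y) t) / (f x t * f y t)
        + D (x - y) t * ((f x t - f 0 t) / (f x t * f 0 t ^ 2)
          + (f y t - f 0 t) / (f x t * f y t * f 0 t)) := by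
      field_simp
      ring
    rw [e]
    have b1 : |-(f x t - f y t - D (x - y) t) / (f x t * f y t)| ≤ η / 2 * ‖x - y‖ := by
      rw [abs_div, abs_neg, abs_of_pos (mul_pos px py), div_le_iff₀ (mul_pos px py)]
      calc _ ≤ q' * ‖x - y‖ := h5
        _ = η / 2 * ‖x - y‖ * (m / 2 * (m / 2)) := by simp only [q']; ring
        _ ≤ _ := by gcongr
    have b2 : |(f x t - f 0 t) / (f x t * f 0 t ^ 2)| ≤ η / (4 * (A' + 1)) := by
      have hp : 0 < f x t * f 0 t ^ 2 := by positivity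
      rw [abs_div, abs_of_pos hp, div_le_iff₀ hp]
      calc _ ≤ q := hx4
        _ ≤ η / (4 * (A' + 1)) * (m / 2 * m ^ 2) := by
          rw [hq]
          have : η / (4 * (A' + 1)) * (m / 2 * m ^ 2) = η * m ^ 3 / (8 * (A' + 1)) := by
            field_simp; ring
          rw [this]
          gcongr
          norm_num
        _ ≤ _ := by gcongr
    have b3 : |(f y t - f 0 t) / (f x t * f y t * f 0 t)| ≤ η / (4 * (A' + 1)) := by
      have hp : 0 < f x t * f y t * f 0 t := by positivity
      rw [abs_div, abs_of_pos hp, div_le_iff₀ hp]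
      calc _ ≤ q := hy4
        _ = η / (4 * (A' + 1)) * (m / 2 * (m / 2) * m) := by
          rw [hq]
          field_simp; ring
        _ ≤ _ := by gcongr
    have b4 : |D (x - y) t * ((f x t - f 0 t) / (f x t * f 0 t ^ 2)
          + (f y t - f 0 t) / (f x t * f y t * f 0 t))| ≤ η / 2 * ‖x - y‖ := by
      rw [abs_mul]
      calc _ ≤ (A' * ‖x - y‖) * (η / (4 * (A' + 1)) + η / (4 * (A' + 1))) := by
            gcongr
            exact (abs_add_le _ _).trans (add_le_add b2 b3)
        _ = A' / (A' + 1) * (η / 2 * ‖x - y‖) := by field_simp; ring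
        _ ≤ 1 * (η / 2 * ‖x - y‖) := by
            gcongr
            rw [div_le_one (by positivity)]; linarith
        _ = _ := one_mul _
    refine (abs_add_le _ _).trans ?_
    linarith
  · have h0 := h t ht
    have p0 : 0 < f 0 t := by linarith
    rw [abs_div, abs_neg, abs_of_pos (by positivity : 0 < f 0 t ^ 2), div_mul_eq_mul_div]
    gcongr
    exact HA' x t ht
  · have h0 := h t ht
    rw [abs_of_pos (inv_pos.2 (hm.trans_le h0))]
    gcongr

/-- The error is at most the uniform error times `∫ |g|`. The weight `g` need only be integrable,
which allows `κ` and `κ²`. Limits depending on `t` cover primitives and, for constant limits, plain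
integrals. -/
theorem integral {a b : ℝ} (hab : a ≤ b) (hf : UDiff (Icc a b) f D) {g : ℝ → ℝ}
    (hg : IntervalIntegrable g volume a b)
    (hfc : ∃ δ > 0, ∀ x : E, ‖x‖ < δ → ContinuousOn (f x) (Icc a b)) (hDc : ∀ x, ContinuousOn (D x) (Icc a b))
    {S : Set ℝ} {u v : ℝ → ℝ} (hu : ∀ t ∈ S, u t ∈ Icc a b) (hv : ∀ t ∈ S, v t ∈ Icc a b) :
    UDiff S (fun x t => ∫ y in u t..v t, g y * f x y) (fun x t => ∫ y in u t..v t, g y * D x y) := by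
  set I := ∫ y in a..b, |g y| with hI
  have hI0 : 0 ≤ I := intervalIntegral.integral_nonneg hab fun _ _ => abs_nonneg _
  have hsub : ∀ t ∈ S, uIcc (u t) (v t) ⊆ Icc a b := fun t ht =>
    ordConnected_Icc.uIcc_subset (hu t ht) (hv t ht)
  have hint : ∀ t ∈ S, ∀ φ : ℝ → ℝ, ContinuousOn φ (Icc a b) →
      IntervalIntegrable (fun y => g y * φ y) volume (u t) (v t) := fun t ht φ hφ =>
    (hg.mono_set (by rw [uIcc_of_le hab]; exact hsub t ht)).mul_continuousOn (hφ.mono (hsub t ht))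
  have key : ∀ t ∈ S, ∀ φ : ℝ → ℝ, ∀ M : ℝ, (∀ y ∈ Icc a b, |φ y| ≤ M) → 0 ≤ M →
      |∫ y in u t..v t, g y * φ y| ≤ M * I := by
    intro t ht φ M hφ hM
    have h1 : |∫ y in u t..v t, g y * φ y| ≤ |∫ y in u t..v t, (M * |g y|)| := by
      have := intervalIntegral.norm_integral_le_abs_of_norm_le (f := fun y => g y * φ y)
        (g := fun y => M * |g y|) (a := u t) (b := v t) (μ := volume) ?_ ?_
      · simpa using this
      · rw [ae_restrict_iff' measurableSet_uIoc]
        refine Eventually.of_forall fun y hy => ?_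
        rw [Real.norm_eq_abs, abs_mul, mul_comm]
        gcongr
        exact hφ y (hsub t ht (uIoc_subset_uIcc hy))
      · exact ((hg.mono_set (by rw [uIcc_of_le hab]; exact hsub t ht)).abs).const_mul M
    refine h1.trans ?_
    rw [intervalIntegral.integral_const_mul, abs_mul, abs_of_nonneg hM]
    gcongr
    have h2 := intervalIntegral.abs_integral_mono_interval (f := fun y => |g y|) (c := a) (d := b)
      (a := u t) (b := v t) (μ := volume) ?_ (Eventually.of_forall fun _ => abs_nonneg _) hg.abs
    · rwa [← hI, abs_of_nonneg hI0] at h2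
    · rw [uIoc_of_le hab]
      have h3 := hu t ht
      have h4 := hv t ht
      intro y hy
      rw [mem_uIoc] at hy
      rcases hy with hy | hy
      · exact ⟨by linarith [h3.1], by linarith [h4.2]⟩
      · exact ⟨by linarith [h4.1], by linarith [h3.2]⟩
  refine ⟨fun η hη => ?_, ?_, ?_⟩
  · obtain ⟨δ, hδ, H⟩ := hf.approx (η / (I + 1)) (by positivity)
    obtain ⟨δ', hδ', hfc⟩ := hfc
    refine ⟨min δ δ', lt_min hδ hδ', fun x y hx hy t ht => ?_⟩
    simp only [lt_min_iff] at hx hy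
    rw [← intervalIntegral.integral_sub (hint t ht _ (hfc x hx.2)) (hint t ht _ (hfc y hy.2)),
      ← intervalIntegral.integral_sub ((hint t ht _ (hfc x hx.2)).sub (hint t ht _ (hfc y hy.2)))
        (hint t ht _ (hDc _))]
    have e : ∀ z, g z * f x z - g z * f y z - g z * D (x - y) z
      = g z * (f x z - f y z - D (x - y) z) := fun z => by ring
    simp_rw [e]
    refine (key t ht _ _ (H x y hx.1 hy.1) (by positivity)).trans ?_
    calc η / (I + 1) * ‖x - y‖ * I = I / (I + 1) * (η * ‖x - y‖) := by ring
      _ ≤ 1 * (η * ‖x - y‖) := by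
          gcongr
          rw [div_le_one (by positivity)]; linarith
      _ = _ := one_mul _
  · obtain ⟨M, hM, H⟩ := hf.bound_deriv
    refine ⟨M * I, by positivity, fun x t ht => ?_⟩
    refine (key t ht _ _ (H x) (by positivity)).trans (le_of_eq (by ring))
  · obtain ⟨M, hM, H⟩ := hf.bound
    exact ⟨M * I, by positivity, fun t ht => key t ht _ _ H hM⟩

/-- At angle `0` the cosine is stationary: its increment is a product of two sines, one small and
the other at most a multiple of `‖x - y‖`. -/
theorem cos (hf : UDiff S f f) (h0 : ∀ t ∈ S, f 0 t = 0) :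
    UDiff S (fun x t => Real.cos (f x t)) (fun _ _ => 0) := by
  refine ⟨fun η hη => ?_, ⟨0, le_rfl, fun x t _ => by simp⟩,
    ⟨1, zero_le_one, fun t _ => Real.abs_cos_le_one _⟩⟩
  obtain ⟨K, hK, δ, hδ, H⟩ := hf.lipschitz
  obtain ⟨δ', hδ', H'⟩ := hf.near (show 0 < η / K by positivity)
  refine ⟨min δ δ', lt_min hδ hδ', fun x y hx hy t ht => ?_⟩
  simp only [lt_min_iff] at hx hy
  have h1 := H x y hx.1 hy.1 t ht
  have hx' := H' x hx.2 t ht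
  have hy' := H' y hy.2 t ht
  rw [h0 t ht, sub_zero] at hx' hy'
  rw [sub_zero, Real.cos_sub_cos, abs_mul, abs_mul]
  have s1 : |Real.sin ((f x t + f y t) / 2)| ≤ η / K := by
    refine Real.abs_sin_le_abs.trans ?_
    rw [abs_div, abs_two]
    linarith [abs_add_le (f x t) (f y t)]
  have s2 : |Real.sin ((f x t - f y t) / 2)| ≤ K * ‖x - y‖ / 2 := by
    refine Real.abs_sin_le_abs.trans ?_
    rw [abs_div, abs_two]
    linarith
  calc |(-2 : ℝ)| * |Real.sin ((f x t + f y t) / 2)| * |Real.sin ((f x t - f y t) / 2)|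
      ≤ 2 * (η / K) * (K * ‖x - y‖ / 2) := by
        gcongr
        norm_num
    _ = η * ‖x - y‖ := by field_simp

theorem sin (hf : UDiff S f f) (h0 : ∀ t ∈ S, f 0 t = 0)
    (hadd : ∀ x y t, f (x - y) t = f x t - f y t) :
    UDiff S (fun x t => Real.sin (f x t)) f := by
  refine ⟨fun η hη => ?_, hf.bound_deriv, ⟨1, zero_le_one, fun t _ => Real.abs_sin_le_one _⟩⟩
  obtain ⟨K, hK, δ, hδ, H⟩ := hf.lipschitz
  obtain ⟨δ', hδ', H'⟩ := hf.near (show 0 < min 1 (η / K) by positivity)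
  refine ⟨min δ δ', lt_min hδ hδ', fun x y hx hy t ht => ?_⟩
  simp only [lt_min_iff] at hx hy
  have h1 := H x y hx.1 hy.1 t ht
  have hx' := H' x hx.2 t ht
  have hy' := H' y hy.2 t ht
  rw [h0 t ht, sub_zero] at hx' hy'
  rw [hadd]
  set q := min 1 (η / K)
  have hq1 : q ≤ 1 := min_le_left _ _
  have hqη : q ≤ η / K := min_le_right _ _
  -- On this interval `sin z - z` has derivative of size `1 - cos z ≤ z²/2`, and `q ≤ 1` bounds `z²`
  -- by `q`.
  have key : ∀ z ∈ Icc (-q) q, ‖deriv (fun z => Real.sin z - z) z‖ ≤ η / K := by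
    intro z hz
    have hd : HasDerivAt (fun z => Real.sin z - z) (Real.cos z - 1) z :=
      (Real.hasDerivAt_sin z).sub (hasDerivAt_id z)
    rw [hd.deriv, Real.norm_eq_abs, abs_sub_comm, abs_of_nonneg (by linarith [Real.cos_le_one z])]
    have h2 := Real.one_sub_sq_div_two_le_cos (x := z)
    have h3 : z ^ 2 ≤ q ^ 2 := sq_le_sq' hz.1 hz.2
    have hq0 : 0 ≤ q := by linarith [hz.1, hz.2]
    nlinarith
  have := (convex_Icc (-q) q).norm_image_sub_le_of_norm_deriv_le
    (f := fun z => Real.sin z - z) (x := f y t) (y := f x t)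
    (fun z _ => (Real.differentiable_sin.sub differentiable_id) z) key (abs_le.1 hy') (abs_le.1 hx')
  simp only [Real.norm_eq_abs] at this
  calc |Real.sin (f x t) - Real.sin (f y t) - (f x t - f y t)|
      = |Real.sin (f x t) - f x t - (Real.sin (f y t) - f y t)| := by ring_nf
    _ ≤ η / K * |f x t - f y t| := this
    _ ≤ η / K * (K * ‖x - y‖) := by gcongr
    _ = η * ‖x - y‖ := by field_simp

end UDiff

/-! ### Three-parameter rotations and their first variations. -/

/-- Linear combinations of a family of functions. -/
def comb (ψ : Fin 3 → ℝ → ℝ) (x : Fin 3 → ℝ) (t : ℝ) : ℝ := ∑ i, x i * ψ i t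

section comb

variable {ψ : Fin 3 → ℝ → ℝ}

theorem comb_zero (t : ℝ) : comb ψ 0 t = 0 := by simp [comb]

theorem comb_sub (x y : Fin 3 → ℝ) (t : ℝ) : comb ψ (x - y) t = comb ψ x t - comb ψ y t := by
  simp [comb, sub_mul]

theorem isTest_comb (hψ : ∀ i, IsTest (ψ i)) (x : Fin 3 → ℝ) : IsTest (comb ψ x) := by
  have : comb ψ x = fun t => (x 0 * ψ 0 t + x 1 * ψ 1 t) + x 2 * ψ 2 t := by
    ext t; simp [comb, Fin.sum_univ_three]
  rw [this]
  exact (((hψ 0).const_mul _).add ((hψ 1).const_mul _)).add ((hψ 2).const_mul _)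

theorem deriv_comb (hψ : ∀ i, IsTest (ψ i)) (x : Fin 3 → ℝ) :
    deriv (comb ψ x) = comb (fun i => deriv (ψ i)) x := by
  ext t
  have : HasDerivAt (comb ψ x) (comb (fun i => deriv (ψ i)) x t) t := by
    unfold comb
    exact HasDerivAt.fun_sum fun i _ => ((hψ i).hasDerivAt t).const_mul (x i)
  exact this.deriv

theorem uDiff_comb {p q : ℝ} (hψ : ∀ i, Continuous (ψ i)) :
    UDiff (Icc p q) (comb ψ) (comb ψ) := by
  have hb : ∀ i, ∃ M, 0 ≤ M ∧ ∀ t ∈ Icc p q, |ψ i t| ≤ M := fun i =>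
    UDiff.bounded_of_continuous (hψ i).continuousOn
  choose M hM hb using hb
  refine ⟨fun η hη => ⟨1, one_pos, fun x y _ _ t _ => ?_⟩, ⟨∑ i, M i,
    Finset.sum_nonneg fun i _ => hM i, fun x t ht => ?_⟩, ⟨0, le_rfl, fun t _ => by
      simp [comb_zero]⟩⟩
  · rw [comb_sub]; simp; positivity
  · rw [Finset.sum_mul]
    refine (Finset.abs_sum_le_sum_abs _ _).trans (Finset.sum_le_sum fun i _ => ?_)
    rw [abs_mul, mul_comm]
    gcongr
    exacts [hM i, hb i t ht, norm_le_pi_norm x i]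

end comb

namespace UnitProfile

variable {r c s κ : ℝ → ℝ} {ψ : Fin 3 → ℝ → ℝ}

/-- The distance to the axis along the rotated tangent field, kept fixed at `e`. -/
noncomputable def locR (r c s : ℝ → ℝ) (ψ : Fin 3 → ℝ → ℝ) (e : ℝ) (x : Fin 3 → ℝ) (t : ℝ) : ℝ :=
  r t + ∫ y in e..t, (rotC c s (comb ψ x) y - c y)

/-- The first variation of `locR`. -/
noncomputable def locRho (s : ℝ → ℝ) (ψ : Fin 3 → ℝ → ℝ) (e : ℝ) (x : Fin 3 → ℝ) (t : ℝ) : ℝ :=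
  ∫ y in e..t, -(s y * comb ψ x y)

theorem uDiff_rotC (h : UnitProfile r c s κ) (hψ : ∀ i, IsTest (ψ i)) (p q : ℝ) :
    UDiff (Icc p q) (fun x => rotC c s (comb ψ x)) (fun x t => -(s t * comb ψ x t)) := by
  have h1 := uDiff_comb (p := p) (q := q) fun i => (hψ i).continuous
  have hcos := h1.cos fun t _ => comb_zero t
  have hsin := h1.sin (fun t _ => comb_zero t) comb_sub
  have bc := UDiff.bounded_of_continuous (h.continuous_c.continuousOn (s := Icc p q))
  have bs := UDiff.bounded_of_continuous (h.continuous_s.neg.continuousOn (s := Icc p q))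
  refine ((hcos.const_mul bc).add (hsin.const_mul bs)).congr_deriv ?_ |>.congr ?_
  · intro x t _; simp only [Pi.neg_apply]; ring
  · intro x t _; simp only [Pi.neg_apply, rotC]; ring

theorem uDiff_rotS (h : UnitProfile r c s κ) (hψ : ∀ i, IsTest (ψ i)) (p q : ℝ) :
    UDiff (Icc p q) (fun x => rotS c s (comb ψ x)) (fun x t => c t * comb ψ x t) := by
  have h1 := uDiff_comb (p := p) (q := q) fun i => (hψ i).continuous
  have hcos := h1.cos fun t _ => comb_zero t
  have hsin := h1.sin (fun t _ => comb_zero t) comb_sub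
  have bc := UDiff.bounded_of_continuous (h.continuous_c.continuousOn (s := Icc p q))
  have bs := UDiff.bounded_of_continuous (h.continuous_s.continuousOn (s := Icc p q))
  refine ((hcos.const_mul bs).add (hsin.const_mul bc)).congr_deriv ?_ |>.congr ?_
  · intro x t _; ring
  · intro x t _; rw [rotS]

theorem continuous_locR (h : UnitProfile r c s κ) (hψ : ∀ i, IsTest (ψ i)) (e : ℝ)
    (x : Fin 3 → ℝ) : Continuous (locR r c s ψ e x) := by
  refine h.continuous_r.add ?_
  apply intervalIntegral.continuous_primitive
  intro a b
  exact ((continuous_rotC h.continuous_c h.continuous_s (isTest_comb hψ x).continuous).sub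
    h.continuous_c).intervalIntegrable _ _

theorem hasDerivAt_locRho (h : UnitProfile r c s κ) (hψ : ∀ i, IsTest (ψ i)) (e : ℝ)
    (x : Fin 3 → ℝ) (t : ℝ) : HasDerivAt (locRho s ψ e x) (-(s t * comb ψ x t)) t := by
  have : Continuous fun y => -(s y * comb ψ x y) :=
    (h.continuous_s.mul (isTest_comb hψ x).continuous).neg
  exact intervalIntegral.integral_hasDerivAt_right (this.intervalIntegrable _ _)
    this.stronglyMeasurable.stronglyMeasurableAtFilter this.continuousAt

theorem continuous_locRho (h : UnitProfile r c s κ) (hψ : ∀ i, IsTest (ψ i)) (e : ℝ)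
    (x : Fin 3 → ℝ) : Continuous (locRho s ψ e x) :=
  continuous_iff_continuousAt.2 fun t => (h.hasDerivAt_locRho hψ e x t).continuousAt

theorem locR_zero (e t : ℝ) : locR r c s ψ e 0 t = r t := by
  simp [locR, rotC, comb_zero]

/-- The anchor `e` is later the end of the common support on the side considered. Each half of the
curve is thus varied from its own pole and makes sense before the closing condition is imposed. -/
theorem uDiff_locR (h : UnitProfile r c s κ) (hψ : ∀ i, IsTest (ψ i)) {p q e : ℝ}
    (he : e ∈ Icc p q) : UDiff (Icc p q) (locR r c s ψ e) (locRho s ψ e) := by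
  have bc := UDiff.bounded_of_continuous (h.continuous_c.neg.continuousOn (s := Icc p q))
  have br := UDiff.bounded_of_continuous (h.continuous_r.continuousOn (s := Icc p q))
  have h1 := (h.uDiff_rotC hψ p q).add (UDiff.const bc)
  have h2 := h1.integral (he.1.trans he.2) (g := fun _ => 1) intervalIntegrable_const
    ⟨1, one_pos, fun x _ => ((continuous_rotC h.continuous_c h.continuous_s
      (isTest_comb hψ x).continuous).add h.continuous_c.neg).continuousOn⟩
    (fun x => ((h.continuous_s.mul (isTest_comb hψ x).continuous).neg.add
      continuous_const).continuousOn) (S := Icc p q) (u := fun _ => e) (v := id)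
    (fun _ _ => he) (fun _ ht => ht)
  refine ((UDiff.const br).add h2).congr_deriv ?_ |>.congr ?_
  · intro x t _; simp [locRho]
  · intro x t _; simp [locR, sub_eq_add_neg]

/-- The area of the varied surface between `p` and `q`. -/
noncomputable def locA (r c s : ℝ → ℝ) (ψ : Fin 3 → ℝ → ℝ) (p q e : ℝ) (x : Fin 3 → ℝ) : ℝ :=
  ∫ t in p..q, locR r c s ψ e x t

/-- The volume of the varied surface between `p` and `q`. -/
noncomputable def locV (r c s : ℝ → ℝ) (ψ : Fin 3 → ℝ → ℝ) (p q e : ℝ) (x : Fin 3 → ℝ) : ℝ :=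
  ∫ t in p..q, locR r c s ψ e x t ^ 2 * rotS c s (comb ψ x) t

/-- The Willmore energy of the varied surface between `p` and `q`, expanded in powers of the
curvature. -/
noncomputable def locW (r c s κ : ℝ → ℝ) (ψ : Fin 3 → ℝ → ℝ) (p q e : ℝ) (x : Fin 3 → ℝ) : ℝ :=
  (∫ t in p..q, κ t ^ 2 * locR r c s ψ e x t)
  + (∫ t in p..q, κ t * (2 * (deriv (comb ψ x) t * locR r c s ψ e x t + rotS c s (comb ψ x) t)))
  + ∫ t in p..q, (deriv (comb ψ x) t ^ 2 * locR r c s ψ e x t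
      + 2 * (deriv (comb ψ x) t * rotS c s (comb ψ x) t)
      + rotS c s (comb ψ x) t ^ 2 * (locR r c s ψ e x t)⁻¹)

theorem uDiff_locA (h : UnitProfile r c s κ) (hψ : ∀ i, IsTest (ψ i)) {p q e : ℝ}
    (he : e ∈ Icc p q) : UDiff {0} (fun x _ => locA r c s ψ p q e x)
      (fun x _ => ∫ t in p..q, locRho s ψ e x t) := by
  have hpq := he.1.trans he.2
  have := (h.uDiff_locR hψ he).integral hpq (g := fun _ => 1) intervalIntegrable_const
    ⟨1, one_pos, fun x _ => (h.continuous_locR hψ e x).continuousOn⟩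
    (fun x => (h.continuous_locRho hψ e x).continuousOn) (S := {0}) (u := fun _ => p)
    (v := fun _ => q) (fun _ _ => left_mem_Icc.2 hpq) (fun _ _ => right_mem_Icc.2 hpq)
  simpa [locA] using this

theorem uDiff_locV (h : UnitProfile r c s κ) (hψ : ∀ i, IsTest (ψ i)) {p q e : ℝ}
    (he : e ∈ Icc p q) : UDiff {0} (fun x _ => locV r c s ψ p q e x)
      (fun x _ => ∫ t in p..q, (2 * r t * s t * locRho s ψ e x t
        + r t ^ 2 * c t * comb ψ x t)) := by
  have hpq := he.1.trans he.2
  have h1 := h.uDiff_locR hψ he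
  have h2 := ((h1.mul h1).mul (h.uDiff_rotS hψ p q)).congr_deriv
    (D' := fun x t => 2 * r t * s t * locRho s ψ e x t + r t ^ 2 * c t * comb ψ x t) (by
      intro x t _
      rw [locR_zero, rotS_eq_of_eq_zero (comb_zero t)]; ring)
  have hc := h.continuous_c
  have hs := h.continuous_s
  have hr := h.continuous_r
  have := h2.integral hpq (g := fun _ => 1) intervalIntegrable_const
    ⟨1, one_pos, fun x _ => (((h.continuous_locR hψ e x).mul (h.continuous_locR hψ e x)).mul
      (continuous_rotS hc hs (isTest_comb hψ x).continuous)).continuousOn⟩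
    (fun x => by
      have h3 := h.continuous_locRho hψ e x
      have h4 := (isTest_comb hψ x).continuous
      exact Continuous.continuousOn (by fun_prop)) (S := {0}) (u := fun _ => p)
    (v := fun _ => q) (fun _ _ => left_mem_Icc.2 hpq) (fun _ _ => right_mem_Icc.2 hpq)
  simpa [locV, sq] using this

theorem exists_lower_bound (h : UnitProfile r c s κ) {p q : ℝ} (hp : 0 < p) (hq : q < 1) :
    ∃ m > 0, ∀ t ∈ Icc p q, m ≤ r t := by
  rcases le_or_gt p q with hpq | hpq
  · obtain ⟨x, hx, hx'⟩ := isCompact_Icc.exists_isMinOn (nonempty_Icc.2 hpq)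
      h.continuous_r.continuousOn
    exact ⟨r x, h.r_pos x ⟨hp.trans_le hx.1, hx.2.trans_lt hq⟩, fun t ht => hx' ht⟩
  · exact ⟨1, one_pos, fun t ht => by simp [Icc_eq_empty_of_lt hpq] at ht⟩

theorem locR_pos (h : UnitProfile r c s κ) (hψ : ∀ i, IsTest (ψ i)) {p q e : ℝ}
    (he : e ∈ Icc p q) (hp : 0 < p) (hq : q < 1) :
    ∃ δ > 0, ∀ x : Fin 3 → ℝ, ‖x‖ < δ → ∀ t ∈ Icc p q, 0 < locR r c s ψ e x t := by
  obtain ⟨m, hm, hm'⟩ := h.exists_lower_bound hp hq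
  obtain ⟨δ, hδ, H⟩ := (h.uDiff_locR hψ he).near (half_pos hm)
  refine ⟨δ, hδ, fun x hx t ht => ?_⟩
  have h1 := abs_le.1 (H x hx t ht)
  rw [locR_zero] at h1
  linarith [hm' t ht]

/-- Expanding `(κ + Ψ' + S/R)² R` in powers of `κ` separates the rough fixed weights `κ²`, `κ`, `1`
from factors that depend on `x` uniformly differentiably. Away from the poles `r` is bounded below,
so the factor `1/R` is harmless. -/
theorem uDiff_locW (h : UnitProfile r c s κ) (hψ : ∀ i, IsTest (ψ i)) {p q e : ℝ}
    (he : e ∈ Icc p q) (hp : 0 < p) (hq : q < 1) :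
    UDiff {0} (fun x _ => locW r c s κ ψ p q e x)
      (fun x _ => (∫ t in p..q, κ t ^ 2 * locRho s ψ e x t)
        + (∫ t in p..q, κ t * (2 * (deriv (comb ψ x) t * r t + c t * comb ψ x t)))
        + ∫ t in p..q, (2 * (deriv (comb ψ x) t * s t) + 2 * s t * c t / r t * comb ψ x t
          - s t ^ 2 / r t ^ 2 * locRho s ψ e x t)) := by
  have hpq := he.1.trans he.2
  have mp : p ∈ Ioo (0 : ℝ) 1 := ⟨hp, hpq.trans_lt hq⟩
  have mq : q ∈ Ioo (0 : ℝ) 1 := ⟨hp.trans_le hpq, hq⟩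
  obtain ⟨m, hm, hm'⟩ := h.exists_lower_bound hp hq
  obtain ⟨δ, hδ, hpos⟩ := h.locR_pos hψ he hp hq
  have hc := h.continuous_c
  have hs := h.continuous_s
  have hr := h.continuous_r
  have hR := h.continuous_locR hψ e
  have hρ := h.continuous_locRho hψ e
  have hS := fun x => continuous_rotS hc hs (isTest_comb hψ x).continuous
  have hΨ := fun x => (isTest_comb hψ x).continuous
  have hdΨ := fun x => (isTest_comb hψ x).deriv.continuous
  have dR := h.uDiff_locR hψ he
  have dS := h.uDiff_rotS hψ p q
  have dΨ : UDiff (Icc p q) (fun x => deriv (comb ψ x)) (fun x => deriv (comb ψ x)) := by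
    have := uDiff_comb (p := p) (q := q) fun i => (hψ i).deriv.continuous
    have e : (fun x => deriv (comb ψ x)) = comb fun i => deriv (ψ i) := funext (deriv_comb hψ)
    rwa [e]
  have z0 : ∀ t, deriv (comb ψ 0) t = 0 := fun t => by rw [deriv_comb hψ, comb_zero]
  have z1 : ∀ t, rotS c s (comb ψ 0) t = s t := fun t => rotS_eq_of_eq_zero (comb_zero t)
  have i1 := dR.integral hpq (h.locInt_sq.intervalIntegrable mp mq)
    ⟨1, one_pos, fun x _ => (hR x).continuousOn⟩ (fun x => (hρ x).continuousOn) (S := {0})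
    (u := fun _ => p) (v := fun _ => q) (fun _ _ => left_mem_Icc.2 hpq)
    (fun _ _ => right_mem_Icc.2 hpq)
  have b2 : ∃ M, 0 ≤ M ∧ ∀ t ∈ Icc p q, |(fun _ : ℝ => (2 : ℝ)) t| ≤ M :=
    ⟨2, by norm_num, fun t _ => by norm_num⟩
  have d2 := (((dΨ.mul dR).add dS).const_mul b2).congr_deriv
    (D' := fun x t => 2 * (deriv (comb ψ x) t * r t + c t * comb ψ x t)) (by
      intro x t _
      rw [locR_zero, z0]; ring)
  have i2 := d2.integral hpq (h.locInt.intervalIntegrable mp mq)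
    ⟨1, one_pos, fun x _ => (continuous_const.mul
      (((hdΨ x).mul (hR x)).add (hS x))).continuousOn⟩
    (fun x => (continuous_const.mul (((hdΨ x).mul hr).add (hc.mul (hΨ x)))).continuousOn) (S := {0})
    (u := fun _ => p) (v := fun _ => q) (fun _ _ => left_mem_Icc.2 hpq)
    (fun _ _ => right_mem_Icc.2 hpq)
  have hne : ∀ t ∈ Icc p q, r t ≠ 0 := fun t ht => (hm.trans_le (hm' t ht)).ne'
  have d3 := ((((dΨ.mul dΨ).mul dR).add ((dΨ.mul dS).const_mul b2)).add
    ((dS.mul dS).mul (dR.inv hm (fun t ht => by rw [locR_zero]; exact hm' t ht)))).congr_deriv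
    (D' := fun x t => 2 * (deriv (comb ψ x) t * s t) + 2 * s t * c t / r t * comb ψ x t
          - s t ^ 2 / r t ^ 2 * locRho s ψ e x t) (by
      intro x t ht
      have := hne t ht
      rw [locR_zero, z0, z1]
      field_simp
      ring)
  have i3 := d3.integral hpq (g := fun _ => 1) intervalIntegrable_const
    ⟨δ, hδ, fun x hx => (((((hdΨ x).mul (hdΨ x)).mul (hR x)).add
      (continuous_const.mul ((hdΨ x).mul (hS x)))).continuousOn).add
      (((hS x).mul (hS x)).continuousOn.mul ((hR x).continuousOn.inv₀
        fun t ht => (hpos x hx t ht).ne'))⟩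
    (fun x => by
      refine ((continuous_const.mul ((hdΨ x).mul hs)).continuousOn.add ?_).sub ?_
      · exact (((continuous_const.mul hs).mul hc).continuousOn.div hr.continuousOn hne).mul
          (hΨ x).continuousOn
      · exact ((hs.pow 2).continuousOn.div (hr.pow 2).continuousOn
          fun t ht => pow_ne_zero 2 (hne t ht)).mul (hρ x).continuousOn)
    (S := {0})
    (u := fun _ => p) (v := fun _ => q) (fun _ _ => left_mem_Icc.2 hpq)
    (fun _ _ => right_mem_Icc.2 hpq)
  have := (i1.add i2).add i3
  simpa only [locW, one_mul, sq] using this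

/-- The primitive vanishing at the midpoint. -/
noncomputable def primHalf (G : ℝ → ℝ) (t : ℝ) : ℝ := ∫ y in (1 / 2 : ℝ)..t, G y

/-- Integration by parts on each half: the boundary term at `1/2` vanishes because `primHalf G`
does, the one at `a` or `b` because `locRho` is anchored there. Splitting at the midpoint turns the
variation into a single integral against `comb ψ x` without assuming that the curve closes. -/
theorem integral_mul_locRho (h : UnitProfile r c s κ) (hψ : ∀ i, IsTest (ψ i)) {a b : ℝ}
    (ha : 0 < a) (ha' : a < 1 / 2) (hb' : 1 / 2 < b) (hb : b < 1)
    (hab : ∀ i, ∀ t ∉ Ioo a b, ψ i t = 0) {G : ℝ → ℝ} (hG : LocInt G) (x : Fin 3 → ℝ) :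
    (∫ t in a..(1 / 2), G t * locRho s ψ a x t) + (∫ t in (1 / 2)..b, G t * locRho s ψ b x t)
      = ∫ t, comb ψ x t * (s t * primHalf G t) := by
  have hz : ∀ t ∉ Ioo a b, comb ψ x t = 0 := fun t ht => by simp [comb, hab _ t ht]
  have hΨ := (isTest_comb hψ x).continuous
  have key : ∀ p q e, 0 < p → p ≤ 1 / 2 → 1 / 2 ≤ q → q < 1 →
      primHalf G p * locRho s ψ e x p = 0 → primHalf G q * locRho s ψ e x q = 0 →
      ∫ t in p..q, G t * locRho s ψ e x t = ∫ t in p..q, comb ψ x t * (s t * primHalf G t) := by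
    intro p q e hp hp2 hq2 hq h1 h2
    have hac : AbsolutelyContinuousOnInterval (primHalf G) p q :=
      hG.absolutelyContinuousOnInterval hp ⟨hp2, hq2⟩ hq
    have hρd := h.hasDerivAt_locRho hψ e x
    have hρ : AbsolutelyContinuousOnInterval (locRho s ψ e x) p q := by
      apply ContDiffOn.absolutelyContinuousOnInterval
      refine ContDiff.contDiffOn ?_
      rw [contDiff_one_iff_deriv]
      refine ⟨fun t => (hρd t).differentiableAt, ?_⟩
      rw [show deriv (locRho s ψ e x) = _ from funext fun t => (hρd t).deriv]
      exact (h.continuous_s.mul hΨ).neg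
    have ibp := hρ.integral_mul_deriv_eq_deriv_mul hac
    have e1 : ∫ t in p..q, locRho s ψ e x t * deriv (primHalf G) t
        = ∫ t in p..q, G t * locRho s ψ e x t := by
      apply intervalIntegral.integral_congr_ae
      filter_upwards [(hG.intervalIntegrable (a := p) (b := q) ⟨hp, by linarith⟩
        ⟨by linarith, hq⟩).ae_hasDerivAt_integral] with t ht ht'
      have := (ht (uIoc_subset_uIcc ht') (1 / 2)
        (by rw [uIcc_of_le (hp2.trans hq2)]; exact ⟨hp2, hq2⟩)).deriv
      unfold primHalf
      rw [this, mul_comm]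
    rw [e1, mul_comm, h2, mul_comm, h1] at ibp
    rw [ibp, sub_zero, zero_sub, ← intervalIntegral.integral_neg]
    apply intervalIntegral.integral_congr
    intro t _
    simp only [(hρd t).deriv]
    ring
  have hp0 : primHalf G (1 / 2) = 0 := by simp [primHalf]
  have hint : ∀ p q : ℝ, 0 < p → p < 1 → 0 < q → q < 1 →
      IntervalIntegrable (fun t => comb ψ x t * (s t * primHalf G t)) volume p q := by
    intro p q hp hp1 hq hq1
    apply ContinuousOn.intervalIntegrable
    have hsub : uIcc p q ⊆ Ioo (0 : ℝ) 1 := ordConnected_Ioo.uIcc_subset ⟨hp, hp1⟩ ⟨hq, hq1⟩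
    exact hΨ.continuousOn.mul (h.continuous_s.continuousOn.mul
      ((hG.continuousOn_integral (by norm_num)).mono hsub))
  rw [key a (1 / 2) a ha ha'.le le_rfl (by norm_num) (by simp [locRho])
      (by rw [hp0, zero_mul]),
    key (1 / 2) b b (by norm_num) le_rfl hb'.le hb (by rw [hp0, zero_mul]) (by simp [locRho]),
    intervalIntegral.integral_add_adjacent_intervals (hint _ _ ha (by linarith) (by norm_num)
      (by norm_num)) (hint _ _ (by norm_num) (by norm_num) (by linarith) hb)]
  exact (integral_eq_of_support fun t ht => by rw [hz t ht, zero_mul]).symm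

end UnitProfile

/-! ### First variations as linear functionals, and Lagrange multipliers. -/

/-- The space of test functions on `(0,1)`. -/
def testSpace : Submodule ℝ (ℝ → ℝ) where
  carrier := {ψ | IsTest ψ}
  add_mem' := fun h₁ h₂ => h₁.add h₂
  zero_mem' := IsTest.zero
  smul_mem' := fun x _ h => h.const_mul x

/-- The distribution given by a locally integrable function. -/
noncomputable def pairing (f : ℝ → ℝ) (hf : LocInt f) : testSpace →ₗ[ℝ] ℝ where
  toFun ψ := ∫ t, ψ.1 t * f t
  map_add' ψ χ := by
    rw [← integral_add (hf.integrable_mul ψ.2) (hf.integrable_mul χ.2)]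
    congr 1; ext t; simp [add_mul]
  map_smul' x ψ := by
    rw [RingHom.id_apply, smul_eq_mul, ← integral_const_mul]
    congr 1; ext t; simp [mul_assoc]

/-- Minus the distributional derivative of a locally integrable function. -/
noncomputable def pairingDeriv (f : ℝ → ℝ) (hf : LocInt f) : testSpace →ₗ[ℝ] ℝ where
  toFun ψ := ∫ t, deriv ψ.1 t * f t
  map_add' ψ χ := by
    rw [← integral_add (hf.integrable_mul (IsTest.deriv ψ.2))
      (hf.integrable_mul (IsTest.deriv χ.2))]
    congr 1; ext t
    have : deriv (ψ + χ : testSpace).1 t = deriv ψ.1 t + deriv χ.1 t :=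
      ((IsTest.hasDerivAt ψ.2 t).add (IsTest.hasDerivAt χ.2 t)).deriv
    rw [this, add_mul]
  map_smul' x ψ := by
    rw [RingHom.id_apply, smul_eq_mul, ← integral_const_mul]
    congr 1; ext t
    have : deriv (x • ψ : testSpace).1 t = x * deriv ψ.1 t :=
      ((IsTest.hasDerivAt ψ.2 t).const_mul x).deriv
    rw [this, mul_assoc]

theorem UDiff.hasStrictFDerivAt {E : Type*} [NormedAddCommGroup E] [NormedSpace ℝ E] {F : E → ℝ}
    {D : E →L[ℝ] ℝ} (h : UDiff {0} (fun x _ => F x) (fun x _ => D x)) :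
    HasStrictFDerivAt F D 0 := by
  rw [hasStrictFDerivAt_iff_isLittleO, Asymptotics.isLittleO_iff]
  intro η hη
  obtain ⟨δ, hδ, H⟩ := h.approx η hη
  have : Metric.ball (0 : E) δ ×ˢ Metric.ball (0 : E) δ ∈ 𝓝 ((0 : E), (0 : E)) :=
    prod_mem_nhds (Metric.ball_mem_nhds _ hδ) (Metric.ball_mem_nhds _ hδ)
  filter_upwards [this] with p hp
  exact H p.1 p.2 (by simpa using hp.1) (by simpa using hp.2) 0 rfl

theorem integral_sub_integral_of_eq_outside {f g : ℝ → ℝ} {a b : ℝ} (ha : 0 ≤ a) (hab : a ≤ b)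
    (hb : b ≤ 1) (hf : IntervalIntegrable f volume 0 1) (hg : IntervalIntegrable g volume 0 1)
    (h : ∀ t ∈ Ioo (0 : ℝ) 1, t ∉ Ioo a b → f t = g t) :
    (∫ t in (0 : ℝ)..1, f t) - ∫ t in (0 : ℝ)..1, g t
      = (∫ t in a..b, f t) - ∫ t in a..b, g t := by
  have sub : ∀ {p q : ℝ}, 0 ≤ p → p ≤ q → q ≤ 1 → ∀ {φ : ℝ → ℝ}, IntervalIntegrable φ volume 0 1 →
      IntervalIntegrable φ volume p q := fun hp hpq hq _ hφ =>
    hφ.mono_set (by rw [uIcc_of_le hpq, uIcc_of_le zero_le_one]; exact Icc_subset_Icc hp hq)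
  have split : ∀ {φ : ℝ → ℝ}, IntervalIntegrable φ volume 0 1 → ∫ t in (0 : ℝ)..1, φ t
      = (∫ t in (0 : ℝ)..a, φ t) + (∫ t in a..b, φ t) + ∫ t in b..1, φ t := fun hφ => by
    rw [intervalIntegral.integral_add_adjacent_intervals (sub le_rfl ha (hab.trans hb) hφ)
      (sub ha hab hb hφ), intervalIntegral.integral_add_adjacent_intervals
      (sub le_rfl (ha.trans hab) hb hφ) (sub (ha.trans hab) hb le_rfl hφ)]
  have ne1 : ∀ᵐ t : ℝ, t ≠ 1 := by simp [ae_iff, measure_singleton]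
  have e1 : ∫ t in (0 : ℝ)..a, f t = ∫ t in (0 : ℝ)..a, g t := by
    apply intervalIntegral.integral_congr_ae
    filter_upwards [ne1] with t ht ht'
    rw [uIoc_of_le ha] at ht'
    exact h t ⟨ht'.1, lt_of_le_of_ne (by linarith [ht'.2]) ht⟩ (fun h' => by linarith [h'.1, ht'.2])
  have e2 : ∫ t in b..1, f t = ∫ t in b..1, g t := by
    apply intervalIntegral.integral_congr_ae
    filter_upwards [ne1] with t ht ht'
    rw [uIoc_of_le hb] at ht'
    exact h t ⟨by linarith [ht'.1], lt_of_le_of_ne ht'.2 ht⟩ (fun h' => by linarith [h'.2, ht'.1])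
  rw [split hf, split hg, e1, e2]
  ring

namespace UnitProfile

variable {r c s κ : ℝ → ℝ}

theorem continuousOn_primHalf {G : ℝ → ℝ} (hG : LocInt G) :
    ContinuousOn (primHalf G) (Ioo 0 1) := hG.continuousOn_integral (by norm_num)

theorem continuousOn_div_r (h : UnitProfile r c s κ) {f : ℝ → ℝ} (hf : Continuous f) :
    ContinuousOn (fun t => f t / r t) (Ioo 0 1) :=
  hf.continuousOn.div h.continuous_r.continuousOn fun t ht => (h.r_pos t ht).ne'

theorem locInt_potential (h : UnitProfile r c s κ) :
    LocInt (fun t => κ t ^ 2 - s t ^ 2 / r t ^ 2) :=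
  h.locInt_sq.sub (LocInt.of_continuousOn ((h.continuous_s.pow 2).continuousOn.div
    (h.continuous_r.pow 2).continuousOn fun t ht => pow_ne_zero 2 (h.r_pos t ht).ne'))

/-- The first variation of the Willmore energy. -/
noncomputable def varW (h : UnitProfile r c s κ) : testSpace →ₗ[ℝ] ℝ :=
  pairingDeriv (fun t => 2 * r t * κ t)
      (h.locInt_mul_curv (continuous_const.mul h.continuous_r))
    + pairing (fun t => 2 * s t * c t / r t
        + s t * primHalf (fun t => κ t ^ 2 - s t ^ 2 / r t ^ 2) t)
      (LocInt.of_continuousOn ((h.continuousOn_div_r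
        ((continuous_const.mul h.continuous_s).mul h.continuous_c)).add
        (h.continuous_s.continuousOn.mul (continuousOn_primHalf h.locInt_potential))))

/-- The first variation of the area. -/
noncomputable def varA (h : UnitProfile r c s κ) : testSpace →ₗ[ℝ] ℝ :=
  pairing (fun t => s t * primHalf (fun _ => 1) t) (LocInt.of_continuousOn
    (h.continuous_s.continuousOn.mul
      (continuousOn_primHalf (LocInt.of_continuousOn continuousOn_const))))

theorem locInt_two_mul (h : UnitProfile r c s κ) : LocInt (fun t => 2 * r t * s t) :=
  LocInt.of_continuousOn
    ((continuous_const.mul h.continuous_r).mul h.continuous_s).continuousOn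

/-- The first variation of the volume. -/
noncomputable def varV (h : UnitProfile r c s κ) : testSpace →ₗ[ℝ] ℝ :=
  pairing (fun t => r t ^ 2 * c t + s t * primHalf (fun t => 2 * r t * s t) t)
    (LocInt.of_continuousOn (((h.continuous_r.pow 2).mul h.continuous_c).continuousOn.add
      (h.continuous_s.continuousOn.mul (continuousOn_primHalf h.locInt_two_mul))))

/-- The first variation of the closing defect. -/
noncomputable def varC (h : UnitProfile r c s κ) : testSpace →ₗ[ℝ] ℝ :=
  pairing (fun t => -s t) (LocInt.of_continuousOn h.continuous_s.neg.continuousOn)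

section variation

variable {ψ : Fin 3 → testSpace} {a b : ℝ}

theorem coe_sum (x : Fin 3 → ℝ) :
    ((∑ i, x i • ψ i : testSpace) : ℝ → ℝ) = comb (fun i => (ψ i).1) x := by
  ext t
  simp [comb, Finset.sum_apply]

theorem integral_add_halves {f : ℝ → ℝ} (hf : ContinuousOn f (Ioo 0 1)) (ha : 0 < a)
    (ha' : a < 1 / 2) (hb' : 1 / 2 < b) (hb : b < 1) :
    (∫ t in a..(1 / 2), f t) + ∫ t in (1 / 2)..b, f t = ∫ t in a..b, f t := by
  have hf' := LocInt.of_continuousOn hf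
  exact intervalIntegral.integral_add_adjacent_intervals
    (hf'.intervalIntegrable ⟨ha, by linarith⟩ (by norm_num))
    (hf'.intervalIntegrable (by norm_num) ⟨by linarith, hb⟩)

theorem varA_eq (h : UnitProfile r c s κ) (ha : 0 < a) (ha' : a < 1 / 2) (hb' : 1 / 2 < b)
    (hb : b < 1) (hab : ∀ i, ∀ t ∉ Ioo a b, (ψ i).1 t = 0) (x : Fin 3 → ℝ) :
    (∫ t in a..(1 / 2), locRho s (fun i => (ψ i).1) a x t)
      + (∫ t in (1 / 2)..b, locRho s (fun i => (ψ i).1) b x t)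
      = h.varA (∑ i, x i • ψ i) := by
  have := h.integral_mul_locRho (fun i => (ψ i).2) ha ha' hb' hb hab
    (G := fun _ => 1) (LocInt.of_continuousOn continuousOn_const) x
  simp only [one_mul] at this
  rw [this]
  show _ = ∫ t, ((∑ i, x i • ψ i : testSpace) : ℝ → ℝ) t * _
  rw [coe_sum]

theorem varV_eq (h : UnitProfile r c s κ) (ha : 0 < a) (ha' : a < 1 / 2) (hb' : 1 / 2 < b)
    (hb : b < 1) (hab : ∀ i, ∀ t ∉ Ioo a b, (ψ i).1 t = 0) (x : Fin 3 → ℝ) :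
    (∫ t in a..(1 / 2), (2 * r t * s t * locRho s (fun i => (ψ i).1) a x t
        + r t ^ 2 * c t * comb (fun i => (ψ i).1) x t))
      + (∫ t in (1 / 2)..b, (2 * r t * s t * locRho s (fun i => (ψ i).1) b x t
        + r t ^ 2 * c t * comb (fun i => (ψ i).1) x t))
      = h.varV (∑ i, x i • ψ i) := by
  have hψ : ∀ i, IsTest (ψ i).1 := fun i => (ψ i).2
  have ht := isTest_comb hψ x
  have key := h.integral_mul_locRho hψ ha ha' hb' hb hab
    (G := fun t => 2 * r t * s t) h.locInt_two_mul x
  have hc := h.continuous_c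
  have hs := h.continuous_s
  have hr := h.continuous_r
  have hΨ := ht.continuous
  have h1 := h.continuous_locRho hψ a x
  have h2 := h.continuous_locRho hψ b x
  have c1 : Continuous fun t => 2 * r t * s t * locRho s (fun i => (ψ i).1) a x t := by fun_prop
  have c2 : Continuous fun t => 2 * r t * s t * locRho s (fun i => (ψ i).1) b x t := by fun_prop
  have c3 : Continuous fun t => r t ^ 2 * c t * comb (fun i => (ψ i).1) x t := by fun_prop
  rw [intervalIntegral.integral_add (c1.intervalIntegrable _ _) (c3.intervalIntegrable _ _),
    intervalIntegral.integral_add (c2.intervalIntegrable _ _) (c3.intervalIntegrable _ _)]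
  have e3 := integral_add_halves c3.continuousOn ha ha' hb' hb
  have e4 : ∫ t in a..b, r t ^ 2 * c t * comb (fun i => (ψ i).1) x t
      = ∫ t, comb (fun i => (ψ i).1) x t * (r t ^ 2 * c t) := by
    rw [integral_eq_of_support (a := a) (b := b)]
    · congr 1; ext t; ring
    · intro t ht; simp [comb, hab _ t ht]
  have e5 : h.varV (∑ i, x i • ψ i) = ∫ t, comb (fun i => (ψ i).1) x t *
      (r t ^ 2 * c t + s t * primHalf (fun t => 2 * r t * s t) t) := by
    rw [← coe_sum]; rfl
  have I1 : Integrable fun t => comb (fun i => (ψ i).1) x t * (r t ^ 2 * c t) :=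
    (LocInt.of_continuousOn ((hr.pow 2).mul hc).continuousOn).integrable_mul ht
  have I2 : Integrable fun t =>
      comb (fun i => (ψ i).1) x t * (s t * primHalf (fun t => 2 * r t * s t) t) :=
    (LocInt.of_continuousOn (hs.continuousOn.mul
      (continuousOn_primHalf h.locInt_two_mul))).integrable_mul ht
  rw [e5]
  simp_rw [mul_add]
  rw [integral_add I1 I2]
  linarith

/-- The mixed terms `2 Ψ' s` and `2 Ψ c κ` integrate to zero together, since `cκ` is the weak
derivative of `s`. The factor of `locRho` that remains is `κ² - s²/r²`, and it is treated by
`integral_mul_locRho`. -/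
theorem varW_eq (h : UnitProfile r c s κ) (ha : 0 < a) (ha' : a < 1 / 2) (hb' : 1 / 2 < b)
    (hb : b < 1) (hab : ∀ i, ∀ t ∉ Ioo a b, (ψ i).1 t = 0)
    (hab' : ∀ i, ∀ t ∉ Ioo a b, deriv (ψ i).1 t = 0) (x : Fin 3 → ℝ) {Ψ : ℝ → ℝ}
    (hΨ : Ψ = comb (fun i => (ψ i).1) x) {D : ℝ → ℝ → ℝ → ℝ} (hD : ∀ p q e, D p q e =
      (∫ t in p..q, κ t ^ 2 * locRho s (fun i => (ψ i).1) e x t)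
        + (∫ t in p..q, κ t * (2 * (deriv Ψ t * r t + c t * Ψ t)))
        + ∫ t in p..q, (2 * (deriv Ψ t * s t) + 2 * s t * c t / r t * Ψ t
          - s t ^ 2 / r t ^ 2 * locRho s (fun i => (ψ i).1) e x t)) :
    D a (1 / 2) a + D (1 / 2) b b = h.varW (∑ i, x i • ψ i) := by
  have hψ : ∀ i, IsTest (ψ i).1 := fun i => (ψ i).2
  have ht : IsTest Ψ := hΨ ▸ isTest_comb hψ x
  have hz : ∀ t ∉ Ioo a b, Ψ t = 0 := fun t ht => by simp [hΨ, comb, hab _ t ht]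
  have hz' : ∀ t ∉ Ioo a b, deriv Ψ t = 0 := fun t ht => by
    rw [hΨ, deriv_comb hψ]; simp [comb, hab' _ t ht]
  have key := h.integral_mul_locRho hψ ha ha' hb' hb hab h.locInt_potential x
  rw [← hΨ] at key
  have hc := h.continuous_c
  have hs := h.continuous_s
  have hr := h.continuous_r
  have hΨc := ht.continuous
  have hdΨc := ht.deriv.continuous
  have m1 : a ∈ Ioo (0 : ℝ) 1 := ⟨ha, by linarith⟩
  have m2 : (1 / 2 : ℝ) ∈ Ioo (0 : ℝ) 1 := by norm_num
  have m3 : b ∈ Ioo (0 : ℝ) 1 := ⟨by linarith, hb⟩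
  have hsr : ContinuousOn (fun t => s t ^ 2 / r t ^ 2) (Ioo 0 1) :=
    (hs.pow 2).continuousOn.div (hr.pow 2).continuousOn
      fun t ht => pow_ne_zero 2 (h.r_pos t ht).ne'
  have L1 : ∀ e, LocInt fun t => κ t ^ 2 * locRho s (fun i => (ψ i).1) e x t := fun e => by
    simpa only [mul_comm] using h.locInt_sq.continuous_mul (h.continuous_locRho hψ e x)
  have L2 : LocInt fun t => κ t * (2 * (deriv Ψ t * r t + c t * Ψ t)) := by
    simpa only [mul_comm] using h.locInt_mul_curv
      (f := fun t => 2 * (deriv Ψ t * r t + c t * Ψ t)) (by fun_prop)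
  have L3 : LocInt fun t => 2 * (deriv Ψ t * s t) + 2 * s t * c t / r t * Ψ t :=
    LocInt.of_continuousOn ((Continuous.continuousOn (by fun_prop)).add
      ((h.continuousOn_div_r (by fun_prop)).mul hΨc.continuousOn))
  have L4 : ∀ e, LocInt fun t => s t ^ 2 / r t ^ 2 * locRho s (fun i => (ψ i).1) e x t := fun e =>
    LocInt.of_continuousOn (hsr.mul (h.continuous_locRho hψ e x).continuousOn)
  have expand : ∀ p q e, p ∈ Ioo (0 : ℝ) 1 → q ∈ Ioo (0 : ℝ) 1 → D p q e =
      (∫ t in p..q, (κ t ^ 2 - s t ^ 2 / r t ^ 2) * locRho s (fun i => (ψ i).1) e x t)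
      + ∫ t in p..q, (κ t * (2 * (deriv Ψ t * r t + c t * Ψ t))
        + (2 * (deriv Ψ t * s t) + 2 * s t * c t / r t * Ψ t)) := by
    intro p q e hp hq
    rw [hD]
    simp_rw [sub_mul]
    rw [intervalIntegral.integral_sub (L3.intervalIntegrable hp hq)
        ((L4 e).intervalIntegrable hp hq), intervalIntegral.integral_sub
        ((L1 e).intervalIntegrable hp hq) ((L4 e).intervalIntegrable hp hq),
      intervalIntegral.integral_add (L2.intervalIntegrable hp hq) (L3.intervalIntegrable hp hq)]
    ring
  have L23 : LocInt fun t => κ t * (2 * (deriv Ψ t * r t + c t * Ψ t))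
      + (2 * (deriv Ψ t * s t) + 2 * s t * c t / r t * Ψ t) := LocallyIntegrableOn.add L2 L3
  have e0 := intervalIntegral.integral_add_adjacent_intervals (μ := volume)
    (L23.intervalIntegrable m1 m2) (L23.intervalIntegrable m2 m3)
  have e1 : ∫ t in a..b, (κ t * (2 * (deriv Ψ t * r t + c t * Ψ t))
        + (2 * (deriv Ψ t * s t) + 2 * s t * c t / r t * Ψ t))
      = ∫ t, ((deriv Ψ t * (2 * r t * κ t) + Ψ t * (2 * s t * c t / r t))
        + (2 * (deriv Ψ t * s t) + 2 * (Ψ t * (c t * κ t)))) := by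
    rw [integral_eq_of_support (a := a) (b := b)]
    · congr 1; ext t; ring
    · intro t ht; simp [hz t ht, hz' t ht]
  have I1 : Integrable fun t => deriv Ψ t * (2 * r t * κ t) :=
    (h.locInt_mul_curv (continuous_const.mul hr)).integrable_mul ht.deriv
  have I2 : Integrable fun t => Ψ t * (2 * s t * c t / r t) :=
    (LocInt.of_continuousOn (h.continuousOn_div_r (by fun_prop))).integrable_mul ht
  have I3 : Integrable fun t => deriv Ψ t * s t :=
    (LocInt.of_continuousOn hs.continuousOn).integrable_mul ht.deriv
  have I4 : Integrable fun t => Ψ t * (c t * κ t) := (h.locInt_mul_curv hc).integrable_mul ht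
  have I5 : Integrable fun t =>
      Ψ t * (s t * primHalf (fun t => κ t ^ 2 - s t ^ 2 / r t ^ 2) t) :=
    (LocInt.of_continuousOn (hs.continuousOn.mul
      (continuousOn_primHalf h.locInt_potential))).integrable_mul ht
  have e2 : h.varW (∑ i, x i • ψ i) = (∫ t, deriv Ψ t * (2 * r t * κ t))
      + ∫ t, Ψ t * (2 * s t * c t / r t
        + s t * primHalf (fun t => κ t ^ 2 - s t ^ 2 / r t ^ 2) t) := by
    rw [hΨ, ← coe_sum]; rfl
  have I12 : Integrable fun t => deriv Ψ t * (2 * r t * κ t) + Ψ t * (2 * s t * c t / r t) :=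
    I1.add I2
  have I34 : Integrable fun t => 2 * (deriv Ψ t * s t) + 2 * (Ψ t * (c t * κ t)) :=
    (I3.const_mul 2).add (I4.const_mul 2)
  rw [integral_add I12 I34, integral_add I1 I2,
    integral_add (I3.const_mul 2) (I4.const_mul 2), integral_const_mul, integral_const_mul,
    h.weak_s Ψ ht] at e1
  simp_rw [mul_add] at e2
  rw [integral_add I2 I5] at e2
  rw [expand _ _ _ m1 m2, expand _ _ _ m2 m3, e2]
  linarith

theorem integrable_energy (h : UnitProfile r c s κ) :
    IntervalIntegrable (fun t => (κ t + s t / r t) ^ 2 * r t) volume 0 1 := by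
  rw [intervalIntegrable_iff_integrableOn_Ioo_of_le zero_le_one]
  have h1 : IntegrableOn (fun t => 2 * (κ t ^ 2 * r t) + 2 * (s t ^ 2 / r t)) (Ioo 0 1) :=
    (h.integrable_curv.const_mul 2).add (h.integrable_rot.const_mul 2)
  refine h1.mono' ?_ ?_
  · exact ((h.locInt.aestronglyMeasurable.add ((h.continuousOn_div_r
      h.continuous_s).aestronglyMeasurable measurableSet_Ioo)).pow 2).mul
      h.continuous_r.aestronglyMeasurable
  · rw [ae_restrict_iff' measurableSet_Ioo]
    refine Eventually.of_forall fun t ht => ?_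
    have hr := h.r_pos t ht
    rw [Real.norm_eq_abs, abs_of_nonneg (by positivity)]
    have e : 2 * (κ t ^ 2 * r t) + 2 * (s t ^ 2 / r t) - (κ t + s t / r t) ^ 2 * r t
        = (κ t - s t / r t) ^ 2 * r t := by field_simp; ring
    have : 0 ≤ (κ t - s t / r t) ^ 2 * r t := by positivity
    linarith

theorem locW_eq (h : UnitProfile r c s κ) {φ : Fin 3 → ℝ → ℝ} (hφ : ∀ i, IsTest (φ i))
    {p q e : ℝ} (hp : p ∈ Ioo (0 : ℝ) 1) (hq : q ∈ Ioo (0 : ℝ) 1)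
    (hpq : p ≤ q) {x : Fin 3 → ℝ} {R S k : ℝ → ℝ} (hR : ∀ t ∈ Icc p q, locR r c s φ e x t = R t)
    (hpos : ∀ t ∈ Icc p q, 0 < R t) (hS : ∀ t, rotS c s (comb φ x) t = S t)
    (hk : ∀ t, κ t + deriv (comb φ x) t = k t) :
    locW r c s κ φ p q e x = ∫ t in p..q, (k t + S t / R t) ^ 2 * R t := by
  have hc := h.continuous_c
  have hs := h.continuous_s
  have hRc := h.continuous_locR hφ e x
  have hSc := continuous_rotS hc hs (isTest_comb hφ x).continuous
  have hd := (isTest_comb hφ x).deriv.continuous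
  have I1 : IntervalIntegrable (fun t => κ t ^ 2 * locR r c s φ e x t) volume p q :=
    (h.locInt_sq.intervalIntegrable hp hq).mul_continuousOn hRc.continuousOn
  have I2 : IntervalIntegrable (fun t => κ t * (2 * (deriv (comb φ x) t * locR r c s φ e x t
      + rotS c s (comb φ x) t))) volume p q :=
    (h.locInt.intervalIntegrable hp hq).mul_continuousOn (Continuous.continuousOn (by fun_prop))
  have I3 : IntervalIntegrable (fun t => deriv (comb φ x) t ^ 2 * locR r c s φ e x t
      + 2 * (deriv (comb φ x) t * rotS c s (comb φ x) t)
      + rotS c s (comb φ x) t ^ 2 * (locR r c s φ e x t)⁻¹) volume p q := by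
    apply ContinuousOn.intervalIntegrable
    rw [uIcc_of_le hpq]
    refine (Continuous.continuousOn (by fun_prop)).add ((hSc.pow 2).continuousOn.mul
      (hRc.continuousOn.inv₀ fun t ht => ?_))
    rw [hR t ht]
    exact (hpos t ht).ne'
  rw [locW, ← intervalIntegral.integral_add I1 I2,
    ← intervalIntegral.integral_add (I1.add I2) I3]
  apply intervalIntegral.integral_congr
  intro t ht
  rw [uIcc_of_le hpq] at ht
  have := (hpos t ht).ne'
  simp only [← hk, ← hS, hR t ht]
  field_simp
  ring

end variation

theorem rotR_sub (h : UnitProfile r c s κ) {Ψ : ℝ → ℝ} (hΨ : Continuous Ψ) (t : ℝ) :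
    rotR c s Ψ t - r t = ∫ y in (0 : ℝ)..t, (rotC c s Ψ y - c y) := by
  rw [intervalIntegral.integral_sub ((continuous_rotC h.continuous_c h.continuous_s
    hΨ).intervalIntegrable _ _) (h.continuous_c.intervalIntegrable _ _), h.r_eq, rotR]

theorem continuous_rotR (h : UnitProfile r c s κ) {Ψ : ℝ → ℝ} (hΨ : Continuous Ψ) :
    Continuous (rotR c s Ψ) :=
  intervalIntegral.continuous_primitive (fun _ _ => (continuous_rotC h.continuous_c
    h.continuous_s hΨ).intervalIntegrable _ _) 0

/-- A small test rotation satisfying the closing condition at level `[a, b]`. -/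
theorem rotR_of_closing (h : UnitProfile r c s κ) {φ : Fin 3 → ℝ → ℝ} (hφ : ∀ i, IsTest (φ i))
    {a b : ℝ} (ha : 0 < a) (hb : b < 1) (hz : ∀ i, ∀ t ∉ Ioo a b, φ i t = 0)
    {x : Fin 3 → ℝ} (hC : ∫ t in a..b, (rotC c s (comb φ x) t - c t) = 0) :
    rotR c s (comb φ x) 1 = 0 ∧ (∀ t, locR r c s φ a x t = rotR c s (comb φ x) t) ∧
      (∀ t, locR r c s φ b x t = rotR c s (comb φ x) t) ∧
      ∀ t ∈ Ioo (0 : ℝ) 1, t ∉ Ioo a b → rotR c s (comb φ x) t = r t := by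
  have hΨ := (isTest_comb hφ x).continuous
  have hz' : ∀ t ∉ Ioo a b, comb φ x t = 0 := fun t ht => by simp [comb, hz _ t ht]
  have hδ : Continuous fun y => rotC c s (comb φ x) y - c y :=
    (continuous_rotC h.continuous_c h.continuous_s hΨ).sub h.continuous_c
  have add := fun p q u => intervalIntegral.integral_add_adjacent_intervals (μ := volume)
    (hδ.intervalIntegrable p q) (hδ.intervalIntegrable q u)
  have z1 : ∫ y in (0 : ℝ)..a, (rotC c s (comb φ x) y - c y) = 0 := by
    refine (intervalIntegral.integral_congr (g := fun _ => 0) ?_).trans (by simp)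
    intro y hy
    rw [uIcc_of_le ha.le] at hy
    simp only [rotC_eq_of_eq_zero (hz' y fun h' => by linarith [h'.1, hy.2]), sub_self]
  have z2 : ∫ y in b..1, (rotC c s (comb φ x) y - c y) = 0 := by
    refine (intervalIntegral.integral_congr (g := fun _ => 0) ?_).trans (by simp)
    intro y hy
    rw [uIcc_of_le hb.le] at hy
    simp only [rotC_eq_of_eq_zero (hz' y fun h' => by linarith [h'.2, hy.1]), sub_self]
  have h1 : rotR c s (comb φ x) 1 = 0 := by
    have e := h.rotR_sub hΨ 1
    rw [h.r_one, ← add 0 a 1, ← add a b 1, z1, z2, hC] at e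
    linarith
  refine ⟨h1, fun t => ?_, fun t => ?_, fun t ht htab => ?_⟩
  · have e := h.rotR_sub hΨ t
    rw [← add 0 a t, z1] at e
    rw [locR]
    linarith
  · have e := h.rotR_sub hΨ t
    rw [← add 0 a t, ← add a b t, z1, hC] at e
    rw [locR]
    linarith
  · by_cases hta : t ≤ a
    · exact h.rotR_eq_left hz' hta ht.1.le
    · have : b ≤ t := by
        by_contra hb''
        exact htab ⟨not_le.1 hta, not_le.1 hb''⟩
      rw [h.rotR_eq_right hΨ hz' this ht.2.le, h1, zero_add]

/-- The variation map is not onto at a minimiser. -/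
theorem range_variation_ne_top (h : UnitProfile r c s κ)
    (hmin : ∀ Ψ, IsTest Ψ → rotR c s Ψ 1 = 0 → (∀ t ∈ Ioo (0 : ℝ) 1, 0 < rotR c s Ψ t) →
      unitVol (rotR c s Ψ) (rotS c s Ψ) ^ 2 * unitArea r ^ 3
        = unitVol r s ^ 2 * unitArea (rotR c s Ψ) ^ 3 →
      unitWillmore r s κ
        ≤ unitWillmore (rotR c s Ψ) (rotS c s Ψ) (fun t => κ t + deriv Ψ t)) :
    LinearMap.range (LinearMap.pi ![h.varW, (3 * unitArea r ^ 2 * unitVol r s ^ 2) • h.varA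
      + (-(2 * unitVol r s * unitArea r ^ 3)) • h.varV, h.varC]) ≠ ⊤ := by
  intro htop
  set A₀ := unitArea r with hA₀
  set V₀ := unitVol r s with hV₀
  set Λ : testSpace →ₗ[ℝ] (Fin 3 → ℝ) := LinearMap.pi ![h.varW, (3 * A₀ ^ 2 * V₀ ^ 2) • h.varA
      + (-(2 * V₀ * A₀ ^ 3)) • h.varV, h.varC] with hΛ
  -- Preimages of the basis vectors: along their span the differential of (energy, ratio constraint,
  -- closing defect) is the identity of `ℝ³`.
  have hsurj : ∀ i : Fin 3, ∃ ψ, Λ ψ = Pi.single i 1 := fun i => by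
    have : Pi.single i (1 : ℝ) ∈ LinearMap.range Λ := htop ▸ Submodule.mem_top
    exact this
  choose ψ hψΛ using hsurj
  have hΛx : ∀ x : Fin 3 → ℝ, Λ (∑ i, x i • ψ i) = x := by
    intro x
    rw [map_sum]
    simp_rw [map_smul, hψΛ]
    ext j
    simp [Finset.sum_apply, Pi.single_apply]
  set φ : Fin 3 → ℝ → ℝ := fun i => (ψ i).1 with hφdef
  have hφ : ∀ i, IsTest (φ i) := fun i => (ψ i).2
  obtain ⟨a, b, ha, ha', hb', hb, hz, hz'⟩ : ∃ a b : ℝ, 0 < a ∧ a < 1 / 2 ∧ 1 / 2 < b ∧ b < 1 ∧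
      (∀ i, ∀ t ∉ Ioo a b, φ i t = 0) ∧ (∀ i, ∀ t ∉ Ioo a b, deriv (φ i) t = 0) := by
    choose a b h1 h2 h3 h4 h5 using fun i => (hφ i).exists_support
    choose a' b' h1' h2' h3' h4' h5' using fun i => (hφ i).deriv.exists_support
    have hne : (Finset.univ : Finset (Fin 3)).Nonempty := Finset.univ_nonempty
    refine ⟨Finset.univ.inf' hne fun i => min (a i) (a' i),
      Finset.univ.sup' hne fun i => max (b i) (b' i), ?_, ?_, ?_, ?_, ?_, ?_⟩
    · rw [Finset.lt_inf'_iff]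
      exact fun i _ => lt_min (h1 i) (h1' i)
    · rw [Finset.inf'_lt_iff]
      exact ⟨0, Finset.mem_univ _, (min_le_left _ _).trans_lt (h2 0)⟩
    · rw [Finset.lt_sup'_iff]
      exact ⟨0, Finset.mem_univ _, (h3 0).trans_le (le_max_left _ _)⟩
    · rw [Finset.sup'_lt_iff]
      exact fun i _ => max_lt (h4 i) (h4' i)
    · intro i t ht
      refine h5 i t fun h' => ht ⟨?_, ?_⟩
      · exact ((Finset.inf'_le (fun i => min (a i) (a' i)) (Finset.mem_univ i)).trans (min_le_left _ _)).trans_lt h'.1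
      · exact h'.2.trans_le ((le_max_left _ _).trans
          (Finset.le_sup' (fun i => max (b i) (b' i)) (Finset.mem_univ i)))
    · intro i t ht
      refine h5' i t fun h' => ht ⟨?_, ?_⟩
      · exact ((Finset.inf'_le (fun i => min (a i) (a' i)) (Finset.mem_univ i)).trans (min_le_right _ _)).trans_lt h'.1
      · exact h'.2.trans_le ((le_max_right _ _).trans
          (Finset.le_sup' (fun i => max (b i) (b' i)) (Finset.mem_univ i)))
  have hab : a < b := ha'.trans hb'
  have half0 : (0 : ℝ) < 1 / 2 := by norm_num
  have half1 : (1 / 2 : ℝ) < 1 := by norm_num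
  have el : a ∈ Icc a (1 / 2) := ⟨le_rfl, ha'.le⟩
  have er : b ∈ Icc (1 / 2) b := ⟨hb'.le, le_rfl⟩
  let Wt : (Fin 3 → ℝ) → ℝ := fun x =>
    locW r c s κ φ a (1 / 2) a x + locW r c s κ φ (1 / 2) b b x
  let At : (Fin 3 → ℝ) → ℝ := fun x => locA r c s φ a (1 / 2) a x + locA r c s φ (1 / 2) b b x
  let Vt : (Fin 3 → ℝ) → ℝ := fun x => locV r c s φ a (1 / 2) a x + locV r c s φ (1 / 2) b b x
  let Ct : (Fin 3 → ℝ) → ℝ := fun x => ∫ t in a..b, (rotC c s (comb φ x) t - c t)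
  -- The constraint `A³ V₀² = V² A₀³`. Area and volume enter through their increments, because a
  -- closed competitor differs from the old curve only in `(a, b)`.
  let Gt : (Fin 3 → ℝ) → ℝ := fun x =>
    (A₀ + (At x - At 0)) ^ 3 * V₀ ^ 2 - (V₀ + (Vt x - Vt 0)) ^ 2 * A₀ ^ 3
  have bconst : ∀ y : ℝ, ∃ M, 0 ≤ M ∧ ∀ t ∈ ({0} : Set ℝ), |(fun _ : ℝ => y) t| ≤ M := fun y =>
    ⟨|y|, abs_nonneg _, fun _ _ => le_rfl⟩
  have uW : UDiff {0} (fun x _ => Wt x) (fun x _ => h.varW (∑ i, x i • ψ i)) :=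
    ((h.uDiff_locW hφ el ha half1).add (h.uDiff_locW hφ er half0 hb)).congr_deriv fun x _ _ =>
      h.varW_eq ha ha' hb' hb hz hz' x rfl (D := fun p q e =>
      (∫ t in p..q, κ t ^ 2 * locRho s φ e x t)
        + (∫ t in p..q, κ t * (2 * (deriv (comb φ x) t * r t + c t * comb φ x t)))
        + ∫ t in p..q, (2 * (deriv (comb φ x) t * s t) + 2 * s t * c t / r t * comb φ x t
          - s t ^ 2 / r t ^ 2 * locRho s φ e x t)) fun _ _ _ => rfl
  have uA : UDiff {0} (fun x _ => At x) (fun x _ => h.varA (∑ i, x i • ψ i)) :=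
    ((h.uDiff_locA hφ el).add (h.uDiff_locA hφ er)).congr_deriv fun x _ _ =>
      h.varA_eq ha ha' hb' hb hz x
  have uV : UDiff {0} (fun x _ => Vt x) (fun x _ => h.varV (∑ i, x i • ψ i)) :=
    ((h.uDiff_locV hφ el).add (h.uDiff_locV hφ er)).congr_deriv fun x _ _ =>
      h.varV_eq ha ha' hb' hb hz x
  have uC : UDiff {0} (fun x _ => Ct x) (fun x _ => h.varC (∑ i, x i • ψ i)) := by
    have bc := UDiff.bounded_of_continuous (h.continuous_c.neg.continuousOn (s := Icc a b))
    have h1 := (h.uDiff_rotC hφ a b).add (UDiff.const bc)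
    have h2 := h1.integral hab.le (g := fun _ => 1) intervalIntegrable_const
      ⟨1, one_pos, fun x _ => ((continuous_rotC h.continuous_c h.continuous_s
        (isTest_comb hφ x).continuous).add h.continuous_c.neg).continuousOn⟩
      (fun x => ((h.continuous_s.mul (isTest_comb hφ x).continuous).neg.add
        continuous_const).continuousOn) (S := {0}) (u := fun _ => a) (v := fun _ => b)
      (fun _ _ => left_mem_Icc.2 hab.le) (fun _ _ => right_mem_Icc.2 hab.le)
    refine h2.congr_deriv ?_ |>.congr ?_
    · intro x t _
      have : h.varC (∑ i, x i • ψ i) = ∫ t, comb φ x t * (-s t) := by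
        rw [hφdef, ← coe_sum]; rfl
      rw [this, integral_eq_of_support (a := a) (b := b)]
      · apply intervalIntegral.integral_congr; intro t _; simp only; ring
      · intro t ht; simp [comb, hz _ t ht]
    · intro x t _; simp [Ct, sub_eq_add_neg]
  have uG : UDiff {0} (fun x _ => Gt x) (fun x _ => ((3 * A₀ ^ 2 * V₀ ^ 2) • h.varA
      + (-(2 * V₀ * A₀ ^ 3)) • h.varV) (∑ i, x i • ψ i)) := by
    have a1 := (UDiff.const (E := Fin 3 → ℝ) (bconst (A₀ - At 0))).add uA
    have v1 := (UDiff.const (E := Fin 3 → ℝ) (bconst (V₀ - Vt 0))).add uV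
    have := (((a1.mul a1).mul a1).const_mul (bconst (V₀ ^ 2))).add
      ((v1.mul v1).const_mul (bconst (-A₀ ^ 3)))
    refine this.congr_deriv ?_ |>.congr ?_
    · intro x t _
      simp only [LinearMap.add_apply, LinearMap.smul_apply, smul_eq_mul]
      ring
    · intro x t _
      simp only [Gt]
      ring
  let F : (Fin 3 → ℝ) → (Fin 3 → ℝ) := fun x => ![Wt x, Gt x, Ct x]
  have hF : HasStrictFDerivAt F (ContinuousLinearMap.id ℝ (Fin 3 → ℝ)) 0 := by
    rw [hasStrictFDerivAt_pi']
    intro i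
    apply UDiff.hasStrictFDerivAt
    fin_cases i
    · exact uW.congr_deriv fun x _ _ => congrFun (hΛx x) 0
    · exact uG.congr_deriv fun x _ _ => congrFun (hΛx x) 1
    · exact uC.congr_deriv fun x _ _ => congrFun (hΛx x) 2
  -- A strictly differentiable map with surjective differential is open at the point, so values near
  -- `F 0` are attained at small parameters.
  have hmap : map F (𝓝 0) = 𝓝 (F 0) := hF.map_nhds_eq_of_surj (LinearMap.range_eq_top.2
    Function.surjective_id)
  obtain ⟨δ₁, hδ₁, H₁⟩ := h.locR_pos hφ el ha half1
  obtain ⟨δ₂, hδ₂, H₂⟩ := h.locR_pos hφ er half0 hb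
  have hN : F '' {x | ‖x‖ < δ₁ ∧ ‖x‖ < δ₂} ∈ 𝓝 (F 0) := by
    rw [← hmap]
    apply image_mem_map
    have : Metric.ball (0 : Fin 3 → ℝ) (min δ₁ δ₂) ∈ 𝓝 0 :=
      Metric.ball_mem_nhds _ (lt_min hδ₁ hδ₂)
    filter_upwards [this] with x hx
    rw [mem_ball_zero_iff, lt_min_iff] at hx
    exact hx
  -- The target value lowers the energy by a small `τ > 0` and leaves both constraints untouched.
  have hline : Tendsto (fun τ : ℝ => F 0 - τ • (Pi.single 0 1 : Fin 3 → ℝ)) (𝓝[>] 0)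
      (𝓝 (F 0)) := by
    have : Tendsto (fun τ : ℝ => F 0 - τ • (Pi.single 0 1 : Fin 3 → ℝ)) (𝓝 0)
        (𝓝 (F 0 - (0 : ℝ) • (Pi.single 0 1 : Fin 3 → ℝ))) :=
      (Continuous.tendsto (by fun_prop) 0)
    rw [zero_smul, sub_zero] at this
    exact this.mono_left nhdsWithin_le_nhds
  obtain ⟨τ, ⟨x, ⟨hx1, hx2⟩, hFx⟩, hτ⟩ :=
    ((hline.eventually hN).and self_mem_nhdsWithin).exists
  have hW : Wt x = Wt 0 - τ := by simpa [F] using congrFun hFx 0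
  have hG0 : Gt 0 = 0 := by simp only [Gt]; ring
  have hC0 : Ct 0 = 0 := by simp [Ct, rotC, comb_zero]
  have hG : Gt x = 0 := by simpa [F, hG0] using congrFun hFx 1
  have hC : Ct x = 0 := by simpa [F, hC0] using congrFun hFx 2
  set Ψ := comb φ x with hΨdef
  have hΨ : IsTest Ψ := isTest_comb hφ x
  -- With vanishing defect the halves anchored at `a` and at `b` are parts of one closed curve, so
  -- the local functionals compute the true energy, area and volume.
  obtain ⟨c1, c2, c3, c4⟩ := h.rotR_of_closing hφ ha hb hz hC
  have hΨz : ∀ t ∉ Ioo a b, Ψ t = 0 := fun t ht => by simp [hΨdef, comb, hz _ t ht]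
  have hΨz' : ∀ t ∉ Ioo a b, deriv Ψ t = 0 := fun t ht => by
    rw [hΨdef, deriv_comb hφ]; simp [comb, hz' _ t ht]
  have pl : ∀ t ∈ Icc a (1 / 2), 0 < rotR c s Ψ t := fun t ht => c2 t ▸ H₁ x hx1 t ht
  have pr : ∀ t ∈ Icc (1 / 2) b, 0 < rotR c s Ψ t := fun t ht => c3 t ▸ H₂ x hx2 t ht
  have hpos : ∀ t ∈ Ioo (0 : ℝ) 1, 0 < rotR c s Ψ t := by
    intro t ht
    by_cases htab : t ∈ Ioo a b
    · rcases le_total t (1 / 2) with h' | h'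
      · exact pl t ⟨htab.1.le, h'⟩
      · exact pr t ⟨h', htab.2.le⟩
    · rw [c4 t ht htab]; exact h.r_pos t ht
  have hprof := h.rotate hΨ c1 hpos
  have hRc := h.continuous_rotR hΨ.continuous
  have hSc := continuous_rotS h.continuous_c h.continuous_s hΨ.continuous
  have hr := h.continuous_r
  have hs := h.continuous_s
  have hA : unitArea (rotR c s Ψ) = A₀ + (At x - At 0) := by
    have e := integral_sub_integral_of_eq_outside ha.le hab.le hb.le
      (hRc.intervalIntegrable 0 1) (hr.intervalIntegrable 0 1) c4
    have e1 : At x = ∫ t in a..b, rotR c s Ψ t := by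
      rw [← integral_add_halves hRc.continuousOn ha ha' hb' hb]
      simp only [At, locA, c2, c3, hΨdef]
    have e2 : At 0 = ∫ t in a..b, r t := by
      rw [← integral_add_halves hr.continuousOn ha ha' hb' hb]
      simp only [At, locA, locR_zero]
    rw [e1, e2, ← e, hA₀, unitArea, unitArea]
    ring
  have hV : unitVol (rotR c s Ψ) (rotS c s Ψ) = V₀ + (Vt x - Vt 0) := by
    have k1 : Continuous fun t => rotR c s Ψ t ^ 2 * rotS c s Ψ t := (hRc.pow 2).mul hSc
    have k2 : Continuous fun t => r t ^ 2 * s t := (hr.pow 2).mul hs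
    have e := integral_sub_integral_of_eq_outside ha.le hab.le hb.le
      (k1.intervalIntegrable 0 1) (k2.intervalIntegrable 0 1) (fun t ht htab => by
        rw [c4 t ht htab, rotS_eq_of_eq_zero (hΨz t htab)])
    have e1 : Vt x = ∫ t in a..b, rotR c s Ψ t ^ 2 * rotS c s Ψ t := by
      rw [← integral_add_halves k1.continuousOn ha ha' hb' hb]
      simp only [Vt, locV, c2, c3, hΨdef]
    have e2 : Vt 0 = ∫ t in a..b, r t ^ 2 * s t := by
      rw [← integral_add_halves k2.continuousOn ha ha' hb' hb]
      simp only [Vt, locV, locR_zero, rotS_eq_of_eq_zero (comb_zero _)]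
    rw [e1, e2, ← e, hV₀, unitVol, unitVol]
    ring
  have hconstr : unitVol (rotR c s Ψ) (rotS c s Ψ) ^ 2 * A₀ ^ 3
      = V₀ ^ 2 * unitArea (rotR c s Ψ) ^ 3 := by
    rw [hA, hV]
    simp only [Gt] at hG
    linarith
  have hle := hmin Ψ hΨ c1 hpos hconstr
  have hdiff : unitWillmore (rotR c s Ψ) (rotS c s Ψ) (fun t => κ t + deriv Ψ t)
      - unitWillmore r s κ = Wt x - Wt 0 := by
    have i1 := hprof.integrable_energy
    have i2 := h.integrable_energy
    have e := integral_sub_integral_of_eq_outside ha.le hab.le hb.le i1 i2 (fun t ht htab => by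
        rw [c4 t ht htab, rotS_eq_of_eq_zero (hΨz t htab), hΨz' t htab, add_zero])
    have sub : ∀ {f : ℝ → ℝ}, IntervalIntegrable f volume 0 1 → ∀ {p q : ℝ}, 0 ≤ p → p ≤ q →
        q ≤ 1 → IntervalIntegrable f volume p q := fun hf p q hp hpq hq =>
      hf.mono_set (by rw [uIcc_of_le hpq, uIcc_of_le zero_le_one]; exact Icc_subset_Icc hp hq)
    have ma : a ∈ Ioo (0 : ℝ) 1 := ⟨ha, by linarith⟩
    have mh : (1 / 2 : ℝ) ∈ Ioo (0 : ℝ) 1 := ⟨half0, half1⟩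
    have mb : b ∈ Ioo (0 : ℝ) 1 := ⟨by linarith, hb⟩
    have z0 : ∀ t, deriv (comb φ 0) t = 0 := fun t => by rw [deriv_comb hφ, comb_zero]
    have w1 := h.locW_eq hφ ma mh ha'.le (fun t _ => c2 t) pl (fun t => rfl) (fun t => rfl)
    have w2 := h.locW_eq hφ mh mb hb'.le (fun t _ => c3 t) pr (fun t => rfl) (fun t => rfl)
    have w3 := h.locW_eq hφ ma mh ha'.le (fun t _ => locR_zero (ψ := φ) a t)
      (fun t ht => h.r_pos t ⟨by linarith [ht.1], by linarith [ht.2]⟩)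
      (fun t => rotS_eq_of_eq_zero (comb_zero (ψ := φ) t)) (k := κ) (fun t => by simp [z0])
    have w4 := h.locW_eq hφ mh mb hb'.le (fun t _ => locR_zero (ψ := φ) b t)
      (fun t ht => h.r_pos t ⟨by linarith [ht.1], by linarith [ht.2]⟩)
      (fun t => rotS_eq_of_eq_zero (comb_zero (ψ := φ) t)) (k := κ) (fun t => by simp [z0])
    have e1 := intervalIntegral.integral_add_adjacent_intervals
      (sub i1 ha.le ha'.le half1.le) (sub i1 half0.le hb'.le hb.le)
    have e2 := intervalIntegral.integral_add_adjacent_intervals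
      (sub i2 ha.le ha'.le half1.le) (sub i2 half0.le hb'.le hb.le)
    simp only [Wt]
    rw [w1, w2, w3, w4, e1, e2]
    exact e
  have : (0 : ℝ) < τ := hτ
  linarith

/-- The Euler-Lagrange equation, with Lagrange multipliers of Fritz John type. -/
theorem exists_multipliers (h : UnitProfile r c s κ) (hV : unitVol r s ≠ 0)
    (hmin : ∀ Ψ, IsTest Ψ → rotR c s Ψ 1 = 0 → (∀ t ∈ Ioo (0 : ℝ) 1, 0 < rotR c s Ψ t) →
      unitVol (rotR c s Ψ) (rotS c s Ψ) ^ 2 * unitArea r ^ 3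
        = unitVol r s ^ 2 * unitArea (rotR c s Ψ) ^ 3 →
      unitWillmore r s κ
        ≤ unitWillmore (rotR c s Ψ) (rotS c s Ψ) (fun t => κ t + deriv Ψ t)) :
    ∃ c₀ lam mu nu : ℝ, (c₀ ≠ 0 ∨ lam ≠ 0 ∨ nu ≠ 0) ∧
      2 * mu * unitArea r + 3 * lam * unitVol r s = 0 ∧
      ∀ ψ, c₀ * h.varW ψ + lam * h.varV ψ + mu * h.varA ψ + nu * h.varC ψ = 0 := by
  -- A proper subspace of `ℝ³` lies in the kernel of a nonzero functional, whose three coefficients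
  -- are the multipliers.
  obtain ⟨f, hf, hker⟩ := Submodule.exists_le_ker_of_lt_top _
    (lt_top_iff_ne_top.2 (h.range_variation_ne_top hmin))
  have hA := h.unitArea_pos
  have hfe : ∀ v : Fin 3 → ℝ, f v = v 0 * f (Pi.single 0 1) + v 1 * f (Pi.single 1 1)
      + v 2 * f (Pi.single 2 1) := by
    intro v
    rw [LinearMap.pi_apply_eq_sum_univ f v, Fin.sum_univ_three]
    have : ∀ i : Fin 3, (fun j => if i = j then (1 : ℝ) else 0) = Pi.single i 1 := by
      intro i; ext j; simp [Pi.single_apply, eq_comm]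
    simp [this]
  set c₀ := f (Pi.single 0 1)
  set c₁ := f (Pi.single 1 1)
  set c₂ := f (Pi.single 2 1)
  refine ⟨c₀, c₁ * -(2 * unitVol r s * unitArea r ^ 3),
    c₁ * (3 * unitArea r ^ 2 * unitVol r s ^ 2), c₂, ?_, by ring, ?_⟩
  -- Since `A > 0` and `V ≠ 0`, `lam = 0` already forces the multiplier `c₁` of the ratio constraint
  -- to vanish.
  · by_contra hcon
    push Not at hcon
    obtain ⟨h0, h1, h2⟩ := hcon
    have h1' : c₁ = 0 := by
      rcases mul_eq_zero.1 h1 with h' | h'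
      · exact h'
      · exfalso
        have : 2 * unitVol r s * unitArea r ^ 3 ≠ 0 := by positivity
        exact this (neg_eq_zero.1 h')
    apply hf
    ext i
    simp [hfe, h0, h1', h2]
  · intro ψ
    have := hker (LinearMap.mem_range_self _ ψ)
    rw [LinearMap.mem_ker, hfe] at this
    simp at this
    linarith

end UnitProfile

/-! ### Boundary values, interior regularity and the local Euler-Lagrange equation. -/

theorem contDiffOn_succ_of_hasDerivAt {f g : ℝ → ℝ} {U : Set ℝ} (hU : IsOpen U) {n : ℕ}
    (h : ∀ t ∈ U, HasDerivAt f (g t) t) (hg : ContDiffOn ℝ n g U) :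
    ContDiffOn ℝ (n + 1 : ℕ) f U := by
  push_cast
  rw [contDiffOn_succ_iff_deriv_of_isOpen hU]
  refine ⟨fun t ht => (h t ht).differentiableAt.differentiableWithinAt, by simp, ?_⟩
  exact hg.congr fun t ht => (h t ht).deriv

/-- A function dominated near an endpoint by `t * g t` with `g` integrable vanishes there. -/
theorem eq_zero_of_abs_le_mul {f g : ℝ → ℝ} (hf : ContinuousAt f 0)
    (hg : IntegrableOn g (Ioo 0 1)) (h : ∀ t ∈ Ioo (0 : ℝ) 1, |f t| ≤ t * |g t|) : f 0 = 0 := by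
  by_contra h0
  have h1 : 0 < |f 0| := abs_pos.2 h0
  have h2 : ∀ᶠ t in 𝓝 (0 : ℝ), |f 0| / 2 < |f t| :=
    hf.abs.eventually (lt_mem_nhds (half_lt_self h1))
  obtain ⟨δ, hδ, h3⟩ := Metric.eventually_nhds_iff.1 h2
  have hm : 0 < min δ 1 := lt_min hδ one_pos
  -- If `f 0 ≠ 0`, then `1/t` is at most a constant times `|g t|` near `0`, hence integrable, which
  -- is false.
  have h4 : IntervalIntegrable (fun t : ℝ => t⁻¹) volume 0 (min δ 1) := by
    rw [intervalIntegrable_iff_integrableOn_Ioo_of_le hm.le]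
    have h5 : IntegrableOn (fun t => 2 / |f 0| * |g t|) (Ioo 0 (min δ 1)) :=
      ((hg.mono_set (Ioo_subset_Ioo_right (min_le_right _ _))).abs).const_mul _
    refine Integrable.mono' h5 (by fun_prop) ?_
    refine (ae_restrict_iff' measurableSet_Ioo).2 (ae_of_all _ fun t ht => ?_)
    have ht1 : t < δ := ht.2.trans_le (min_le_left _ _)
    have ht2 : t < 1 := ht.2.trans_le (min_le_right _ _)
    have h6 := h3 (y := t) (by rw [dist_zero_right, Real.norm_of_nonneg ht.1.le]; exact ht1)
    have h7 := h t ⟨ht.1, ht2⟩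
    rw [Real.norm_of_nonneg (inv_nonneg.2 ht.1.le), inv_eq_one_div, div_le_iff₀ ht.1,
      div_mul_eq_mul_div, div_mul_eq_mul_div, le_div_iff₀ h1]
    nlinarith
  rw [intervalIntegrable_inv_iff] at h4
  rcases h4 with h4 | h4
  · exact hm.ne h4
  · exact h4 (by simp [hm.le])

theorem integrableOn_reflect {g : ℝ → ℝ} (hg : IntegrableOn g (Ioo 0 1)) :
    IntegrableOn (fun t => g (1 - t)) (Ioo 0 1) := by
  rw [← intervalIntegrable_iff_integrableOn_Ioo_of_le zero_le_one] at hg ⊢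
  simpa using (hg.comp_sub_left 1).symm

theorem eq_zero_of_abs_le_mul_right {f g : ℝ → ℝ} (hf : ContinuousAt f 1)
    (hg : IntegrableOn g (Ioo 0 1)) (h : ∀ t ∈ Ioo (0 : ℝ) 1, |f t| ≤ (1 - t) * |g t|) :
    f 1 = 0 := by
  have := eq_zero_of_abs_le_mul (f := fun t => f (1 - t)) (g := fun t => g (1 - t))
    (ContinuousAt.comp (by simpa using hf) (by fun_prop)) (integrableOn_reflect hg)
    fun t ht => by
      have := h (1 - t) ⟨by linarith [ht.2], by linarith [ht.1]⟩
      simpa using this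
  simpa using this

/-- Smooth unit speed profile solving the reduced Euler-Lagrange equation with multipliers
`lam` (volume) and `mu` (area). -/
structure SmoothProfile (r c s k : ℝ → ℝ) (lam mu : ℝ) : Prop where
  continuous_c : Continuous c
  continuous_s : Continuous s
  unit : ∀ t, c t ^ 2 + s t ^ 2 = 1
  deriv_r : ∀ t, HasDerivAt r (c t) t
  r_zero : r 0 = 0
  r_one : r 1 = 0
  r_pos : ∀ t ∈ Ioo (0 : ℝ) 1, 0 < r t
  deriv_c : ∀ t ∈ Ioo (0 : ℝ) 1, HasDerivAt c (-(s t * k t)) t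
  deriv_s : ∀ t ∈ Ioo (0 : ℝ) 1, HasDerivAt s (c t * k t) t
  contDiffOn_k : ContDiffOn ℝ ∞ k (Ioo 0 1)
  integrable_curv : IntegrableOn (fun t => k t ^ 2 * r t) (Ioo 0 1)
  integrable_rot : IntegrableOn (fun t => s t ^ 2 / r t) (Ioo 0 1)
  -- Multiplied by `c`, so that it also holds where `c` vanishes; where `c ≠ 0` it is a first order
  -- equation for the mean curvature.
  euler : ∀ t ∈ Ioo (0 : ℝ) 1, c t * deriv (fun y => k y + s y / r y) t
    = lam * r t * c t ^ 2 / 2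
      + s t * ((s t / r t) ^ 2 - k t ^ 2 + mu + lam * r t * s t) / 2

namespace UnitProfile
variable {r c s κ : ℝ → ℝ}

theorem hasDerivAt_primHalf {G : ℝ → ℝ} (hG : ContinuousOn G (Ioo 0 1)) {t : ℝ}
    (ht : t ∈ Ioo (0 : ℝ) 1) : HasDerivAt (primHalf G) (G t) t := by
  have h2 : (1 / 2 : ℝ) ∈ Ioo (0 : ℝ) 1 := by constructor <;> norm_num
  refine intervalIntegral.integral_hasDerivAt_right
    ((LocInt.of_continuousOn hG).intervalIntegrable h2 ht) ?_ (hG.continuousAt (Ioo_mem_nhds ht.1 ht.2))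
  exact ContinuousOn.stronglyMeasurableAtFilter isOpen_Ioo hG t ht

theorem abs_c_le (h : UnitProfile r c s κ) (t : ℝ) : |c t| ≤ 1 := by
  rw [abs_le_one_iff_mul_self_le_one]; nlinarith [h.unit t, sq_nonneg (s t)]

theorem r_le_left (h : UnitProfile r c s κ) {t : ℝ} (ht : 0 ≤ t) : r t ≤ t := by
  rw [h.r_eq]
  have := intervalIntegral.norm_integral_le_of_norm_le_const (a := 0) (b := t) (f := c) (C := 1)
    fun x _ => h.abs_c_le x
  rw [sub_zero, abs_of_nonneg ht, one_mul, Real.norm_eq_abs] at this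
  exact (le_abs_self _).trans this

theorem r_le_right (h : UnitProfile r c s κ) {t : ℝ} (ht : t ≤ 1) : r t ≤ 1 - t := by
  have h1 : r t = -∫ x in t..1, c x := by
    have := intervalIntegral.integral_add_adjacent_intervals
      (h.continuous_c.intervalIntegrable (μ := volume) 0 t)
      (h.continuous_c.intervalIntegrable t 1)
    rw [← h.r_eq, ← h.r_eq, h.r_one] at this
    linarith
  have := intervalIntegral.norm_integral_le_of_norm_le_const (a := t) (b := 1) (f := c) (C := 1)
    fun x _ => h.abs_c_le x
  rw [abs_of_nonneg (sub_nonneg.2 ht), one_mul, Real.norm_eq_abs] at this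
  rw [h1]
  exact (neg_le_abs _).trans this

/-- As `r ≤ t`, a nonzero `s 0` would make `s²/r` non-integrable: finite energy forces the profile
to meet the axis at a right angle. -/
theorem s_zero (h : UnitProfile r c s κ) : s 0 = 0 := by
  have : s 0 ^ 2 = 0 := by
    refine eq_zero_of_abs_le_mul (f := fun t => s t ^ 2) (h.continuous_s.pow 2).continuousAt
      h.integrable_rot fun t ht => ?_
    have hr := h.r_pos t ht
    rw [abs_div, abs_of_pos hr, mul_div_assoc', le_div_iff₀ hr, mul_comm]
    exact mul_le_mul_of_nonneg_right (h.r_le_left ht.1.le) (abs_nonneg _)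
  simpa using this

theorem s_one (h : UnitProfile r c s κ) : s 1 = 0 := by
  have : s 1 ^ 2 = 0 := by
    refine eq_zero_of_abs_le_mul_right (f := fun t => s t ^ 2) (h.continuous_s.pow 2).continuousAt
      h.integrable_rot fun t ht => ?_
    have hr := h.r_pos t ht
    rw [abs_div, abs_of_pos hr, mul_div_assoc', le_div_iff₀ hr, mul_comm]
    exact mul_le_mul_of_nonneg_right (h.r_le_right ht.2.le) (abs_nonneg _)
  simpa using this

/-- Conservation of the boundary values of `r * Q` forces a vanishing first integral. -/
theorem first_integral_eq_zero (h : UnitProfile r c s κ) {Q : ℝ → ℝ} {e lam mu : ℝ}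
    (hQ : ∀ t ∈ Ioo (0 : ℝ) 1,
      HasDerivAt (fun y => r y * Q y) (e + 2 * mu * r t + 3 * lam * (r t ^ 2 * s t)) t)
    (hint : IntegrableOn (fun t => Q t * c t) (Ioo 0 1))
    (hmul : 2 * mu * unitArea r + 3 * lam * unitVol r s = 0) : e = 0 := by
  have hr := h.continuous_r
  have hs := h.continuous_s
  have hc := h.continuous_c
  let g : ℝ → ℝ := fun t => e + 2 * mu * r t + 3 * lam * (r t ^ 2 * s t)
  have hg : Continuous g := by fun_prop
  -- A continuous version of `rQ` on the whole line; the derivative of `rQ` is bounded, although `Q`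
  -- itself may blow up at the poles.
  let R : ℝ → ℝ := fun t => r (1 / 2) * Q (1 / 2) + ∫ y in (1 / 2 : ℝ)..t, g y
  have hR : ∀ t, HasDerivAt R (g t) t := fun t =>
    (hg.integral_hasStrictDerivAt (1 / 2) t).hasDerivAt.const_add _
  have hRc : Continuous R := continuous_iff_continuousAt.2 fun t => (hR t).continuousAt
  have h2 : (1 / 2 : ℝ) ∈ Ioo (0 : ℝ) 1 := by constructor <;> norm_num
  have hRQ : EqOn R (fun t => r t * Q t) (Ioo 0 1) :=
    isOpen_Ioo.eqOn_of_deriv_eq isPreconnected_Ioo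
      (fun t _ => (hR t).differentiableAt.differentiableWithinAt)
      (fun t ht => (hQ t ht).differentiableAt.differentiableWithinAt)
      (fun t ht => by rw [(hR t).deriv, (hQ t ht).deriv]) h2 (by simp [R])
  have habs : ∀ t ∈ Ioo (0 : ℝ) 1, |R t * c t| = r t * |Q t * c t| := fun t ht => by
    rw [hRQ ht, mul_assoc, abs_mul, abs_of_pos (h.r_pos t ht)]
  -- `R c = r * (Qc)` with `Qc` integrable and `r ≤ t`, so `R c` vanishes at the pole; there `c² =
  -- 1`.
  have hR0 : R 0 = 0 := by
    have h3 := eq_zero_of_abs_le_mul (f := fun t => R t * c t) (hRc.mul hc).continuousAt hint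
      fun t ht => (habs t ht).trans_le
        (mul_le_mul_of_nonneg_right (h.r_le_left ht.1.le) (abs_nonneg _))
    rcases mul_eq_zero.1 h3 with h4 | h4
    · exact h4
    · have := h.unit 0; rw [h4, h.s_zero] at this; norm_num at this
  have hR1 : R 1 = 0 := by
    have h3 := eq_zero_of_abs_le_mul_right (f := fun t => R t * c t) (hRc.mul hc).continuousAt hint
      fun t ht => (habs t ht).trans_le
        (mul_le_mul_of_nonneg_right (h.r_le_right ht.2.le) (abs_nonneg _))
    rcases mul_eq_zero.1 h3 with h4 | h4
    · exact h4
    · have := h.unit 1; rw [h4, h.s_one] at this; norm_num at this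
  have h5 : ∫ t in (0 : ℝ)..1, g t = R 1 - R 0 :=
    intervalIntegral.integral_eq_sub_of_hasDerivAt (fun t _ => hR t) (hg.intervalIntegrable _ _)
  -- Only `e` survives the integration, by the relation between the two multipliers.
  have h6 : ∫ t in (0 : ℝ)..1, g t = e + (2 * mu * unitArea r + 3 * lam * unitVol r s) := by
    simp only [g]
    rw [intervalIntegral.integral_add, intervalIntegral.integral_add,
      intervalIntegral.integral_const_mul, intervalIntegral.integral_const_mul, unitArea, unitVol]
    · simp; ring
    all_goals exact Continuous.intervalIntegrable (by fun_prop) _ _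
  rw [hR0, hR1, h6, hmul] at h5
  simpa using h5

end UnitProfile
theorem integral_linear_combination {f₁ f₂ f₃ f₄ : ℝ → ℝ} (h₁ : Integrable f₁) (h₂ : Integrable f₂)
    (h₃ : Integrable f₃) (h₄ : Integrable f₄) (x y z : ℝ) :
    ∫ t, (f₁ t + x * f₂ t + y * f₃ t + z * f₄ t)
      = (∫ t, f₁ t) + x * (∫ t, f₂ t) + y * (∫ t, f₃ t) + z * ∫ t, f₄ t := by
  rw [integral_add (f := fun t => f₁ t + x * f₂ t + y * f₃ t)
      ((h₁.add (h₂.const_mul x)).add (h₃.const_mul y)) (h₄.const_mul z),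
    integral_add (f := fun t => f₁ t + x * f₂ t) (h₁.add (h₂.const_mul x)) (h₃.const_mul y),
    integral_add h₁ (h₂.const_mul x), integral_const_mul, integral_const_mul, integral_const_mul]

namespace UnitProfile
variable {r c s κ : ℝ → ℝ}

theorem hasDerivAt_c (h : UnitProfile r c s κ) {k : ℝ → ℝ} (hk : ContinuousOn k (Ioo 0 1))
    (hκ : ∀ᵐ t, t ∈ Ioo (0 : ℝ) 1 → κ t = k t) {t : ℝ} (ht : t ∈ Ioo (0 : ℝ) 1) :
    HasDerivAt c (-(s t * k t)) t := by
  have hg : ContinuousOn (fun y => -(s y * k y)) (Ioo 0 1) :=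
    (h.continuous_s.continuousOn.mul hk).neg
  have h1 := eqOn_primitive_of_weak_deriv h.continuous_c.continuousOn
    (LocInt.of_continuousOn hg) fun ψ hψ => by
      rw [h.weak_c ψ hψ]
      simp only [mul_neg, integral_neg, neg_neg]
      exact integral_test_congr hψ (hκ.mono fun y hy hy' => by rw [hy hy'])
  refine ((hasDerivAt_primHalf hg ht).const_add (c (1 / 2))).congr_of_eventuallyEq ?_
  filter_upwards [Ioo_mem_nhds ht.1 ht.2] with y hy
  exact h1 y hy

theorem hasDerivAt_s (h : UnitProfile r c s κ) {k : ℝ → ℝ} (hk : ContinuousOn k (Ioo 0 1))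
    (hκ : ∀ᵐ t, t ∈ Ioo (0 : ℝ) 1 → κ t = k t) {t : ℝ} (ht : t ∈ Ioo (0 : ℝ) 1) :
    HasDerivAt s (c t * k t) t := by
  have hg : ContinuousOn (fun y => c y * k y) (Ioo 0 1) := h.continuous_c.continuousOn.mul hk
  have h1 := eqOn_primitive_of_weak_deriv h.continuous_s.continuousOn
    (LocInt.of_continuousOn hg) fun ψ hψ => by
      rw [h.weak_s ψ hψ]
      exact congrArg _ (integral_test_congr hψ (hκ.mono fun y hy hy' => by rw [hy hy']))
  refine ((hasDerivAt_primHalf hg ht).const_add (s (1 / 2))).congr_of_eventuallyEq ?_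
  filter_upwards [Ioo_mem_nhds ht.1 ht.2] with y hy
  exact h1 y hy

theorem primHalf_congr_ae {f g : ℝ → ℝ} (h : ∀ᵐ t, t ∈ Ioo (0 : ℝ) 1 → f t = g t) {t : ℝ}
    (ht : t ∈ Ioo (0 : ℝ) 1) : primHalf f t = primHalf g t := by
  apply intervalIntegral.integral_congr_ae
  filter_upwards [h] with y hy hy'
  have h2 : (1 / 2 : ℝ) ∈ Ioo (0 : ℝ) 1 := by constructor <;> norm_num
  exact hy (ordConnected_Ioo.uIcc_subset h2 ht (uIoc_subset_uIcc hy'))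

/-- The combination of first integrals appearing in the Euler-Lagrange equation. -/
noncomputable def totalQ (r s κ : ℝ → ℝ) (lam mu nu t : ℝ) : ℝ :=
  primHalf (fun t => κ t ^ 2 - s t ^ 2 / r t ^ 2) t
    + lam * primHalf (fun t => 2 * r t * s t) t + mu * primHalf (fun _ => 1) t - nu

theorem hasDerivAt_totalQ (h : UnitProfile r c s κ) {k : ℝ → ℝ} (hk : ContinuousOn k (Ioo 0 1))
    (hκ : ∀ᵐ t, t ∈ Ioo (0 : ℝ) 1 → κ t = k t) {lam mu nu t : ℝ} (ht : t ∈ Ioo (0 : ℝ) 1) :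
    HasDerivAt (totalQ r s κ lam mu nu)
      (k t ^ 2 - s t ^ 2 / r t ^ 2 + 2 * lam * r t * s t + mu) t := by
  have hr := h.continuous_r
  have hs := h.continuous_s
  have h1 : ContinuousOn (fun t => k t ^ 2 - s t ^ 2 / r t ^ 2) (Ioo 0 1) :=
    (hk.pow 2).sub ((hs.pow 2).continuousOn.div (hr.pow 2).continuousOn
      fun t ht => pow_ne_zero 2 (h.r_pos t ht).ne')
  have h2 : Continuous fun t => 2 * r t * s t := by fun_prop
  have h3 := ((((hasDerivAt_primHalf h1 ht).add
    ((hasDerivAt_primHalf h2.continuousOn ht).const_mul lam)).add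
    ((hasDerivAt_primHalf (G := fun _ => 1) continuousOn_const ht).const_mul mu)).sub_const nu)
  refine (h3.congr_of_eventuallyEq ?_).congr_deriv (by ring)
  filter_upwards [Ioo_mem_nhds ht.1 ht.2] with y hy
  simp only [totalQ, Pi.add_apply]
  rw [primHalf_congr_ae (hκ.mono fun t ht ht' => by rw [ht ht']) hy]

/-- Regularity: the curvature of a profile solving the weak equation agrees almost everywhere
with a function such that `r * k` is continuously differentiable. -/
theorem exists_regular_curv (h : UnitProfile r c s κ) {lam mu nu : ℝ}
    (hEL : ∀ ψ, h.varW ψ + lam * h.varV ψ + mu * h.varA ψ + nu * h.varC ψ = 0) :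
    ∃ k : ℝ → ℝ, ContinuousOn k (Ioo 0 1) ∧ (∀ᵐ t, t ∈ Ioo (0 : ℝ) 1 → κ t = k t) ∧
      ∀ t ∈ Ioo (0 : ℝ) 1, HasDerivAt (fun y => r y * k y) (s t * c t / r t
        + lam * r t ^ 2 * c t / 2 + s t * totalQ r s κ lam mu nu t / 2) t := by
  have hr := h.continuous_r
  have hs := h.continuous_s
  have hc := h.continuous_c
  let g : ℝ → ℝ := fun t => s t * c t / r t + lam * r t ^ 2 * c t / 2
    + s t * totalQ r s κ lam mu nu t / 2
  have hQ : ContinuousOn (totalQ r s κ lam mu nu) (Ioo 0 1) :=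
    (((continuousOn_primHalf h.locInt_potential).add
      (continuousOn_const.mul (continuousOn_primHalf h.locInt_two_mul))).add
      (continuousOn_const.mul (continuousOn_primHalf
        (LocInt.of_continuousOn continuousOn_const)))).sub continuousOn_const
  have hg : ContinuousOn g (Ioo 0 1) :=
    ((h.continuousOn_div_r (hs.mul hc)).add (Continuous.continuousOn (by fun_prop))).add
      ((hs.continuousOn.mul hQ).div_const 2)
  have hrκ : LocInt fun t => r t * κ t := h.locInt_mul_curv hr
  -- The multiplier equation, halved: `g` is a weak derivative of `r κ`. As `g` is continuous, `r κ`
  -- agrees almost everywhere with a `C¹` function.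
  have hweak : ∀ ψ, IsTest ψ → ∫ t, deriv ψ t * (r t * κ t) = -∫ t, ψ t * g t := by
    intro ψ hψ
    have h1 := hEL ⟨ψ, hψ⟩
    have eC : h.varC ⟨ψ, hψ⟩ = ∫ t, ψ t * (-s t) := rfl
    have eA : h.varA ⟨ψ, hψ⟩ = ∫ t, ψ t * (s t * primHalf (fun _ => 1) t) := rfl
    have eV : h.varV ⟨ψ, hψ⟩ = ∫ t, ψ t * (r t ^ 2 * c t
      + s t * primHalf (fun t => 2 * r t * s t) t) := rfl
    have eW : h.varW ⟨ψ, hψ⟩ = (∫ t, deriv ψ t * (2 * r t * κ t)) + ∫ t, ψ t *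
      (2 * s t * c t / r t + s t * primHalf (fun t => κ t ^ 2 - s t ^ 2 / r t ^ 2) t) := rfl
    have iC := (LocInt.of_continuousOn h.continuous_s.neg.continuousOn).integrable_mul hψ
    have iA := (LocInt.of_continuousOn (h.continuous_s.continuousOn.mul
      (continuousOn_primHalf (LocInt.of_continuousOn continuousOn_const)))
        : LocInt (fun t => s t * primHalf (fun _ => 1) t)).integrable_mul hψ
    have iV := (LocInt.of_continuousOn (((h.continuous_r.pow 2).mul
      h.continuous_c).continuousOn.add (h.continuous_s.continuousOn.mul
        (continuousOn_primHalf h.locInt_two_mul)))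
        : LocInt (fun t => r t ^ 2 * c t
          + s t * primHalf (fun t => 2 * r t * s t) t)).integrable_mul hψ
    have iW := (LocInt.of_continuousOn ((h.continuousOn_div_r
      ((continuous_const.mul h.continuous_s).mul h.continuous_c)).add
        (h.continuous_s.continuousOn.mul (continuousOn_primHalf h.locInt_potential)))
        : LocInt (fun t => 2 * s t * c t / r t
          + s t * primHalf (fun t => κ t ^ 2 - s t ^ 2 / r t ^ 2) t)).integrable_mul hψ
    have e1 : (2 : ℝ) * ∫ t, ψ t * g t = (∫ t, ψ t * (2 * s t * c t / r t
          + s t * primHalf (fun t => κ t ^ 2 - s t ^ 2 / r t ^ 2) t))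
        + lam * h.varV ⟨ψ, hψ⟩ + mu * h.varA ⟨ψ, hψ⟩ + nu * h.varC ⟨ψ, hψ⟩ := by
      rw [eC, eA, eV]
      refine Eq.trans ?_ (integral_linear_combination iW iV iA iC lam mu nu)
      rw [← integral_const_mul]
      congr 1; ext t
      simp only [g, totalQ, Pi.neg_apply]
      ring
    have e2 : ∫ t, deriv ψ t * (2 * r t * κ t) = 2 * ∫ t, deriv ψ t * (r t * κ t) := by
      rw [← integral_const_mul]; congr 1; ext t; ring
    rw [eW, e2] at h1
    linarith
  obtain ⟨C, hC⟩ := ae_eq_primitive_of_weak_deriv hrκ (LocInt.of_continuousOn hg) hweak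
  let p : ℝ → ℝ := fun t => C + primHalf g t
  have hp : ∀ t ∈ Ioo (0 : ℝ) 1, HasDerivAt p (g t) t := fun t ht =>
    (hasDerivAt_primHalf hg ht).const_add C
  have hrk : ∀ t ∈ Ioo (0 : ℝ) 1, r t * (p t / r t) = p t := fun t ht =>
    mul_div_cancel₀ _ (h.r_pos t ht).ne'
  refine ⟨fun t => p t / r t, ?_, ?_, ?_⟩
  · exact ContinuousOn.div (fun t ht => (hp t ht).continuousAt.continuousWithinAt)
      hr.continuousOn fun t ht => (h.r_pos t ht).ne'
  · filter_upwards [hC] with t ht ht'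
    rw [eq_div_iff (h.r_pos t ht').ne', mul_comm]
    exact ht ht'
  · intro t ht
    refine (hp t ht).congr_of_eventuallyEq ?_
    filter_upwards [Ioo_mem_nhds ht.1 ht.2] with y hy
    exact hrk y hy

/-- Bootstrapping gives interior smoothness. The nonlocal `Q` is then removed by a conserved
quantity, whose value is zero by `first_integral_eq_zero`. -/
theorem exists_smoothProfile_of_regular (h : UnitProfile r c s κ) {lam mu nu : ℝ}
    (hmul : 2 * mu * unitArea r + 3 * lam * unitVol r s = 0)
    (hEL : ∀ ψ, h.varW ψ + lam * h.varV ψ + mu * h.varA ψ + nu * h.varC ψ = 0) :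
    ∃ k, SmoothProfile r c s k lam mu := by
  obtain ⟨k, hk, hκ, hrk⟩ := h.exists_regular_curv hEL
  set Q := totalQ r s κ lam mu nu with hQdef
  have hr := h.hasDerivAt_r
  have hc := fun t ht => h.hasDerivAt_c hk hκ (t := t) ht
  have hs := fun t ht => h.hasDerivAt_s hk hκ (t := t) ht
  have hQ : ∀ t ∈ Ioo (0 : ℝ) 1, HasDerivAt Q
      (k t ^ 2 - s t ^ 2 / r t ^ 2 + 2 * lam * r t * s t + mu) t := fun t ht =>
    h.hasDerivAt_totalQ hk hκ ht
  have hk' : ∀ t ∈ Ioo (0 : ℝ) 1, HasDerivAt k ((s t * c t / r t + lam * r t ^ 2 * c t / 2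
      + s t * Q t / 2 - c t * k t) / r t) t := by
    intro t ht
    have hr0 := (h.r_pos t ht).ne'
    refine (((hrk t ht).div (hr t) hr0).congr_of_eventuallyEq ?_).congr_deriv ?_
    · filter_upwards [Ioo_mem_nhds ht.1 ht.2] with y hy
      simp only [Pi.div_apply]
      rw [mul_div_cancel_left₀ _ (h.r_pos y hy).ne']
    · field_simp
  -- The five functions solve a closed first order system, rational with powers of `r > 0` as
  -- denominators, so each pass gains one derivative.
  have hsmooth : ∀ n : ℕ, ContDiffOn ℝ n r (Ioo 0 1) ∧ ContDiffOn ℝ n c (Ioo 0 1) ∧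
      ContDiffOn ℝ n s (Ioo 0 1) ∧ ContDiffOn ℝ n k (Ioo 0 1) ∧ ContDiffOn ℝ n Q (Ioo 0 1) := by
    intro n
    induction n with
    | zero =>
      simp only [Nat.cast_zero, contDiffOn_zero]
      exact ⟨h.continuous_r.continuousOn, h.continuous_c.continuousOn, h.continuous_s.continuousOn,
        hk, fun t ht => (hQ t ht).continuousAt.continuousWithinAt⟩
    | succ n ih =>
      obtain ⟨ir, ic, is, ik, iQ⟩ := ih
      have hr0 : ∀ t ∈ Ioo (0 : ℝ) 1, r t ≠ 0 := fun t ht => (h.r_pos t ht).ne'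
      have hr2 : ∀ t ∈ Ioo (0 : ℝ) 1, r t ^ 2 ≠ 0 := fun t ht => pow_ne_zero 2 (hr0 t ht)
      refine ⟨contDiffOn_succ_of_hasDerivAt isOpen_Ioo (fun t _ => hr t) ic,
        contDiffOn_succ_of_hasDerivAt isOpen_Ioo hc (is.mul ik).neg,
        contDiffOn_succ_of_hasDerivAt isOpen_Ioo hs (ic.mul ik),
        contDiffOn_succ_of_hasDerivAt isOpen_Ioo hk' ?_,
        contDiffOn_succ_of_hasDerivAt isOpen_Ioo hQ ?_⟩
      · exact (((((is.mul ic).div ir hr0).add (((contDiffOn_const.mul (ir.pow 2)).mul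
          ic).div_const 2)).add ((is.mul iQ).div_const 2)).sub (ic.mul ik)).div ir hr0
      · exact (((ik.pow 2).sub ((is.pow 2).div (ir.pow 2) hr2)).add
          ((contDiffOn_const.mul ir).mul is)).add contDiffOn_const
  have hcurv : IntegrableOn (fun t => k t ^ 2 * r t) (Ioo 0 1) := by
    refine h.integrable_curv.congr ((ae_restrict_iff' measurableSet_Ioo).2 ?_)
    filter_upwards [hκ] with t ht ht'
    rw [ht ht']
  -- The first integral of the system. Writing `r k²` as `(r k) k` lets the derivative of `r k` be
  -- used directly.
  let E : ℝ → ℝ := fun t => r t * k t * k t - s t ^ 2 / r t - mu * r t - lam * (r t ^ 2 * s t)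
    + Q t * c t
  have hE : ∀ t ∈ Ioo (0 : ℝ) 1, HasDerivAt E 0 t := by
    intro t ht
    have hr0 := (h.r_pos t ht).ne'
    refine ((((((hrk t ht).mul (hk' t ht)).sub (((hs t ht).pow 2).div (hr t) hr0)).sub
      ((hr t).const_mul mu)).sub ((((hr t).pow 2).mul (hs t ht)).const_mul lam)).add
      ((hQ t ht).mul (hc t ht))).congr_deriv ?_
    have hu := h.unit t
    simp only [Pi.pow_apply]
    field_simp
    ring
  obtain ⟨e, he⟩ : ∃ e, ∀ t ∈ Ioo (0 : ℝ) 1, E t = e :=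
    isOpen_Ioo.exists_is_const_of_deriv_eq_zero isPreconnected_Ioo
      (fun t ht => (hE t ht).differentiableAt.differentiableWithinAt)
      (fun t ht => (hE t ht).deriv)
  have hQc : ∀ t ∈ Ioo (0 : ℝ) 1, Q t * c t
      = e - k t ^ 2 * r t + s t ^ 2 / r t + mu * r t + lam * (r t ^ 2 * s t) := fun t ht => by
    have := he t ht
    simp only [E] at this
    linear_combination this
  have he0 : e = 0 := by
    refine h.first_integral_eq_zero (Q := Q) (fun t ht => ?_) ?_ hmul
    · refine ((hr t).mul (hQ t ht)).congr_deriv ?_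
      have hr0 := (h.r_pos t ht).ne'
      have h2 : r t * (s t ^ 2 / r t ^ 2) = s t ^ 2 / r t := by field_simp
      linear_combination hQc t ht - h2
    -- `Qc` is a combination of the two integrable energy densities and bounded functions, although
    -- `Q` need not be bounded.
    · have hb : ∀ {f : ℝ → ℝ}, Continuous f → IntegrableOn f (Ioo 0 1) := fun hf =>
        (hf.integrableOn_Icc (a := 0) (b := 1)).mono_set Ioo_subset_Icc_self
      have hrc := h.continuous_r
      have hsc := h.continuous_s
      refine IntegrableOn.congr_fun ((((hb (f := fun _ => e) continuous_const).sub hcurv).add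
        h.integrable_rot).add (hb (f := fun t => mu * r t + lam * (r t ^ 2 * s t)) (by fun_prop)))
        (fun t ht => ?_) measurableSet_Ioo
      simp only [Pi.add_apply, Pi.sub_apply]
      rw [hQc t ht]; ring
  refine ⟨k, h.continuous_c, h.continuous_s, h.unit, hr, h.r_zero, h.r_one, h.r_pos, hc, hs,
    contDiffOn_infty.2 fun n => (hsmooth n).2.2.2.1, hcurv, h.integrable_rot, fun t ht => ?_⟩
  have hr0 := (h.r_pos t ht).ne'
  have hH : HasDerivAt (fun y => k y + s y / r y) _ t := (hk' t ht).add ((hs t ht).div (hr t) hr0)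
  rw [hH.deriv]
  have h1 := hQc t ht
  have h2 : r t * (s t ^ 2 / r t ^ 2) = s t ^ 2 / r t := by field_simp
  rw [he0] at h1
  field_simp at h1 ⊢
  linear_combination s t * h1

/-- The constraint equation `lam r² c + s Q = 0` makes `(Q, -lam r²)` a multiple `η` of `(c, s)`.
One finds `η' = mu c`, and the vanishing first integral gives `η = mu r`. Thus `s = -(lam/mu) r`, so
the rotational and meridian curvatures are the same constant, and the Euler-Lagrange equation with
zero multipliers is immediate. -/
theorem exists_smoothProfile_of_singular (h : UnitProfile r c s κ) (hV : unitVol r s ≠ 0)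
    {lam mu nu : ℝ} (hne : lam ≠ 0 ∨ nu ≠ 0)
    (hmul : 2 * mu * unitArea r + 3 * lam * unitVol r s = 0)
    (hEL : ∀ ψ, lam * h.varV ψ + mu * h.varA ψ + nu * h.varC ψ = 0) :
    ∃ k, SmoothProfile r c s k 0 0 := by
  have hr := h.continuous_r
  have hs := h.continuous_s
  have hc := h.continuous_c
  have hdr := h.hasDerivAt_r
  have hpc : ∀ {f : ℝ → ℝ}, Continuous f → ∀ t, HasDerivAt (primHalf f) (f t) t := fun hf t =>
    (hf.integral_hasStrictDerivAt (1 / 2) t).hasDerivAt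
  let Q : ℝ → ℝ := fun t => lam * primHalf (fun t => 2 * r t * s t) t
    + mu * primHalf (fun _ => 1) t - nu
  have hQ : ∀ t, HasDerivAt Q (2 * lam * r t * s t + mu) t := fun t =>
    ((((hpc (f := fun t => 2 * r t * s t) (by fun_prop) t).const_mul lam).add
      ((hpc (f := fun _ => 1) continuous_const t).const_mul mu)).sub_const nu).congr_deriv (by ring)
  have hQc : Continuous Q := continuous_iff_continuousAt.2 fun t => (hQ t).continuousAt
  have hlin : ∀ t ∈ Ioo (0 : ℝ) 1, lam * r t ^ 2 * c t + s t * Q t = 0 := by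
    refine eqOn_of_ae_eq_of_continuousOn (f := fun t => lam * r t ^ 2 * c t + s t * Q t)
      (g := fun _ => 0) (Continuous.continuousOn (by fun_prop)) continuousOn_const ?_
    refine ae_eq_zero_of_test (LocInt.of_continuousOn (Continuous.continuousOn (by fun_prop)))
      fun ψ hψ => ?_
    rw [← hEL ⟨ψ, hψ⟩]
    have eC : h.varC ⟨ψ, hψ⟩ = ∫ t, ψ t * (-s t) := rfl
    have eA : h.varA ⟨ψ, hψ⟩ = ∫ t, ψ t * (s t * primHalf (fun _ => 1) t) := rfl
    have eV : h.varV ⟨ψ, hψ⟩ = ∫ t, ψ t * (r t ^ 2 * c t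
      + s t * primHalf (fun t => 2 * r t * s t) t) := rfl
    have iC := (LocInt.of_continuousOn h.continuous_s.neg.continuousOn).integrable_mul hψ
    have iA := (LocInt.of_continuousOn (h.continuous_s.continuousOn.mul
      (continuousOn_primHalf (LocInt.of_continuousOn continuousOn_const)))
        : LocInt (fun t => s t * primHalf (fun _ => 1) t)).integrable_mul hψ
    have iV := (LocInt.of_continuousOn (((h.continuous_r.pow 2).mul
      h.continuous_c).continuousOn.add (h.continuous_s.continuousOn.mul
        (continuousOn_primHalf h.locInt_two_mul)))
        : LocInt (fun t => r t ^ 2 * c t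
          + s t * primHalf (fun t => 2 * r t * s t) t)).integrable_mul hψ
    rw [eC, eA, eV]
    have e1 := integral_linear_combination (f₁ := fun _ => 0) (integrable_zero ℝ ℝ volume)
      iV iA iC lam mu nu
    rw [integral_zero, zero_add] at e1
    refine Eq.trans ?_ e1
    congr 1; ext t
    simp only [Q, Pi.neg_apply]
    ring
  -- Otherwise the relation between the multipliers gives `mu = 0`, so `nu ≠ 0`; then `s` vanishes
  -- identically and the volume is zero.
  have hlam : lam ≠ 0 := by
    rintro rfl
    have hnu : nu ≠ 0 := hne.resolve_left (by simp)
    have hmu : mu = 0 := by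
      have := h.unitArea_pos
      rw [mul_zero, zero_mul, add_zero] at hmul
      rcases mul_eq_zero.1 hmul with h1 | h1
      · linarith
      · exact absurd h1 this.ne'
    subst hmu
    apply hV
    have hs0 : ∀ t ∈ Ioo (0 : ℝ) 1, s t = 0 := fun t ht => by
      have h1 : s t * nu = 0 := by simpa [Q] using hlin t ht
      exact (mul_eq_zero.1 h1).resolve_right hnu
    rw [unitVol, intervalIntegral.integral_of_le zero_le_one, integral_Ioc_eq_integral_Ioo,
      setIntegral_congr_fun (g := fun _ => 0) measurableSet_Ioo fun t ht => by simp [hs0 t ht]]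
    simp
  let η : ℝ → ℝ := fun t => Q t * c t - lam * r t ^ 2 * s t
  have hηc : Continuous η := by fun_prop
  have hcη : ∀ t ∈ Ioo (0 : ℝ) 1, Q t = η t * c t := fun t ht => by
    simp only [η]
    linear_combination (-Q t) * h.unit t + s t * hlin t ht
  have hsη : ∀ t ∈ Ioo (0 : ℝ) 1, lam * r t ^ 2 = -(η t * s t) := fun t ht => by
    simp only [η]
    linear_combination (-lam * r t ^ 2) * h.unit t + c t * hlin t ht
  -- `η` is defined through `c` and `s`, so far only continuous. Its square `N` is differentiable
  -- and positive, so `η` is one fixed sign times `√N`, hence differentiable.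
  let N : ℝ → ℝ := fun t => Q t ^ 2 + (lam * r t ^ 2) ^ 2
  have hN : ∀ t ∈ Ioo (0 : ℝ) 1, N t = η t ^ 2 := fun t ht => by
    simp only [N]
    rw [hcη t ht, hsη t ht]
    linear_combination η t ^ 2 * h.unit t
  have hNpos : ∀ t ∈ Ioo (0 : ℝ) 1, 0 < N t := fun t ht => by
    have : lam * r t ^ 2 ≠ 0 := mul_ne_zero hlam (pow_ne_zero 2 (h.r_pos t ht).ne')
    simp only [N]; positivity
  have hη0 : ∀ t ∈ Ioo (0 : ℝ) 1, η t ≠ 0 := fun t ht h0 => by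
    have := hNpos t ht; rw [hN t ht, h0] at this; norm_num at this
  have hN' : ∀ t ∈ Ioo (0 : ℝ) 1, HasDerivAt N (2 * mu * c t * η t) t := fun t ht => by
    refine (((hQ t).pow 2).add (((hdr t).pow 2).const_mul lam |>.pow 2)).congr_deriv ?_
    simp only [Pi.pow_apply]
    have := hcη t ht
    push_cast
    linear_combination 4 * lam * r t * hlin t ht + 2 * mu * this
  have hsqrt : ∀ t ∈ Ioo (0 : ℝ) 1, HasDerivAt (fun y => √(N y))
      (2 * mu * c t * η t / (2 * √(N t))) t := fun t ht => (hN' t ht).sqrt (hNpos t ht).ne'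
  have hη' : ∀ t ∈ Ioo (0 : ℝ) 1, HasDerivAt η (mu * c t) t := by
    have hsq : EqOn (η ^ 2) ((fun y => √(N y)) ^ 2) (Ioo 0 1) := fun t ht => by
      simp only [Pi.pow_apply]
      rw [Real.sq_sqrt (hNpos t ht).le, hN t ht]
    have hNc : ContinuousOn (fun y => √(N y)) (Ioo 0 1) := fun t ht =>
      (hsqrt t ht).continuousAt.continuousWithinAt
    rcases isPreconnected_Ioo.eq_or_eq_neg_of_sq_eq hηc.continuousOn hNc hsq
      (fun {t} ht => (Real.sqrt_pos.2 (hNpos t ht)).ne') with h1 | h1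
    · intro t ht
      refine ((hsqrt t ht).congr_of_eventuallyEq ?_).congr_deriv ?_
      · filter_upwards [Ioo_mem_nhds ht.1 ht.2] with y hy using h1 hy
      · have h2 : η t = √(N t) := h1 ht
        have := hη0 t ht
        rw [← h2]; field_simp
    · intro t ht
      refine ((hsqrt t ht).neg.congr_of_eventuallyEq ?_).congr_deriv ?_
      · filter_upwards [Ioo_mem_nhds ht.1 ht.2] with y hy using h1 hy
      · have h2 : η t = -√(N t) := h1 ht
        have h3 : √(N t) = -η t := by rw [h2, neg_neg]
        have := hη0 t ht
        rw [h3]; field_simp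
  obtain ⟨e, he⟩ : ∃ e, ∀ t ∈ Ioo (0 : ℝ) 1, η t - mu * r t = e :=
    isOpen_Ioo.exists_is_const_of_deriv_eq_zero isPreconnected_Ioo
      (fun t ht => ((hη' t ht).sub ((hdr t).const_mul mu)).differentiableAt.differentiableWithinAt)
      (fun t ht => by
        have := ((hη' t ht).sub ((hdr t).const_mul mu)).deriv
        rw [sub_self] at this
        exact this)
  have he0 : e = 0 := by
    refine h.first_integral_eq_zero (Q := Q) (fun t ht => ?_) ?_ hmul
    · refine ((hdr t).mul (hQ t)).congr_deriv ?_
      linear_combination c t * hcη t ht + η t * h.unit t + he t ht - s t * hsη t ht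
    · exact (Continuous.integrableOn_Icc (by fun_prop) (a := 0) (b := 1)).mono_set
        Ioo_subset_Icc_self
  subst he0
  have hηr : ∀ t ∈ Ioo (0 : ℝ) 1, η t = mu * r t := fun t ht => sub_eq_zero.1 (he t ht)
  have h2 : (1 / 2 : ℝ) ∈ Ioo (0 : ℝ) 1 := by constructor <;> norm_num
  have hmu : mu ≠ 0 := fun h0 => hη0 _ h2 (by rw [hηr _ h2, h0, zero_mul])
  have hsr : ∀ t ∈ Ioo (0 : ℝ) 1, s t = -lam / mu * r t := fun t ht => by
    have h3 := hsη t ht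
    rw [hηr t ht] at h3
    have := (h.r_pos t ht).ne'
    field_simp
    apply mul_left_cancel₀ this
    linear_combination h3
  have hcr : ∀ t ∈ Ioo (0 : ℝ) 1, c t = Q t / (mu * r t) := fun t ht => by
    have h3 := hcη t ht
    rw [hηr t ht] at h3
    have := (h.r_pos t ht).ne'
    rw [h3]; field_simp
  refine ⟨fun _ => -lam / mu, hc, hs, h.unit, hdr, h.r_zero, h.r_one, h.r_pos, fun t ht => ?_,
    fun t ht => ?_, contDiffOn_const, ?_, h.integrable_rot, fun t ht => ?_⟩
  · have hr0 := (h.r_pos t ht).ne'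
    refine (((hQ t).div ((hdr t).const_mul mu) (mul_ne_zero hmu hr0)).congr_of_eventuallyEq
      ?_).congr_deriv ?_
    · filter_upwards [Ioo_mem_nhds ht.1 ht.2] with y hy using hcr y hy
    · have h3 := hcη t ht
      rw [hηr t ht] at h3
      have h4 := hsr t ht
      have h5 : lam * r t = -(mu * s t) := by rw [h4]; field_simp
      have h6 := h.unit t
      rw [h3]
      field_simp
      linear_combination s t * h5 - mu * h6
  · refine (((hdr t).const_mul (-lam / mu)).congr_of_eventuallyEq ?_).congr_deriv (by ring)
    filter_upwards [Ioo_mem_nhds ht.1 ht.2] with y hy using hsr y hy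
  · exact (Continuous.integrableOn_Icc (by fun_prop) (a := 0) (b := 1)).mono_set
        Ioo_subset_Icc_self
  · have h3 : (fun y => -lam / mu + s y / r y) =ᶠ[𝓝 t] fun _ => -lam / mu + -lam / mu := by
      filter_upwards [Ioo_mem_nhds ht.1 ht.2] with y hy
      rw [hsr y hy, mul_div_cancel_right₀ _ (h.r_pos y hy).ne']
    rw [h3.deriv_eq, deriv_const, hsr t ht, mul_div_cancel_right₀ _ (h.r_pos t ht).ne']
    ring

end UnitProfile

/-- The profile of a minimiser is a smooth solution of the Euler-Lagrange equation. -/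
theorem exists_smoothProfile {σ : ℝ} (hσ : 0 < σ) {γ : ℝ → E2} (hγ : γ ∈ Class σ)
    (hmin : willmore γ = beta σ) : ∃ L r c s κ k lam mu, HasUnitProfile γ L r c s κ ∧
      SmoothProfile r c s k lam mu := by
  obtain ⟨L, r, c, s, κ, h, hp, hV, hm⟩ := exists_minimal_unitProfile hσ hγ hmin
  obtain ⟨c₀, lam, mu, nu, hne, hmul, hEL⟩ := h.exists_multipliers hV
    fun Ψ hΨ h1 hpos hvol => hm _ _ _ _ (h.rotate hΨ h1 hpos) hvol
  by_cases hc : c₀ = 0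
  · subst hc
    obtain ⟨k, hk⟩ := h.exists_smoothProfile_of_singular hV (by simpa using hne) hmul
      fun ψ => by simpa using hEL ψ
    exact ⟨L, r, c, s, κ, k, 0, 0, hp, hk⟩
  · obtain ⟨k, hk⟩ := h.exists_smoothProfile_of_regular (lam := lam / c₀) (mu := mu / c₀)
      (nu := nu / c₀) (by field_simp; linarith) fun ψ => by
        have := hEL ψ
        field_simp
        linarith
    exact ⟨L, r, c, s, κ, k, _, _, hp, hk⟩

/-! ### Smoothness up to the endpoint of a half-open interval, and averages over dilates. -/

section halfOpen
variable {δ : ℝ}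

/-- The derivative of a function on a half-open interval, from continuity at the endpoint. -/
theorem hasDerivWithinAt_Ico {f g : ℝ → ℝ} (hf : ContinuousOn f (Ico 0 δ))
    (h : ∀ w ∈ Ioo 0 δ, HasDerivAt f (g w) w) (hg : ContinuousOn g (Ico 0 δ)) {w : ℝ}
    (hw : w ∈ Ico 0 δ) : HasDerivWithinAt f (g w) (Ico 0 δ) w := by
  rcases hw.1.eq_or_lt with h0 | h0
  · subst h0
    have hδ := hw.2
    refine (hasDerivWithinAt_Ici_of_tendsto_deriv (s := Ioo 0 δ)
      (fun x hx => (h x hx).differentiableAt.differentiableWithinAt)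
      ((hf 0 hw).mono Ioo_subset_Ico_self) (Ioo_mem_nhdsGT hδ) ?_).mono Ico_subset_Ici_self
    have h1 : Tendsto g (𝓝[>] 0) (𝓝 (g 0)) := by
      rw [← nhdsWithin_Ioo_eq_nhdsGT hδ]
      exact (hg 0 hw).mono Ioo_subset_Ico_self
    refine h1.congr' ?_
    filter_upwards [Ioo_mem_nhdsGT hδ] with x hx using (h x hx).deriv.symm
  · exact (h w ⟨h0, hw.2⟩).hasDerivWithinAt

theorem contDiffOn_succ_Ico {f g : ℝ → ℝ} {n : ℕ} (hf : ContinuousOn f (Ico 0 δ))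
    (h : ∀ w ∈ Ioo 0 δ, HasDerivAt f (g w) w) (hg : ContDiffOn ℝ n g (Ico 0 δ)) :
    ContDiffOn ℝ (n + 1 : ℕ) f (Ico 0 δ) := by
  have hd := fun w hw => hasDerivWithinAt_Ico hf h hg.continuousOn (w := w) hw
  have hu : UniqueDiffOn ℝ (Ico (0 : ℝ) δ) := uniqueDiffOn_Ico 0 δ
  push_cast
  rw [contDiffOn_succ_iff_derivWithin hu]
  exact ⟨fun w hw => (hd w hw).differentiableWithinAt, by simp,
    hg.congr fun w hw => (hd w hw).derivWithin (hu w hw)⟩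

theorem exists_hasDerivAt_Ico {f : ℝ → ℝ} {n : ℕ}
    (hf : ContDiffOn ℝ (n + 1 : ℕ) f (Ico 0 δ)) :
    ∃ g, ContDiffOn ℝ n g (Ico 0 δ) ∧ ∀ w ∈ Ioo 0 δ, HasDerivAt f (g w) w := by
  have hu : UniqueDiffOn ℝ (Ico (0 : ℝ) δ) := uniqueDiffOn_Ico 0 δ
  push_cast at hf
  rw [contDiffOn_succ_iff_derivWithin hu] at hf
  exact ⟨_, hf.2.2, fun w hw => ((hf.1 w (Ioo_subset_Ico_self hw)).hasDerivWithinAt).hasDerivAt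
    (Ico_mem_nhds hw.1 hw.2)⟩

/-- A weighted average of the dilates of `f`. -/
noncomputable def dilAverage (φ θ f : ℝ → ℝ) (w : ℝ) : ℝ :=
  ∫ ς in (0 : ℝ)..1, φ ς * f (θ ς * w)

variable {φ θ f f' : ℝ → ℝ}

theorem exists_continuous_extension {a : ℝ} (ha : 0 ≤ a) (haδ : a < δ)
    (hf : ContinuousOn f (Ico 0 δ)) :
    ∃ g : ℝ → ℝ, Continuous g ∧ ∀ x ∈ Icc 0 a, g x = f x := by
  refine ⟨IccExtend ha ((Icc 0 a).domRestrict f), ?_, fun x hx => IccExtend_of_mem ha _ hx⟩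
  exact (continuousOn_iff_continuous_domRestrict.1
    (hf.mono fun x hx => ⟨hx.1, hx.2.trans_lt haδ⟩)).Icc_extend'

theorem dilAverage_congr (hθ : ∀ ς ∈ Icc (0 : ℝ) 1, θ ς ∈ Icc (0 : ℝ) 1) {g : ℝ → ℝ} {a w : ℝ}
    (hg : ∀ x ∈ Icc 0 a, g x = f x) (hw : w ∈ Icc 0 a) :
    dilAverage φ θ f w = dilAverage φ θ g w := by
  refine intervalIntegral.integral_congr fun ς hς => ?_
  rw [uIcc_of_le zero_le_one] at hς
  have := hθ ς hς
  rw [hg _ ⟨mul_nonneg this.1 hw.1, (mul_le_of_le_one_left hw.1 this.2).trans hw.2⟩]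

theorem continuousOn_dilAverage (hφ : Continuous φ) (hθc : Continuous θ)
    (hθ : ∀ ς ∈ Icc (0 : ℝ) 1, θ ς ∈ Icc (0 : ℝ) 1) (hf : ContinuousOn f (Ico 0 δ)) :
    ContinuousOn (dilAverage φ θ f) (Ico 0 δ) := by
  intro w hw
  obtain ⟨a, hwa, haδ⟩ := exists_between hw.2
  obtain ⟨g, hg, hgf⟩ := exists_continuous_extension (hw.1.trans hwa.le) haδ hf
  have h1 : Continuous (dilAverage φ θ g) :=
    intervalIntegral.continuous_parametric_intervalIntegral_of_continuous'
      (f := fun w ς => φ ς * g (θ ς * w)) (by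
        simp only [Function.uncurry_def]; fun_prop) 0 1
  refine (h1.continuousWithinAt (s := Ico 0 δ) (x := w)).congr_of_eventuallyEq ?_
    (dilAverage_congr hθ hgf ⟨hw.1, hwa.le⟩)
  filter_upwards [self_mem_nhdsWithin, mem_nhdsWithin_of_mem_nhds (Iio_mem_nhds hwa)] with x hx hx'
  exact dilAverage_congr hθ hgf ⟨hx.1, le_of_lt hx'⟩

/-- Differentiation under the integral: the derivative is again an average over dilates, with weight
`φ θ` in place of `φ`. -/
theorem hasDerivAt_dilAverage (hφ : Continuous φ) (hθc : Continuous θ)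
    (hθ : ∀ ς ∈ Icc (0 : ℝ) 1, θ ς ∈ Icc (0 : ℝ) 1) (hf : ContinuousOn f (Ico 0 δ))
    (hf' : ContinuousOn f' (Ico 0 δ)) (h : ∀ w ∈ Ioo 0 δ, HasDerivAt f (f' w) w) {w : ℝ}
    (hw : w ∈ Ioo 0 δ) :
    HasDerivAt (dilAverage φ θ f) (dilAverage (fun ς => φ ς * θ ς) θ f' w) w := by
  obtain ⟨a, hwa, haδ⟩ := exists_between hw.2
  have ha : 0 ≤ a := (hw.1.trans hwa).le
  obtain ⟨g, hg, hgf⟩ := exists_continuous_extension ha haδ hf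
  obtain ⟨g', hg', hgf'⟩ := exists_continuous_extension ha haδ hf'
  obtain ⟨M, hM⟩ := isCompact_Icc.exists_bound_of_continuousOn (s := Icc 0 a) hg'.continuousOn
  have hs : Ioo 0 a ∈ 𝓝 w := Ioo_mem_nhds hw.1 hwa
  have key := intervalIntegral.hasDerivAt_integral_of_dominated_loc_of_deriv_le
    (μ := volume) (a := 0) (b := 1) (F := fun w ς => φ ς * g (θ ς * w))
    (F' := fun w ς => φ ς * θ ς * g' (θ ς * w)) (x₀ := w) (s := Ioo 0 a)
    (bound := fun ς => |φ ς * θ ς| * M) hs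
    (Eventually.of_forall fun x => Continuous.aestronglyMeasurable (by fun_prop))
    (Continuous.intervalIntegrable (by fun_prop) _ _)
    (Continuous.aestronglyMeasurable (by fun_prop)) ?_
    (Continuous.intervalIntegrable (by fun_prop) _ _) ?_
  · have h2 : dilAverage (fun ς => φ ς * θ ς) θ f' w
        = ∫ ς in (0 : ℝ)..1, φ ς * θ ς * g' (θ ς * w) :=
      dilAverage_congr hθ hgf' ⟨hw.1.le, hwa.le⟩
    rw [h2]
    refine key.2.congr_of_eventuallyEq ?_
    filter_upwards [hs] with x hx
    exact dilAverage_congr hθ hgf (Ioo_subset_Icc_self hx)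
  · refine ae_of_all _ fun ς hς x hx => ?_
    rw [uIoc_of_le zero_le_one] at hς
    have h1 := hθ ς (Ioc_subset_Icc_self hς)
    rw [norm_mul, Real.norm_eq_abs]
    exact mul_le_mul_of_nonneg_left (hM _ ⟨mul_nonneg h1.1 hx.1.le,
      (mul_le_of_le_one_left hx.1.le h1.2).trans hx.2.le⟩) (abs_nonneg _)
  · refine ae_of_all _ fun ς hς x hx => ?_
    rw [uIoc_of_le zero_le_one] at hς
    have h1 := hθ ς (Ioc_subset_Icc_self hς)
    rcases h1.1.eq_or_lt with h0 | h0
    · simp only [← h0, zero_mul, mul_zero]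
      exact hasDerivAt_const _ _
    · have hx' : θ ς * x ∈ Ioo 0 a := ⟨mul_pos h0 hx.1,
        (mul_le_of_le_one_left hx.1.le h1.2).trans_lt hx.2⟩
      have h3 : HasDerivAt g (g' (θ ς * x)) (θ ς * x) := by
        rw [hgf' _ (Ioo_subset_Icc_self hx')]
        refine (h _ ⟨hx'.1, hx'.2.trans haδ⟩).congr_of_eventuallyEq ?_
        filter_upwards [Ioo_mem_nhds hx'.1 hx'.2] with y hy using hgf y (Ioo_subset_Icc_self hy)
      refine (((h3.comp x ((hasDerivAt_id x).const_mul (θ ς))).const_mul (φ ς))).congr_deriv ?_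
      ring

/-- Since `θ ς * w` stays between `0` and `w`, averaging loses no regularity at the endpoint.
Differentiating only changes the weight, so the induction runs over all weights at once. -/
theorem contDiffOn_dilAverage (hθc : Continuous θ)
    (hθ : ∀ ς ∈ Icc (0 : ℝ) 1, θ ς ∈ Icc (0 : ℝ) 1) {n : ℕ} (hφ : Continuous φ)
    (hf : ContDiffOn ℝ n f (Ico 0 δ)) : ContDiffOn ℝ n (dilAverage φ θ f) (Ico 0 δ) := by
  induction n generalizing φ f with
  | zero =>
    rw [Nat.cast_zero, contDiffOn_zero] at hf ⊢
    exact continuousOn_dilAverage hφ hθc hθ hf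
  | succ n ih =>
    obtain ⟨f', hf', hd⟩ := exists_hasDerivAt_Ico hf
    exact contDiffOn_succ_Ico (continuousOn_dilAverage hφ hθc hθ hf.continuousOn)
      (fun w hw => hasDerivAt_dilAverage hφ hθc hθ hf.continuousOn hf'.continuousOn hd hw)
      (ih (hφ.mul hθc) hf')

end halfOpen

/-! ### Regularity at the poles, in the height variable of the round sphere. -/

/-- The parameter of the meridian as a function of the height above the south pole. -/
noncomputable def tau (w : ℝ) : ℝ := Real.arccos (1 - w) / Real.pi

theorem continuous_tau : Continuous tau := by unfold tau; fun_prop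

theorem tau_zero : tau 0 = 0 := by simp [tau]

theorem tau_mem {w : ℝ} (hw : w ∈ Ioo (0 : ℝ) 2) : tau w ∈ Ioo (0 : ℝ) 1 := by
  have h1 : 0 < Real.arccos (1 - w) := Real.arccos_pos.2 (by linarith [hw.1])
  have h2 : Real.arccos (1 - w) < Real.pi := by
    refine lt_of_le_of_ne (Real.arccos_le_pi _) fun h => ?_
    rw [Real.arccos_eq_pi] at h
    linarith [hw.2]
  exact ⟨div_pos h1 Real.pi_pos, (div_lt_one Real.pi_pos).2 h2⟩

theorem tau_one_sub_cos {t : ℝ} (ht : t ∈ Icc (0 : ℝ) 1) : tau (1 - Real.cos (Real.pi * t)) = t := by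
  have := Real.pi_pos
  rw [tau, sub_sub_cancel, Real.arccos_cos (by nlinarith [ht.1]) (by nlinarith [ht.2])]
  field_simp

theorem mul_two_sub_pos {w : ℝ} (hw : w ∈ Ioo (0 : ℝ) 2) : 0 < w * (2 - w) :=
  mul_pos hw.1 (by linarith [hw.2])

theorem hasDerivAt_tau {w : ℝ} (hw : w ∈ Ioo (0 : ℝ) 2) :
    HasDerivAt tau (1 / (Real.pi * √(w * (2 - w)))) w := by
  have h1 := ((Real.hasDerivAt_arccos (x := 1 - w) (by linarith [hw.2]) (by linarith [hw.1])).comp w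
    ((hasDerivAt_id w).const_sub 1)).div_const Real.pi
  refine h1.congr_deriv ?_
  have : 1 - (1 - w) ^ 2 = w * (2 - w) := by ring
  rw [this]
  have := Real.sqrt_pos.2 (mul_two_sub_pos hw)
  have := Real.pi_pos
  field_simp

theorem contDiffOn_tau : ContDiffOn ℝ ∞ tau (Ioo 0 2) := by
  intro w hw
  have h1 : ContDiffAt ℝ ∞ Real.arccos (1 - w) :=
    Real.contDiffAt_arccos (by linarith [hw.2]) (by linarith [hw.1])
  have h2 : ContDiffAt ℝ ∞ (fun w : ℝ => 1 - w) w := by fun_prop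
  exact ((h1.comp w h2).div_const Real.pi).contDiffWithinAt

namespace SmoothProfile
variable {r c s k : ℝ → ℝ} {lam mu : ℝ}

theorem continuous_r (h : SmoothProfile r c s k lam mu) : Continuous r :=
  continuous_iff_continuousAt.2 fun t => (h.deriv_r t).continuousAt

theorem toUnitProfile (h : SmoothProfile r c s k lam mu) : UnitProfile r c s k where
  continuous_c := h.continuous_c
  continuous_s := h.continuous_s
  unit := h.unit
  r_eq t := by
    rw [intervalIntegral.integral_eq_sub_of_hasDerivAt (fun t _ => h.deriv_r t)
      (h.continuous_c.intervalIntegrable _ _), h.r_zero, sub_zero]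
  r_one := h.r_one
  r_pos := h.r_pos
  locInt := LocInt.of_continuousOn h.contDiffOn_k.continuousOn
  locInt_sq := LocInt.of_continuousOn (h.contDiffOn_k.continuousOn.pow 2)
  weak_c ψ hψ := by
    rw [weak_deriv_of_hasDerivAt h.deriv_c
      (h.continuous_s.continuousOn.mul h.contDiffOn_k.continuousOn).neg hψ]
    simp [integral_neg]
  weak_s ψ hψ := weak_deriv_of_hasDerivAt h.deriv_s
    (h.continuous_c.continuousOn.mul h.contDiffOn_k.continuousOn) hψ
  integrable_curv := h.integrable_curv
  integrable_rot := h.integrable_rot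

/-- `s 0 = 0` leaves `c 0 = ±1`, and a negative slope would make `r` negative just after the pole.
-/
theorem c_zero (h : SmoothProfile r c s k lam mu) : c 0 = 1 := by
  have h0 := h.unit 0
  rw [h.toUnitProfile.s_zero] at h0
  have h1 : (c 0 - 1) * (c 0 + 1) = 0 := by linear_combination h0
  rcases mul_eq_zero.1 h1 with h2 | h2
  · linarith
  · exfalso
    have h3 : ∀ᶠ t in 𝓝 (0 : ℝ), c t < 0 :=
      h.continuous_c.continuousAt.eventually (gt_mem_nhds (by linarith))
    obtain ⟨ε, hε, h4⟩ := Metric.eventually_nhds_iff.1 h3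
    have hm : 0 < min ε 1 / 2 := half_pos (lt_min hε one_pos)
    have hm1 : min ε 1 / 2 < ε := (half_lt_self (lt_min hε one_pos)).trans_le (min_le_left _ _)
    have hm2 : min ε 1 / 2 < 1 := (half_lt_self (lt_min hε one_pos)).trans_le (min_le_right _ _)
    obtain ⟨x, hx, h5⟩ := exists_hasDerivAt_eq_slope r c hm h.continuous_r.continuousOn
      fun t _ => h.deriv_r t
    have h6 := h4 (y := x) (by rw [dist_zero_right, Real.norm_of_nonneg hx.1.le]; linarith [hx.2])
    rw [h5, h.r_zero, sub_zero, sub_zero] at h6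
    exact absurd h6 (not_lt.2 (div_nonneg (h.r_pos _ ⟨hm, hm2⟩).le hm.le))

theorem exists_half_lt_c (h : SmoothProfile r c s k lam mu) :
    ∃ a ∈ Ioo (0 : ℝ) 1, ∀ t ∈ Icc 0 a, 1 / 2 < c t := by
  have h3 : ∀ᶠ t in 𝓝 (0 : ℝ), 1 / 2 < c t :=
    h.continuous_c.continuousAt.eventually (lt_mem_nhds (by rw [h.c_zero]; norm_num))
  obtain ⟨ε, hε, h4⟩ := Metric.eventually_nhds_iff.1 h3
  refine ⟨min ε 1 / 2, ⟨half_pos (lt_min hε one_pos),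
    (half_lt_self (lt_min hε one_pos)).trans_le (min_le_right _ _)⟩, fun t ht => h4 ?_⟩
  rw [dist_zero_right, Real.norm_of_nonneg ht.1]
  exact ht.2.trans_lt ((half_lt_self (lt_min hε one_pos)).trans_le (min_le_left _ _))

theorem contDiffOn (h : SmoothProfile r c s k lam mu) : ContDiffOn ℝ ∞ r (Ioo 0 1) ∧
    ContDiffOn ℝ ∞ s (Ioo 0 1) := by
  have : ∀ n : ℕ, ContDiffOn ℝ n r (Ioo 0 1) ∧ ContDiffOn ℝ n c (Ioo 0 1) ∧
      ContDiffOn ℝ n s (Ioo 0 1) := by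
    intro n
    induction n with
    | zero =>
      simp only [Nat.cast_zero, contDiffOn_zero]
      exact ⟨h.continuous_r.continuousOn, h.continuous_c.continuousOn, h.continuous_s.continuousOn⟩
    | succ n ih =>
      have hk := contDiffOn_infty.1 h.contDiffOn_k n
      exact ⟨contDiffOn_succ_of_hasDerivAt isOpen_Ioo (fun t _ => h.deriv_r t) ih.2.1,
        contDiffOn_succ_of_hasDerivAt isOpen_Ioo h.deriv_c (ih.2.2.mul hk).neg,
        contDiffOn_succ_of_hasDerivAt isOpen_Ioo h.deriv_s (ih.2.1.mul hk)⟩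
  exact ⟨contDiffOn_infty.2 fun n => (this n).1, contDiffOn_infty.2 fun n => (this n).2.2⟩

/-- The Euler-Lagrange equation as a first order equation for the mean curvature. -/
theorem hasDerivAt_mean (h : SmoothProfile r c s k lam mu) {t : ℝ} (ht : t ∈ Ioo (0 : ℝ) 1)
    (hc : c t ≠ 0) : HasDerivAt (fun y => k y + s y / r y) (lam * r t * c t / 2
      + s t / c t * ((s t / r t) ^ 2 - k t ^ 2 + mu + lam * r t * s t) / 2) t := by
  have hk := (h.contDiffOn_k.contDiffAt (Ioo_mem_nhds ht.1 ht.2)).differentiableAt (by simp)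
  have hd : DifferentiableAt ℝ (fun y => k y + s y / r y) t :=
    hk.add ((h.deriv_s t ht).differentiableAt.div (h.deriv_r t).differentiableAt
      (h.r_pos t ht).ne')
  refine hd.hasDerivAt.congr_deriv ?_
  apply mul_left_cancel₀ hc
  rw [h.euler t ht]
  field_simp

/-- The mean curvature extends continuously to the pole. -/
theorem exists_mean_extension (h : SmoothProfile r c s k lam mu) {a : ℝ}
    (ha : a ∈ Ioo (0 : ℝ) 1) (hc : ∀ t ∈ Icc 0 a, 1 / 2 < c t) :
    ∃ G : ℝ → ℝ, ContinuousOn G (Icc 0 a) ∧ ∀ t ∈ Ioo 0 a, k t + s t / r t = G t := by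
  have hsub : Ioo 0 a ⊆ Ioo (0 : ℝ) 1 := Ioo_subset_Ioo_right ha.2.le
  have hrc := h.continuous_r
  have hsc := h.continuous_s
  have hcc := h.continuous_c
  have hc0 : ∀ t ∈ Icc 0 a, c t ≠ 0 := fun t ht => by linarith [hc t ht]
  have hkc : ContinuousOn k (Ioo 0 a) := h.contDiffOn_k.continuousOn.mono hsub
  have hr0 : ∀ t ∈ Ioo 0 a, r t ≠ 0 := fun t ht => (h.r_pos t (hsub ht)).ne'
  -- As `(s/r)² - k² = -(k - s/r) H`, the mean curvature solves `H' = A + B H`, with `A` continuous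
  -- up to the pole.
  let A : ℝ → ℝ := fun t => lam * r t * c t / 2 + s t / c t * (mu + lam * r t * s t) / 2
  let B : ℝ → ℝ := fun t => -(s t / c t * (k t - s t / r t) / 2)
  have hA : ContinuousOn A (Icc 0 a) := (Continuous.continuousOn (by fun_prop)).add
    (((hsc.continuousOn.div hcc.continuousOn hc0).mul
      (Continuous.continuousOn (by fun_prop))).div_const 2)
  have hBc : ContinuousOn B (Ioo 0 a) :=
    (((hsc.continuousOn.div hcc.continuousOn fun t ht => hc0 t (Ioo_subset_Icc_self ht)).mul
      (hkc.sub (hsc.continuousOn.div hrc.continuousOn hr0))).div_const 2).neg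
  -- With `u = s/r` the numerator of `B` is `r u (k - u)`, bounded by the energy densities `k² r`
  -- and `u² r`; `c` is bounded below.
  have hB : IntegrableOn B (Ioo 0 a) := by
    have hbd : IntegrableOn (fun t => 2 * (k t ^ 2 * r t) + 2 * (s t ^ 2 / r t)) (Ioo 0 a) :=
      IntegrableOn.mono_set ((h.integrable_curv.const_mul 2).add (h.integrable_rot.const_mul 2))
        hsub
    refine Integrable.mono' hbd (hBc.aestronglyMeasurable measurableSet_Ioo) ?_
    refine (ae_restrict_iff' measurableSet_Ioo).2 (ae_of_all _ fun t ht => ?_)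
    have h1 := hc t (Ioo_subset_Icc_self ht)
    have h2 := h.r_pos t (hsub ht)
    obtain ⟨u, hu⟩ : ∃ u, s t = u * r t := ⟨s t / r t, by field_simp⟩
    have e1 : B t = -(u * r t * (k t - u) / (2 * c t)) := by
      simp only [B]; rw [hu]; field_simp
    have e2 : s t ^ 2 / r t = u ^ 2 * r t := by rw [hu]; field_simp
    rw [e1, e2, norm_neg, Real.norm_eq_abs, abs_div, abs_of_pos (by linarith : 0 < 2 * c t),
      div_le_iff₀ (by linarith)]
    have e3 : |u * r t * (k t - u)| ≤ (2 * (k t ^ 2 * r t) + 2 * (u ^ 2 * r t)) := by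
      rw [abs_le]
      constructor <;> nlinarith [mul_nonneg h2.le (sq_nonneg (k t - u)),
        mul_nonneg h2.le (sq_nonneg (k t + u)), mul_nonneg h2.le (sq_nonneg (k t)),
        mul_nonneg h2.le (sq_nonneg u)]
    refine e3.trans (le_mul_of_one_le_right ?_ (by linarith))
    positivity
  have hBI : IntegrableOn B (uIcc 0 a) := by
    rw [uIcc_of_le ha.1.le, integrableOn_Icc_iff_integrableOn_Ioo]; exact hB
  have prim : ∀ {g : ℝ → ℝ}, IntegrableOn g (uIcc 0 a) → ContinuousOn g (Ioo 0 a) →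
      ∀ t ∈ Ioo 0 a, HasDerivAt (fun y => ∫ x in (0 : ℝ)..y, g x) (g t) t := by
    intro g hg hgc t ht
    refine intervalIntegral.integral_hasDerivAt_right ?_
      (ContinuousOn.stronglyMeasurableAtFilter isOpen_Ioo hgc t ht)
      (hgc.continuousAt (Ioo_mem_nhds ht.1 ht.2))
    refine (intervalIntegrable_iff_integrableOn_Ioc_of_le ht.1.le).2 (hg.mono_set ?_)
    rw [uIcc_of_le ha.1.le]
    exact fun x hx => ⟨hx.1.le, hx.2.trans ht.2.le⟩
  let P : ℝ → ℝ := fun y => ∫ x in (0 : ℝ)..y, B x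
  have hP : ContinuousOn P (Icc 0 a) := by
    have := intervalIntegral.continuousOn_primitive_interval hBI
    rwa [uIcc_of_le ha.1.le] at this
  have hP' := prim hBI hBc
  -- `exp(-P)` is the integrating factor: `exp(-P) H` has derivative `D`, so it differs from the
  -- primitive of `D` by a constant.
  let D : ℝ → ℝ := fun t => Real.exp (-P t) * A t
  have hD : ContinuousOn D (Icc 0 a) := hP.neg.rexp.mul hA
  have hDI : IntegrableOn D (uIcc 0 a) := by
    rw [uIcc_of_le ha.1.le]; exact hD.integrableOn_Icc
  let S : ℝ → ℝ := fun y => ∫ x in (0 : ℝ)..y, D x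
  have hS : ContinuousOn S (Icc 0 a) := by
    have := intervalIntegral.continuousOn_primitive_interval hDI
    rwa [uIcc_of_le ha.1.le] at this
  have hS' := prim hDI (hD.mono Ioo_subset_Icc_self)
  have hR : ∀ t ∈ Ioo 0 a, HasDerivAt
      (fun y => Real.exp (-P y) * (k y + s y / r y) - S y) 0 t := fun t ht => by
    have h1 := h.hasDerivAt_mean (hsub ht) (hc0 t (Ioo_subset_Icc_self ht))
    refine ((((hP' t ht).neg.exp).mul h1).sub (hS' t ht)).congr_deriv ?_
    have h2 := hr0 t ht
    have h3 := hc0 t (Ioo_subset_Icc_self ht)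
    simp only [D, A, B, P, Pi.neg_apply]
    field_simp
    ring_nf
  obtain ⟨C, hC⟩ : ∃ C, ∀ t ∈ Ioo 0 a, Real.exp (-P t) * (k t + s t / r t) - S t = C :=
    isOpen_Ioo.exists_is_const_of_deriv_eq_zero isPreconnected_Ioo
      (fun t ht => (hR t ht).differentiableAt.differentiableWithinAt)
      (fun t ht => (hR t ht).deriv)
  refine ⟨fun t => Real.exp (P t) * (C + S t), hP.rexp.mul (continuousOn_const.add hS),
    fun t ht => ?_⟩
  simp only [← hC t ht]
  rw [sub_add_cancel, ← mul_assoc, ← Real.exp_add]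
  simp

end SmoothProfile

/-- The quotient of the distance to the axis by that of the round sphere, as a function of the
height above the south pole. -/
noncomputable def radialFactor (c : ℝ → ℝ) (w : ℝ) : ℝ :=
  2 / (Real.pi * √(2 - w)) *
    dilAverage (fun _ => 1) (fun ς => ς ^ 2) (fun v => c (tau v) / √(2 - v)) w

theorem sq_mem_Icc {ς : ℝ} (h : ς ∈ Icc (0 : ℝ) 1) : ς ^ 2 ∈ Icc (0 : ℝ) 1 :=
  ⟨sq_nonneg _, by nlinarith [h.1, h.2]⟩

namespace SmoothProfile
variable {r c s k : ℝ → ℝ} {lam mu : ℝ}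

/-- The fundamental theorem of calculus along `ς ↦ r (tau (ς² w))`. The substitution `ς²` cancels
the square root singularity of `tau'` at `0`. -/
theorem r_tau (h : SmoothProfile r c s k lam mu) {w : ℝ} (hw : w ∈ Ioo (0 : ℝ) 2) :
    r (tau w) = radialFactor c w * √(w * (2 - w)) := by
  have hcc := h.continuous_c
  have hpi := Real.pi_pos
  have hint : ContinuousOn (fun ς : ℝ => 1 * (c (tau (ς ^ 2 * w)) / √(2 - ς ^ 2 * w)))
      (Icc 0 1) := by
    have hτ := continuous_tau
    refine continuousOn_const.mul (ContinuousOn.div (Continuous.continuousOn (by fun_prop))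
      (Continuous.continuousOn (by fun_prop)) fun ς hς => ?_)
    have := (sq_mem_Icc hς).2
    exact (Real.sqrt_pos.2 (by nlinarith [hw.1, hw.2])).ne'
  have key := intervalIntegral.integral_eq_sub_of_hasDerivAt_of_le (zero_le_one' ℝ)
    (f := fun ς => r (tau (ς ^ 2 * w)))
    (f' := fun ς => 2 * √w / Real.pi * (1 * (c (tau (ς ^ 2 * w)) / √(2 - ς ^ 2 * w))))
    (by have := h.continuous_r; have := continuous_tau; fun_prop) (fun ς hς => ?_)
    ((continuousOn_const.mul hint).intervalIntegrable_of_Icc zero_le_one)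
  · rw [intervalIntegral.integral_const_mul] at key
    simp only [one_pow, one_mul, ne_eq, OfNat.ofNat_ne_zero, not_false_eq_true, zero_pow, zero_mul,
      tau_zero, h.r_zero, sub_zero] at key
    rw [← key, radialFactor, dilAverage, Real.sqrt_mul hw.1.le]
    have h2 : 0 < √(2 - w) := Real.sqrt_pos.2 (by linarith [hw.2])
    simp only [one_mul]
    generalize (∫ x in (0 : ℝ)..1, c (tau (x ^ 2 * w)) / √(2 - x ^ 2 * w)) = I
    field_simp
  · have h0 : 0 < ς ^ 2 * w := mul_pos (pow_pos hς.1 2) hw.1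
    have h2 : 0 < 2 - ς ^ 2 * w := by
      have := (sq_mem_Icc (Ioo_subset_Icc_self hς)).2
      nlinarith [hw.1, hw.2]
    have h3 := ((h.deriv_r (tau (ς ^ 2 * w))).comp (ς ^ 2 * w)
      (hasDerivAt_tau ⟨h0, by linarith⟩)).comp ς (((hasDerivAt_id ς).pow 2).mul_const w)
    refine h3.congr_deriv ?_
    rw [Real.sqrt_mul h0.le, Real.sqrt_mul (sq_nonneg ς), Real.sqrt_sq hς.1.le]
    have h4 := Real.sqrt_pos.2 h2
    have h5 := Real.sqrt_pos.2 hw.1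
    have h6 := hς.1
    simp only [id, Nat.cast_ofNat, one_mul, mul_one]
    field_simp
    rw [Real.sq_sqrt hw.1.le]
    ring


/-- The rotational curvature as an average of the mean curvature. -/
noncomputable def rotAverage (c G : ℝ → ℝ) (w : ℝ) : ℝ :=
  1 / (Real.pi * (2 - w) * radialFactor c w ^ 2) *
    dilAverage (fun _ => 1) (fun ς => ς) (fun v => radialFactor c v * c (tau v) * G (tau v)) w

theorem contDiffOn_radialFactor_of {δ : ℝ} (hδ : δ ≤ 2) {n : ℕ}
    (hc : ContDiffOn ℝ n (fun w => c (tau w)) (Ico 0 δ)) :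
    ContDiffOn ℝ n (radialFactor c) (Ico 0 δ) := by
  have h2 : ContDiffOn ℝ n (fun w : ℝ => √(2 - w)) (Ico 0 δ) :=
    ContDiffOn.sqrt (by fun_prop) fun w hw => by linarith [hw.2]
  have h3 : ∀ w ∈ Ico 0 δ, √(2 - w) ≠ 0 := fun w hw =>
    (Real.sqrt_pos.2 (by linarith [hw.2])).ne'
  exact (contDiffOn_const.div (contDiffOn_const.mul h2) fun w hw =>
    mul_ne_zero Real.pi_pos.ne' (h3 w hw)).mul
    (contDiffOn_dilAverage (by fun_prop) (fun _ => sq_mem_Icc) continuous_const (hc.div h2 h3))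

theorem radialFactor_pos {δ : ℝ} (hδ : δ ≤ 2) (hc : ContinuousOn (fun w => c (tau w)) (Ico 0 δ))
    (hpos : ∀ w ∈ Ico 0 δ, 0 < c (tau w)) {w : ℝ} (hw : w ∈ Ico 0 δ) : 0 < radialFactor c w := by
  have h2 : 0 < √(2 - w) := Real.sqrt_pos.2 (by linarith [hw.2])
  refine mul_pos (div_pos two_pos (mul_pos Real.pi_pos h2)) ?_
  have hm : ∀ ς ∈ Icc (0 : ℝ) 1, ς ^ 2 * w ∈ Ico 0 δ := fun ς hς =>
    ⟨mul_nonneg (sq_nonneg _) hw.1,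
      (mul_le_of_le_one_left hw.1 (sq_mem_Icc hς).2).trans_lt hw.2⟩
  have h3 : ∀ v ∈ Ico 0 δ, 0 < √(2 - v) := fun v hv =>
    Real.sqrt_pos.2 (by linarith [hv.2])
  refine intervalIntegral.intervalIntegral_pos_of_pos_on ?_ (fun ς hς => ?_) one_pos
  · refine ContinuousOn.intervalIntegrable_of_Icc zero_le_one (continuousOn_const.mul ?_)
    refine ContinuousOn.comp (t := Ico 0 δ) (g := fun v => c (tau v) / √(2 - v))
      (hc.div (by fun_prop) fun v hv => (h3 v hv).ne') (by fun_prop) hm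
  · have := hm ς (Ioo_subset_Icc_self hς)
    exact mul_pos one_pos (div_pos (hpos _ this) (h3 _ this))

/-- `(r s)' = r c H`. In the variable `w` the factor `√(w(2-w))` of `r` cancels the singularity of
`tau'`, so `r s` is `w/π` times an average; dividing by `r²` gives `s/r`. -/
theorem rotAverage_eq (h : SmoothProfile r c s k lam mu) {δ : ℝ} (hδ : δ ≤ 2) {G : ℝ → ℝ}
    (hb : ContinuousOn (radialFactor c) (Ico 0 δ)) (hG : ContinuousOn (fun w => G (tau w)) (Ico 0 δ))
    (hGe : ∀ w ∈ Ioo 0 δ, k (tau w) + s (tau w) / r (tau w) = G (tau w)) {w : ℝ}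
    (hw : w ∈ Ioo 0 δ) : rotAverage c G w = s (tau w) / r (tau w) := by
  have hcc := h.continuous_c
  have hsc := h.continuous_s
  have hrc := h.continuous_r
  have hpi := Real.pi_pos
  have hτ := continuous_tau
  have hm : ∀ ς ∈ Icc (0 : ℝ) 1, ς * w ∈ Ico 0 δ := fun ς hς =>
    ⟨mul_nonneg hς.1 hw.1.le, (mul_le_of_le_one_left hw.1.le hς.2).trans_lt hw.2⟩
  have hint : ContinuousOn (fun ς : ℝ => 1 * (radialFactor c (ς * w) * c (tau (ς * w))
      * G (tau (ς * w)))) (Icc 0 1) := by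
    refine continuousOn_const.mul ?_
    exact ContinuousOn.comp (t := Ico 0 δ)
      (g := fun v => radialFactor c v * c (tau v) * G (tau v))
      ((hb.mul (Continuous.continuousOn (by fun_prop))).mul hG) (by fun_prop) hm
  have key := intervalIntegral.integral_eq_sub_of_hasDerivAt_of_le (zero_le_one' ℝ)
    (f := fun ς => r (tau (ς * w)) * s (tau (ς * w)))
    (f' := fun ς => w / Real.pi * (1 * (radialFactor c (ς * w) * c (tau (ς * w))
      * G (tau (ς * w)))))
    (by fun_prop) (fun ς hς => ?_)
    ((continuousOn_const.mul hint).intervalIntegrable_of_Icc zero_le_one)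
  · have hw2 : w ∈ Ioo (0 : ℝ) 2 := ⟨hw.1, hw.2.trans_le hδ⟩
    have h5 : 0 < 2 - w := by linarith [hw2.2]
    have hrw := h.r_tau hw2
    have hrp := h.r_pos _ (tau_mem hw2)
    have h6 : r (tau w) ^ 2 = radialFactor c w ^ 2 * (w * (2 - w)) := by
      rw [hrw, mul_pow, Real.sq_sqrt (mul_two_sub_pos hw2).le]
    have hbne : radialFactor c w ≠ 0 := fun h0 => by
      rw [hrw, h0, zero_mul] at hrp; exact lt_irrefl _ hrp
    rw [intervalIntegral.integral_const_mul] at key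
    simp only [one_mul, zero_mul, tau_zero, h.r_zero, sub_zero] at key
    rw [rotAverage, dilAverage, eq_div_iff hrp.ne']
    simp only [one_mul]
    generalize (∫ x in (0 : ℝ)..1, radialFactor c (x * w) * c (tau (x * w)) * G (tau (x * w)))
      = I at key ⊢
    apply mul_left_cancel₀ hrp.ne'
    rw [← key]
    have h7 := hw.1
    field_simp
    linear_combination I * h6
  · have h0 : ς * w ∈ Ioo 0 δ := ⟨mul_pos hς.1 hw.1, (hm ς (Ioo_subset_Icc_self hς)).2⟩
    have h1 : ς * w ∈ Ioo (0 : ℝ) 2 := ⟨h0.1, h0.2.trans_le hδ⟩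
    have ht := tau_mem h1
    have hrp := h.r_pos _ ht
    have h3 := (((h.deriv_r _).mul (h.deriv_s _ ht)).comp (ς * w)
      (hasDerivAt_tau h1)).comp ς ((hasDerivAt_id ς).mul_const w)
    refine h3.congr_deriv ?_
    have h4 := Real.sqrt_pos.2 (mul_two_sub_pos h1)
    rw [← hGe _ h0]
    have h5 : radialFactor c (ς * w) = r (tau (ς * w)) / √(ς * w * (2 - ς * w)) := by
      rw [h.r_tau h1]; field_simp
    rw [h5]
    field_simp
    ring

/-- Smoothness at the pole. -/
theorem exists_contDiffOn_pole (h : SmoothProfile r c s k lam mu) : ∃ δ, 0 < δ ∧ δ ≤ 2 ∧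
    (∀ w ∈ Ico 0 δ, 0 < radialFactor c w) ∧ ContDiffOn ℝ ∞ (radialFactor c) (Ico 0 δ) ∧
    ContDiffOn ℝ ∞ (fun w => ∫ x in (0 : ℝ)..tau w, s x) (Ico 0 δ) := by
  obtain ⟨a, ha, hca⟩ := h.exists_half_lt_c
  obtain ⟨G, hG, hGe⟩ := h.exists_mean_extension ha hca
  have hcc := h.continuous_c
  have hsc := h.continuous_s
  have hτc := continuous_tau
  have hpi := Real.pi_pos
  obtain ⟨δ, hδ, hδ2, hτ⟩ : ∃ δ, 0 < δ ∧ δ ≤ 2 ∧ ∀ w ∈ Ico 0 δ, tau w < a := by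
    have h3 : ∀ᶠ w in 𝓝 (0 : ℝ), tau w < a :=
      continuous_tau.continuousAt.eventually (gt_mem_nhds (by rw [tau_zero]; exact ha.1))
    obtain ⟨ε, hε, h4⟩ := Metric.eventually_nhds_iff.1 h3
    refine ⟨min ε 2, lt_min hε two_pos, min_le_right _ _, fun w hw => h4 ?_⟩
    rw [dist_zero_right, Real.norm_of_nonneg hw.1]
    exact hw.2.trans_le (min_le_left _ _)
  have hI2 : Ioo 0 δ ⊆ Ioo (0 : ℝ) 2 := Ioo_subset_Ioo_right hδ2
  have hτm : ∀ w ∈ Ico 0 δ, tau w ∈ Icc 0 a := fun w hw =>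
    ⟨div_nonneg (Real.arccos_nonneg _) hpi.le, (hτ w hw).le⟩
  have hτo : ∀ w ∈ Ioo 0 δ, tau w ∈ Ioo 0 a := fun w hw =>
    ⟨(tau_mem (hI2 hw)).1, hτ w (Ioo_subset_Ico_self hw)⟩
  have hĉ : ContinuousOn (fun w => c (tau w)) (Ico 0 δ) := Continuous.continuousOn (by fun_prop)
  have hĉp : ∀ w ∈ Ico 0 δ, 0 < c (tau w) := fun w hw => by linarith [hca _ (hτm w hw)]
  have hbp : ∀ w ∈ Ico 0 δ, 0 < radialFactor c w := fun w hw => radialFactor_pos hδ2 hĉ hĉp hw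
  have hĜ : ContinuousOn (fun w => G (tau w)) (Ico 0 δ) := hG.comp hτc.continuousOn hτm
  have hĜe : ∀ w ∈ Ioo 0 δ, k (tau w) + s (tau w) / r (tau w) = G (tau w) := fun w hw =>
    hGe _ (hτo w hw)
  have hb0 : ContinuousOn (radialFactor c) (Ico 0 δ) :=
    contDiffOn_zero.1 (contDiffOn_radialFactor_of (n := 0) hδ2 (by simpa using hĉ))
  have hu : ∀ w ∈ Ioo 0 δ, rotAverage c G w = s (tau w) / r (tau w) := fun w hw =>
    h.rotAverage_eq hδ2 hb0 hĜ hĜe hw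
  -- The meridian curvature is recovered as mean minus rotational curvature, so the system below
  -- involves only functions continuous up to the pole.
  have hk : ∀ w ∈ Ioo 0 δ, k (tau w) = G (tau w) - rotAverage c G w := fun w hw => by
    rw [hu w hw, ← hĜe w hw]; ring
  have hr : ∀ w ∈ Ioo 0 δ, r (tau w) = radialFactor c w * √(w * (2 - w)) := fun w hw =>
    h.r_tau (hI2 hw)
  have hs : ∀ w ∈ Ioo 0 δ, s (tau w)
      = rotAverage c G w * (radialFactor c w * √(w * (2 - w))) := fun w hw => by
    rw [← hr w hw, hu w hw, div_mul_cancel₀ _ (h.r_pos _ (tau_mem (hI2 hw))).ne']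
  have hdτ : ∀ w ∈ Ioo 0 δ, HasDerivAt tau (1 / (Real.pi * √(w * (2 - w)))) w := fun w hw =>
    hasDerivAt_tau (hI2 hw)
  have hsq : ∀ w ∈ Ioo 0 δ, 0 < √(w * (2 - w)) := fun w hw =>
    Real.sqrt_pos.2 (mul_two_sub_pos (hI2 hw))
  have hdz : ∀ w ∈ Ioo 0 δ, HasDerivAt (fun w => ∫ x in (0 : ℝ)..tau w, s x)
      (radialFactor c w * rotAverage c G w / Real.pi) w := fun w hw => by
    refine (((hsc.integral_hasStrictDerivAt 0 _).hasDerivAt).comp w (hdτ w hw)).congr_deriv ?_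
    have := hsq w hw
    rw [hs w hw]; field_simp
  have hdc : ∀ w ∈ Ioo 0 δ, HasDerivAt (fun w => c (tau w)) (-(radialFactor c w
      * rotAverage c G w * (G (tau w) - rotAverage c G w) / Real.pi)) w := fun w hw => by
    refine ((h.deriv_c _ (tau_mem (hI2 hw))).comp w (hdτ w hw)).congr_deriv ?_
    have := hsq w hw
    rw [hs w hw, hk w hw]; field_simp
  have hdG : ∀ w ∈ Ioo 0 δ, HasDerivAt (fun w => G (tau w)) (radialFactor c w *
      (lam * c (tau w) + rotAverage c G w * (rotAverage c G w ^ 2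
        - (G (tau w) - rotAverage c G w) ^ 2 + mu
        + lam * (w * (2 - w) * radialFactor c w ^ 2 * rotAverage c G w)) / c (tau w))
        / (2 * Real.pi)) w := fun w hw => by
    have h0 := hĉp w (Ioo_subset_Ico_self hw)
    have h1 := h.hasDerivAt_mean (tau_mem (hI2 hw)) h0.ne'
    refine ((h1.comp w (hdτ w hw)).congr_of_eventuallyEq ?_).congr_deriv ?_
    · filter_upwards [Ioo_mem_nhds hw.1 hw.2] with v hv using (hĜe v hv).symm
    · have h2 := hsq w hw
      have h3 : √(w * (2 - w)) ^ 2 = w * (2 - w) := Real.sq_sqrt (mul_two_sub_pos (hI2 hw)).le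
      rw [← hu w hw, hs w hw, hk w hw, hr w hw]
      field_simp
      rw [h3]
      ring
  -- The averages `radialFactor` and `rotAverage` are as regular as `c` and `G`, whose derivatives
  -- are rational in all four functions and `w`. The square roots have cancelled, so each round
  -- gains one derivative up to `w = 0`.
  have hn : ∀ n : ℕ, ContDiffOn ℝ n (radialFactor c) (Ico 0 δ) ∧
      ContDiffOn ℝ n (fun w => c (tau w)) (Ico 0 δ) ∧
      ContDiffOn ℝ n (fun w => G (tau w)) (Ico 0 δ) ∧
      ContDiffOn ℝ n (rotAverage c G) (Ico 0 δ) := by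
    have step : ∀ n : ℕ, ContDiffOn ℝ n (fun w => c (tau w)) (Ico 0 δ) →
        ContDiffOn ℝ n (fun w => G (tau w)) (Ico 0 δ) → ContDiffOn ℝ n (radialFactor c) (Ico 0 δ) ∧
        ContDiffOn ℝ n (rotAverage c G) (Ico 0 δ) := fun n ic iG => by
      have ib := contDiffOn_radialFactor_of hδ2 ic
      refine ⟨ib, (contDiffOn_const.div ((contDiffOn_const.mul
        (contDiffOn_const.sub contDiffOn_id)).mul (ib.pow 2)) fun w hw => ?_).mul
        (contDiffOn_dilAverage continuous_id (fun _ h => h) continuous_const ((ib.mul ic).mul iG))⟩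
      have h1 := hbp w hw
      have h2 : 0 < 2 - w := by linarith [hw.2]
      exact (mul_pos (mul_pos hpi h2) (pow_pos h1 2)).ne'
    intro n
    have main : ContDiffOn ℝ n (fun w => c (tau w)) (Ico 0 δ) ∧
        ContDiffOn ℝ n (fun w => G (tau w)) (Ico 0 δ) := by
      induction n with
      | zero =>
        simp only [Nat.cast_zero, contDiffOn_zero]
        exact ⟨hĉ, hĜ⟩
      | succ n ih =>
        obtain ⟨ic, iG⟩ := ih
        obtain ⟨ib, iu⟩ := step n ic iG
        refine ⟨contDiffOn_succ_Ico hĉ hdc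
          (((ib.mul iu).mul (iG.sub iu)).div_const _).neg, contDiffOn_succ_Ico hĜ hdG ?_⟩
        have iw : ContDiffOn ℝ n (fun w : ℝ => w * (2 - w)) (Ico 0 δ) := by fun_prop
        exact (ib.mul ((contDiffOn_const.mul ic).add ((iu.mul ((((iu.pow 2).sub
          ((iG.sub iu).pow 2)).add contDiffOn_const).add (contDiffOn_const.mul
          ((iw.mul (ib.pow 2)).mul iu)))).div ic fun w hw => (hĉp w hw).ne'))).div_const _
    obtain ⟨ib, iu⟩ := step n main.1 main.2
    exact ⟨ib, main.1, main.2, iu⟩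
  refine ⟨δ, hδ, hδ2, hbp, contDiffOn_infty.2 fun n => (hn n).1, contDiffOn_infty.2 fun n => ?_⟩
  have hz : ContinuousOn (fun w => ∫ x in (0 : ℝ)..tau w, s x) (Ico 0 δ) :=
    ((continuous_iff_continuousAt.2 fun t =>
      (hsc.integral_hasStrictDerivAt 0 t).hasDerivAt.continuousAt).comp hτc).continuousOn
  exact (contDiffOn_succ_Ico hz hdz (((hn n).1.mul (hn n).2.2.2).div_const _)).of_le
    (by exact_mod_cast n.le_succ)

theorem contDiffOn_of_local {f : ℝ → ℝ} {δ : ℝ} (hδ : 0 < δ) (h0 : ContDiffOn ℝ ∞ f (Ico 0 δ))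
    (h1 : ContDiffOn ℝ ∞ f (Ioo 0 2)) : ContDiffOn ℝ ∞ f (Ico 0 2) := by
  intro w hw
  rcases hw.1.eq_or_lt with h | h
  · subst h
    refine (h0 0 ⟨le_rfl, hδ⟩).mono_of_mem_nhdsWithin ?_
    filter_upwards [self_mem_nhdsWithin, mem_nhdsWithin_of_mem_nhds (Iio_mem_nhds hδ)] with x hx hx'
    exact ⟨hx.1, hx'⟩
  · exact (h1.contDiffAt (Ioo_mem_nhds h hw.2)).contDiffWithinAt

theorem radialFactor_eq (h : SmoothProfile r c s k lam mu) {w : ℝ} (hw : w ∈ Ioo (0 : ℝ) 2) :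
    radialFactor c w = r (tau w) / √(w * (2 - w)) := by
  have := Real.sqrt_pos.2 (mul_two_sub_pos hw)
  rw [h.r_tau hw]; field_simp

/-- The profile in terms of the height on the round sphere: smooth up to the south pole, with the
nondegeneracy needed for an immersion. -/
theorem radialFactor_spec (h : SmoothProfile r c s k lam mu) :
    ContDiffOn ℝ ∞ (radialFactor c) (Ico 0 2) ∧
    ContDiffOn ℝ ∞ (fun w => ∫ x in (0 : ℝ)..tau w, s x) (Ico 0 2) ∧
    (∀ w ∈ Ico (0 : ℝ) 2, 0 < radialFactor c w) ∧
    ∀ w ∈ Ioo (0 : ℝ) 2, ∀ b' z', HasDerivAt (radialFactor c) b' w →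
      HasDerivAt (fun w => ∫ x in (0 : ℝ)..tau w, s x) z' w →
      w * (2 - w) * b' + (1 - w) * radialFactor c w = 0 → z' ≠ 0 := by
  obtain ⟨δ, hδ, hδ2, hbp, hb, hz⟩ := h.exists_contDiffOn_pole
  have hsc := h.continuous_s
  have hsq : ∀ w ∈ Ioo (0 : ℝ) 2, 0 < √(w * (2 - w)) := fun w hw =>
    Real.sqrt_pos.2 (mul_two_sub_pos hw)
  have hpi := Real.pi_pos
  refine ⟨contDiffOn_of_local hδ hb ?_, contDiffOn_of_local hδ hz ?_, fun w hw => ?_,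
    fun w hw b' z' hb' hz' h1 => ?_⟩
  · refine ContDiffOn.congr ?_ fun w hw => h.radialFactor_eq hw
    refine (h.contDiffOn.1.comp contDiffOn_tau fun w hw => tau_mem hw).div ?_
      fun w hw => (hsq w hw).ne'
    exact ContDiffOn.sqrt (by fun_prop) fun w hw => (mul_two_sub_pos hw).ne'
  · have h2 : ContDiffOn ℝ ∞ (fun t => ∫ x in (0 : ℝ)..t, s x) (Ioo 0 1) := by
      refine contDiffOn_infty.2 fun n => ?_
      exact (contDiffOn_succ_of_hasDerivAt isOpen_Ioo
        (fun t _ => (hsc.integral_hasStrictDerivAt 0 t).hasDerivAt)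
        (contDiffOn_infty.1 h.contDiffOn.2 n)).of_le (by exact_mod_cast n.le_succ)
    exact h2.comp contDiffOn_tau fun w hw => tau_mem hw
  · rcases hw.1.eq_or_lt with h0 | h0
    · exact hbp w ⟨hw.1, h0 ▸ hδ⟩
    · rw [h.radialFactor_eq ⟨h0, hw.2⟩]
      exact div_pos (h.r_pos _ (tau_mem ⟨h0, hw.2⟩)) (hsq w ⟨h0, hw.2⟩)
  -- The hypothesis says that `r ∘ tau` is stationary, so `c = 0`; a stationary axis coordinate
  -- would give `s = 0` as well, contradicting the unit tangent.
  · rintro rfl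
    have hτ := hasDerivAt_tau hw
    have q := hsq w hw
    have q2 : √(w * (2 - w)) ^ 2 = w * (2 - w) := Real.sq_sqrt (mul_two_sub_pos hw).le
    have d1 : HasDerivAt (fun w => √(w * (2 - w))) ((2 - w - w) / (2 * √(w * (2 - w)))) w := by
      have : HasDerivAt (fun w : ℝ => w * (2 - w)) (2 - w - w) w :=
        ((hasDerivAt_id w).mul ((hasDerivAt_id w).const_sub 2)).congr_deriv (by simp only [id]; ring)
      exact this.sqrt (mul_two_sub_pos hw).ne'
    have d2 : HasDerivAt (fun w => r (tau w)) (b' * √(w * (2 - w)) + radialFactor c w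
        * ((2 - w - w) / (2 * √(w * (2 - w))))) w := by
      refine (hb'.mul d1).congr_of_eventuallyEq ?_
      filter_upwards [Ioo_mem_nhds hw.1 hw.2] with v hv using h.r_tau hv
    have e1 := d2.unique ((h.deriv_r (tau w)).comp w hτ)
    have e2 := hz'.unique (((hsc.integral_hasStrictDerivAt 0 (tau w)).hasDerivAt).comp w hτ)
    have e3 : c (tau w) = 0 := by
      have : c (tau w) = Real.pi * (w * (2 - w) * b' + (1 - w) * radialFactor c w) := by
        rw [← q2]
        field_simp at e1
        linear_combination -e1 / 2
      rw [this, h1, mul_zero]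
    have e4 : s (tau w) = 0 := by
      have h3 : 1 / (Real.pi * √(w * (2 - w))) ≠ 0 := by positivity
      exact (mul_eq_zero.1 e2.symm).resolve_right h3
    have := h.unit (tau w)
    rw [e3, e4] at this
    norm_num at this

end SmoothProfile
-- From pole data to a smooth immersion of the sphere.
/-- Smooth data for a surface of revolution near a pole, with `w` the height above the pole of the
round sphere: `b` is the radial factor and `z` the position on the axis. -/
structure CapData (b z : ℝ → ℝ) : Prop where
  contDiffOn_b : ContDiffOn ℝ ∞ b (Ico 0 2)
  contDiffOn_z : ContDiffOn ℝ ∞ z (Ico 0 2)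
  pos : ∀ w ∈ Ico (0 : ℝ) 2, 0 < b w
  -- The expression set to zero is `√(w(2-w))` times the derivative of the radius `b √(w(2-w))`:
  -- radius and axis position are never stationary together.
  nondeg : ∀ w ∈ Ioo (0 : ℝ) 2, ∀ b' z', HasDerivAt b b' w → HasDerivAt z z' w →
    w * (2 - w) * b' + (1 - w) * b w = 0 → z' ≠ 0

theorem CapData.affine {b z : ℝ → ℝ} (h : CapData b z) {L M : ℝ} (hL : 0 < L) (hM : M ≠ 0)
    (z₀ : ℝ) : CapData (fun w => L * b w) (fun w => z₀ + M * z w) where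
  contDiffOn_b := contDiffOn_const.mul h.contDiffOn_b
  contDiffOn_z := contDiffOn_const.add (contDiffOn_const.mul h.contDiffOn_z)
  pos w hw := mul_pos hL (h.pos w hw)
  nondeg w hw b' z' hb hz h0 := by
    have h1 := hb.const_mul L⁻¹
    have h2 := (hz.sub_const z₀).const_mul M⁻¹
    simp only [add_sub_cancel_left, inv_mul_cancel_left₀ hM] at h2
    simp only [inv_mul_cancel_left₀ hL.ne'] at h1
    have h3 := h.nondeg w hw _ _ h1 h2 (by field_simp; linear_combination h0)
    exact fun h4 => h3 (by rw [h4, mul_zero])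

/-- Half the squared distance to the pole `(0, 0, -ε)`. -/
noncomputable def capHeight (ε : ℝ) (p : E3) : ℝ := (p 0 ^ 2 + p 1 ^ 2 + (p 2 + ε) ^ 2) / 2

/-- The surface of revolution generated by `CapData`, as a map of the ambient space. -/
noncomputable def capMap (ε : ℝ) (b z : ℝ → ℝ) (p : E3) : E3 :=
  !₂[p 0 * b (capHeight ε p), p 1 * b (capHeight ε p), z (capHeight ε p)]

/-- The coordinate functionals of Euclidean space. -/
noncomputable def coordL (i : Fin 3) : E3 →L[ℝ] ℝ := EuclideanSpace.proj i

theorem coordL_apply (i : Fin 3) (p : E3) : coordL i p = p i := rfl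

theorem contDiff_coord (i : Fin 3) : ContDiff ℝ ∞ fun p : E3 => p i :=
  (coordL i).contDiff

theorem hasFDerivAt_coord (i : Fin 3) (p : E3) :
    HasFDerivAt (fun p : E3 => p i) (coordL i) p :=
  (coordL i).hasFDerivAt

theorem contDiff_capHeight (ε : ℝ) : ContDiff ℝ ∞ (capHeight ε) :=
  ((((contDiff_coord 0).pow 2).add ((contDiff_coord 1).pow 2)).add
    (((contDiff_coord 2).add contDiff_const).pow 2)).div_const 2

theorem capHeight_nonneg (ε : ℝ) (p : E3) : 0 ≤ capHeight ε p := by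
  unfold capHeight; positivity

theorem isOpen_capHeight_lt (ε : ℝ) : IsOpen {p | capHeight ε p < 2} :=
  isOpen_lt (contDiff_capHeight ε).continuous continuous_const

theorem sum_sq_eq_one {p : E3} (hp : p ∈ Metric.sphere (0 : E3) 1) :
    p 0 ^ 2 + p 1 ^ 2 + p 2 ^ 2 = 1 := by
  rw [mem_sphere_zero_iff_norm, EuclideanSpace.norm_eq, Real.sqrt_eq_one] at hp
  simpa [Fin.sum_univ_three] using hp

/-- The squared distance is preferred to the affine function `1 + ε p₂`, equal to it on the sphere,
because it is nonnegative on all of space. Functions smooth only on `[0,2)` can then be composed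
with it on an open set containing the pole. -/
theorem capHeight_of_mem_sphere {ε : ℝ} (hε : ε ^ 2 = 1) {p : E3}
    (hp : p ∈ Metric.sphere (0 : E3) 1) : capHeight ε p = 1 + ε * p 2 := by
  have := sum_sq_eq_one hp
  unfold capHeight
  linear_combination this / 2 + hε / 2

theorem CapData.contDiffOn_capMap {b z : ℝ → ℝ} (h : CapData b z) (ε : ℝ) :
    ContDiffOn ℝ ∞ (capMap ε b z) {p | capHeight ε p < 2} := by
  have hm : MapsTo (capHeight ε) {p | capHeight ε p < 2} (Ico 0 2) := fun p hp =>
    ⟨capHeight_nonneg ε p, hp⟩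
  have hb := h.contDiffOn_b.comp (contDiff_capHeight ε).contDiffOn hm
  have hz := h.contDiffOn_z.comp (contDiff_capHeight ε).contDiffOn hm
  rw [contDiffOn_euclidean]
  intro i
  fin_cases i
  · exact (contDiff_coord 0).contDiffOn.mul hb
  · exact (contDiff_coord 1).contDiffOn.mul hb
  · exact hz

/-- For tangent `v` the height varies by `ε v₂`. If `v₂ = 0`, positivity of `b` kills the other
components. At the pole tangency itself gives `v₂ = 0`; elsewhere `v₂ ≠ 0` would make radius and
axis position stationary together. -/
theorem CapData.fderiv_capMap_injOn {b z : ℝ → ℝ} (h : CapData b z) {ε : ℝ} (hε : ε ^ 2 = 1)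
    {p : E3} (hp : p ∈ Metric.sphere (0 : E3) 1) (hp2 : capHeight ε p < 2) {v : E3}
    (hv : p 0 * v 0 + p 1 * v 1 + p 2 * v 2 = 0) (h0 : fderiv ℝ (capMap ε b z) p v = 0) :
    v = 0 := by
  have hw : capHeight ε p ∈ Ico (0 : ℝ) 2 := ⟨capHeight_nonneg ε p, hp2⟩
  have hsum := sum_sq_eq_one hp
  have hwe := capHeight_of_mem_sphere hε hp
  set w := capHeight ε p with hwdef
  have hmem : ∀ᶠ q in 𝓝 p, capHeight ε q ∈ Ico (0 : ℝ) 2 := by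
    filter_upwards [(isOpen_capHeight_lt ε).mem_nhds hp2] with q hq
    exact ⟨capHeight_nonneg ε q, hq⟩
  have hdh : HasFDerivAt (capHeight ε) (p 0 • coordL 0
      + p 1 • coordL 1
      + (p 2 + ε) • coordL 2) p := by
    have := ((((hasFDerivAt_coord 0 p).pow 2).add ((hasFDerivAt_coord 1 p).pow 2)).add
      (((hasFDerivAt_coord 2 p).add_const ε).pow 2)).mul_const (1 / 2 : ℝ)
    refine (this.congr_of_eventuallyEq (Eventually.of_forall fun q => ?_)).congr_fderiv ?_
    · simp only [capHeight, Pi.add_apply]; ring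
    · ext u
      simp [coordL_apply]
      ring
  have hb := ((h.contDiffOn_b.differentiableOn (by simp)) w hw).hasDerivWithinAt
  have hz := ((h.contDiffOn_z.differentiableOn (by simp)) w hw).hasDerivWithinAt
  set b' := derivWithin b (Ico 0 2) w
  set z' := derivWithin z (Ico 0 2) w
  have hB := hb.comp_hasFDerivAt p hdh hmem
  have hZ := hz.comp_hasFDerivAt p hdh hmem
  have hG : HasFDerivAt (capMap ε b z) (fderiv ℝ (capMap ε b z) p) p :=
    (((h.contDiffOn_capMap ε).contDiffAt ((isOpen_capHeight_lt ε).mem_nhds hp2)).differentiableAt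
      (by simp)).hasFDerivAt
  have hGi : ∀ i, HasFDerivAt (fun q => capMap ε b z q i)
      ((coordL i).comp
        (fderiv ℝ (capMap ε b z) p)) p := fun i => (hasFDerivAt_coord i _).comp p hG
  have e0 := congrArg (fun T => T v) ((hGi 0).unique ((hasFDerivAt_coord 0 p).mul hB))
  have e1 := congrArg (fun T => T v) ((hGi 1).unique ((hasFDerivAt_coord 1 p).mul hB))
  have e2 := congrArg (fun T => T v) ((hGi 2).unique hZ)
  simp [coordL_apply, h0, ← hwdef] at e0 e1 e2
  have hdv : p 0 * v 0 + p 1 * v 1 + (p 2 + ε) * v 2 = ε * v 2 := by linear_combination hv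
  replace e0 : p 0 * (b' * (ε * v 2)) + b w * v 0 = 0 := by
    linear_combination -e0 - p 0 * b' * hdv
  replace e1 : p 1 * (b' * (ε * v 2)) + b w * v 1 = 0 := by
    linear_combination -e1 - p 1 * b' * hdv
  replace e2 : z' * (ε * v 2) = 0 := by linear_combination -e2 - z' * hdv
  have hε0 : ε ≠ 0 := fun h => by rw [h] at hε; norm_num at hε
  have hbp := h.pos w hw
  have hv2 : v 2 = 0 := by
    by_contra hne
    rcases hw.1.eq_or_lt with hw0 | hw0
    · rw [← hw0] at hwe
      have h2 : p 2 = -ε := by linear_combination (-ε) * hwe - p 2 * hε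
      have h3 : p 0 ^ 2 + p 1 ^ 2 = 0 := by
        rw [h2] at hsum; linear_combination hsum - hε
      have h4 : p 0 = 0 := by nlinarith [sq_nonneg (p 0), sq_nonneg (p 1)]
      have h5 : p 1 = 0 := by nlinarith [sq_nonneg (p 0), sq_nonneg (p 1)]
      rw [h2, h4, h5] at hv
      have : ε * v 2 = 0 := by linear_combination -hv
      exact hne ((mul_eq_zero.1 this).resolve_left hε0)
    · have hz0 : z' = 0 := by
        rcases mul_eq_zero.1 e2 with h5 | h5
        · exact h5
        · exact absurd h5 (by simp [hε0, hne])
      refine h.nondeg w ⟨hw0, hp2⟩ b' z' (hb.hasDerivAt (Ico_mem_nhds hw0 hp2))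
        (hz.hasDerivAt (Ico_mem_nhds hw0 hp2)) ?_ hz0
      -- The radial part `p₀ e₀ + p₁ e₁` is `ε v₂` times the nondegeneracy expression, using `p₀² +
      -- p₁² = w(2-w)` and tangency of `v`.
      apply mul_left_cancel₀ (mul_ne_zero hε0 hne)
      rw [hwe] at e0 e1 ⊢
      linear_combination p 0 * e0 + p 1 * e1 - b (1 + ε * p 2) * (hv + p 2 * v 2 * hε)
        - ε * v 2 * b' * (hsum + p 2 ^ 2 * hε)
  rw [hv2] at e0 e1
  ext i
  fin_cases i
  · simpa [hbp.ne'] using e0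
  · simpa [hbp.ne'] using e1
  · exact hv2

/-- Reversing the parameter and reflecting the height changes the tangent to `(-c, s)` and keeps the
curvature and both multipliers, so one analysis serves both poles. -/
theorem SmoothProfile.reverse {r c s k : ℝ → ℝ} {lam mu : ℝ} (h : SmoothProfile r c s k lam mu) :
    SmoothProfile (fun t => r (1 - t)) (fun t => -c (1 - t)) (fun t => s (1 - t))
      (fun t => k (1 - t)) lam mu where
  continuous_c := (h.continuous_c.comp (by fun_prop)).neg
  continuous_s := h.continuous_s.comp (by fun_prop)
  unit t := by simpa using h.unit (1 - t)
  deriv_r t := ((h.deriv_r (1 - t)).comp t ((hasDerivAt_id t).const_sub 1)).congr_deriv (by ring)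
  r_zero := by simpa using h.r_one
  r_one := by simpa using h.r_zero
  r_pos t ht := h.r_pos _ ⟨by linarith [ht.2], by linarith [ht.1]⟩
  deriv_c t ht := by
    have := (((h.deriv_c (1 - t) ⟨by linarith [ht.2], by linarith [ht.1]⟩).comp t
      ((hasDerivAt_id t).const_sub 1))).neg
    exact this.congr_deriv (by ring)
  deriv_s t ht := by
    have := ((h.deriv_s (1 - t) ⟨by linarith [ht.2], by linarith [ht.1]⟩).comp t
      ((hasDerivAt_id t).const_sub 1))
    exact this.congr_deriv (by ring)
  contDiffOn_k := h.contDiffOn_k.comp (by fun_prop)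
    fun t ht => ⟨by linarith [ht.2], by linarith [ht.1]⟩
  integrable_curv := integrableOn_reflect h.integrable_curv
  integrable_rot := integrableOn_reflect h.integrable_rot
  euler t ht := by
    have h1 := h.euler (1 - t) ⟨by linarith [ht.2], by linarith [ht.1]⟩
    have h2 : deriv (fun y => k (1 - y) + s (1 - y) / r (1 - y)) t
        = -deriv (fun y => k y + s y / r y) (1 - t) :=
      deriv_comp_const_sub (fun y => k y + s y / r y) 1 t
    rw [h2]
    linear_combination h1

theorem SmoothProfile.capData {r c s k : ℝ → ℝ} {lam mu : ℝ} (h : SmoothProfile r c s k lam mu) :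
    CapData (radialFactor c) (fun w => ∫ x in (0 : ℝ)..tau w, s x) :=
  ⟨h.radialFactor_spec.1, h.radialFactor_spec.2.1, h.radialFactor_spec.2.2.1,
    h.radialFactor_spec.2.2.2⟩

theorem SmoothProfile.radialFactor_mul_sin {r c s k : ℝ → ℝ} {lam mu : ℝ}
    (h : SmoothProfile r c s k lam mu) {t : ℝ} (ht : t ∈ Ico (0 : ℝ) 1) :
    radialFactor c (1 - Real.cos (Real.pi * t)) * Real.sin (Real.pi * t) = r t := by
  have hpi := Real.pi_pos
  rcases ht.1.eq_or_lt with h0 | h0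
  · subst h0; simp [h.r_zero]
  · have hs : 0 < Real.sin (Real.pi * t) :=
      Real.sin_pos_of_pos_of_lt_pi (by positivity) (by nlinarith [ht.2])
    have h1 : Real.sin (Real.pi * t) ^ 2 + Real.cos (Real.pi * t) ^ 2 = 1 :=
      Real.sin_sq_add_cos_sq _
    have hw : 1 - Real.cos (Real.pi * t) ∈ Ioo (0 : ℝ) 2 := by
      constructor <;> nlinarith [Real.cos_le_one (Real.pi * t), Real.neg_one_le_cos (Real.pi * t)]
    have h2 := h.r_tau hw
    rw [tau_one_sub_cos ⟨ht.1, ht.2.le⟩] at h2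
    rw [h2, show (1 - Real.cos (Real.pi * t)) * (2 - (1 - Real.cos (Real.pi * t)))
      = Real.sin (Real.pi * t) ^ 2 by linear_combination -h1, Real.sqrt_sq hs.le]

theorem HasUnitProfile.coord_one {γ : ℝ → E2} {L : ℝ} {r c s κ : ℝ → ℝ}
    (h : HasUnitProfile γ L r c s κ) (hγ : Admissible γ) (hs : Continuous s) {t : ℝ}
    (ht : t ∈ Icc (0 : ℝ) 1) : γ t 1 = γ 0 1 + L * ∫ x in (0 : ℝ)..t, s x := by
  have hd : ∀ x ∈ Ioo 0 t, HasDerivAt (fun y => γ y 1) (L * s x) x := fun x hx => by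
    have hx1 : x ∈ Ioo (0 : ℝ) 1 := ⟨hx.1, hx.2.trans_le ht.2⟩
    have h1 : HasDerivAt γ (velocity γ x) x :=
      (((hγ.contDiffOn.differentiableOn (by simp)) x
        (Ioo_subset_Icc_self hx1)).hasDerivWithinAt).hasDerivAt (Icc_mem_nhds hx1.1 hx1.2)
    exact (hasDerivAt_apply h1 1).congr_deriv (h.velocity_one x (Ioo_subset_Icc_self hx1))
  have hc : ContinuousOn (fun y => γ y 1) (Icc 0 t) := by
    have h2 : ContinuousOn γ (Icc 0 t) := hγ.contDiffOn.continuousOn.mono (Icc_subset_Icc_right ht.2)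
    exact (EuclideanSpace.proj (𝕜 := ℝ) (1 : Fin 2)).continuous.comp_continuousOn h2
  have := intervalIntegral.integral_eq_sub_of_hasDerivAt_of_le ht.1 hc hd
    ((continuous_const.mul hs).intervalIntegrable _ _)
  rw [intervalIntegral.integral_const_mul] at this
  linarith

theorem exists_spherePoint (p : Metric.sphere (0 : E3) 1) :
    ∃ t ∈ Icc (0 : ℝ) 1, ∃ θ, spherePoint t θ = p := by
  have hpi := Real.pi_pos
  have hs := sum_sq_eq_one p.2
  have h1 : -1 ≤ -(p : E3) 2 := by nlinarith [sq_nonneg ((p : E3) 0), sq_nonneg ((p : E3) 1)]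
  have h2 : -(p : E3) 2 ≤ 1 := by nlinarith [sq_nonneg ((p : E3) 0), sq_nonneg ((p : E3) 1)]
  let z : ℂ := ⟨(p : E3) 0, (p : E3) 1⟩
  have hz : ‖z‖ = √(1 - (-(p : E3) 2) ^ 2) := by
    rw [Complex.norm_def, Complex.normSq_mk]
    congr 1
    linear_combination hs
  have ht : Real.pi * (Real.arccos (-(p : E3) 2) / Real.pi) = Real.arccos (-(p : E3) 2) := by
    field_simp
  refine ⟨Real.arccos (-(p : E3) 2) / Real.pi, ⟨div_nonneg (Real.arccos_nonneg _) hpi.le,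
    (div_le_one hpi).2 (Real.arccos_le_pi _)⟩, z.arg, ?_⟩
  apply Subtype.ext
  ext i
  simp only [spherePoint, ht, Real.sin_arccos, Real.cos_arccos h1 h2, ← hz]
  fin_cases i
  · exact Complex.norm_mul_cos_arg z
  · exact Complex.norm_mul_sin_arg z
  · simp

/-- Chain rule through the inclusion of the sphere, whose differential is injective with range the
orthogonal complement of `p`. -/
theorem injective_mfderiv_comp_coe {F : Metric.sphere (0 : E3) 1 → E3} {G : E3 → E3}
    {p : Metric.sphere (0 : E3) 1} (hFG : F =ᶠ[𝓝 p] fun q => G q) (hG : DifferentiableAt ℝ G p)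
    (hinj : ∀ v : E3, (p : E3) 0 * v 0 + (p : E3) 1 * v 1 + (p : E3) 2 * v 2 = 0 →
      fderiv ℝ G p v = 0 → v = 0) :
    Function.Injective (mfderiv (𝓡 2) 𝓘(ℝ, E3) F p) := by
  have : Fact (Module.finrank ℝ E3 = 2 + 1) := ⟨by simp⟩
  have hc : MDifferentiableAt (𝓡 2) 𝓘(ℝ, E3) ((↑) : Metric.sphere (0 : E3) 1 → E3) p :=
    (contMDiff_coe_sphere (m := 1) p).mdifferentiableAt one_ne_zero
  have h1 : mfderiv (𝓡 2) 𝓘(ℝ, E3) F p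
      = (fderiv ℝ G p).comp (mfderiv (𝓡 2) 𝓘(ℝ, E3) ((↑) : Metric.sphere (0 : E3) 1 → E3) p) := by
    rw [hFG.mfderiv_eq, ← mfderiv_eq_fderiv]
    exact mfderiv_comp p hG.mdifferentiableAt hc
  rw [injective_iff_map_eq_zero]
  intro v hv
  rw [h1] at hv
  set T := mfderiv (𝓡 2) 𝓘(ℝ, E3) ((↑) : Metric.sphere (0 : E3) 1 → E3) p with hT
  have h2 : ∀ u : E3, u ∈ (ℝ ∙ (p : E3))ᗮ →
      (p : E3) 0 * u 0 + (p : E3) 1 * u 1 + (p : E3) 2 * u 2 = 0 := fun u hu => by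
    rw [Submodule.mem_orthogonal_singleton_iff_inner_right, PiLp.inner_apply] at hu
    simp only [Fin.sum_univ_three, RCLike.inner_apply, conj_trivial] at hu
    linarith
  have h3 : T v = (0 : E3) := hinj (T v) (h2 _ (by
    rw [← range_mfderiv_coe_sphere (n := 2) p]
    exact ⟨v, rfl⟩)) hv
  exact mfderiv_coe_sphere_injective (n := 2) p (h3.trans (map_zero T).symm)

theorem contMDiffAt_of_eventuallyEq_coe {F : Metric.sphere (0 : E3) 1 → E3} {G : E3 → E3}
    {p : Metric.sphere (0 : E3) 1} (hFG : F =ᶠ[𝓝 p] fun q => G q) (hG : ContDiffAt ℝ ∞ G p) :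
    ContMDiffAt (𝓡 2) 𝓘(ℝ, E3) ∞ F p := by
  have : Fact (Module.finrank ℝ E3 = 2 + 1) := ⟨by simp⟩
  exact (ContMDiffAt.comp p hG.contMDiffAt (contMDiff_coe_sphere p)).congr_of_eventuallyEq hFG

/-- A surface of revolution that is given by smooth data near each of its poles is smooth. -/
theorem generatesSmoothSurface_of_capData {γ : ℝ → E2} {b z b' z' : ℝ → ℝ} (hS : CapData b z)
    (hN : CapData b' z')
    (hSγ : ∀ t ∈ Ico (0 : ℝ) 1, ∀ θ, capMap 1 b z (spherePoint t θ) = revolve γ t θ)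
    (hNγ : ∀ t ∈ Ioc (0 : ℝ) 1, ∀ θ, capMap (-1) b' z' (spherePoint t θ) = revolve γ t θ) :
    GeneratesSmoothSurface γ := by
  classical
  have hpi := Real.pi_pos
  have h2 : ∀ t θ, (spherePoint t θ : E3) 2 = -Real.cos (Real.pi * t) := fun t θ => by
    simp [spherePoint]
  have hone : ∀ t ∈ Icc (0 : ℝ) 1, ∀ θ, (spherePoint t θ : E3) 2 = 1 → t = 1 := by
    intro t ht θ h
    rw [h2] at h
    have h3 : Real.cos (Real.pi * t) = Real.cos Real.pi := by rw [Real.cos_pi]; linarith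
    have h4 := Real.injOn_cos ⟨by nlinarith [ht.1], by nlinarith [ht.2]⟩ ⟨hpi.le, le_rfl⟩ h3
    exact mul_left_cancel₀ hpi.ne' (h4.trans (mul_one _).symm)
  have hone' : ∀ θ, (spherePoint 1 θ : E3) 2 = 1 := fun θ => by rw [h2]; simp
  have hzero : ∀ θ, (spherePoint 0 θ : E3) 2 = -1 := fun θ => by rw [h2]; simp
  -- The northern data are used only at the north pole. Away from both poles the two formulas agree,
  -- each giving `revolve γ`, so each represents `F` off the opposite pole.
  let F : Metric.sphere (0 : E3) 1 → E3 := fun p =>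
    if (p : E3) 2 = 1 then capMap (-1) b' z' p else capMap 1 b z p
  have hFS : ∀ p : Metric.sphere (0 : E3) 1, (p : E3) 2 ≠ 1 → F p = capMap 1 b z p :=
    fun p hp => if_neg hp
  have hFN : ∀ p : Metric.sphere (0 : E3) 1, (p : E3) 2 ≠ -1 → F p = capMap (-1) b' z' p := by
    intro p hp
    by_cases h1 : (p : E3) 2 = 1
    · exact if_pos h1
    · rw [hFS p h1]
      obtain ⟨t, ht, θ, rfl⟩ := exists_spherePoint p
      have h3 : t ≠ 0 := by rintro rfl; exact hp (hzero θ)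
      have h4 : t ≠ 1 := by rintro rfl; exact h1 (hone' θ)
      rw [hSγ t ⟨ht.1, lt_of_le_of_ne ht.2 h4⟩, hNγ t ⟨lt_of_le_of_ne ht.1 h3.symm, ht.2⟩]
  have hcont : Continuous fun p : Metric.sphere (0 : E3) 1 => (p : E3) 2 :=
    (contDiff_coord 2).continuous.comp continuous_subtype_val
  have key : ∀ p : Metric.sphere (0 : E3) 1, ∃ G : E3 → E3, (F =ᶠ[𝓝 p] fun q => G q) ∧
      ContDiffAt ℝ ∞ G p ∧ ∀ v : E3,
        (p : E3) 0 * v 0 + (p : E3) 1 * v 1 + (p : E3) 2 * v 2 = 0 → fderiv ℝ G p v = 0 → v = 0 := by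
    intro p
    have hs := sum_sq_eq_one p.2
    by_cases h1 : (p : E3) 2 = 1
    · have h3 : capHeight (-1) p < 2 := by
        rw [capHeight_of_mem_sphere (by norm_num) p.2, h1]; norm_num
      refine ⟨capMap (-1) b' z', ?_, (hN.contDiffOn_capMap _).contDiffAt
        ((isOpen_capHeight_lt _).mem_nhds h3), fun v hv h0 =>
          hN.fderiv_capMap_injOn (by norm_num) p.2 h3 hv h0⟩
      filter_upwards [hcont.continuousAt.eventually_ne (y := -1) (by rw [h1]; norm_num)] with q hq
        using hFN q hq
    · have h3 : capHeight 1 p < 2 := by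
        rw [capHeight_of_mem_sphere (by norm_num) p.2]
        have : (p : E3) 2 ≤ 1 := by nlinarith [sq_nonneg ((p : E3) 0), sq_nonneg ((p : E3) 1)]
        have := lt_of_le_of_ne this h1
        linarith
      refine ⟨capMap 1 b z, ?_, (hS.contDiffOn_capMap _).contDiffAt
        ((isOpen_capHeight_lt _).mem_nhds h3), fun v hv h0 =>
          hS.fderiv_capMap_injOn (by norm_num) p.2 h3 hv h0⟩
      filter_upwards [hcont.continuousAt.eventually_ne h1] with q hq using hFS q hq
  refine ⟨F, fun t ht θ => ?_, fun p => ?_, fun p => ?_⟩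
  · rcases ht.2.eq_or_lt with h | h
    · rw [hFN _ (by rw [h, hone' θ]; norm_num)]
      exact hNγ t ⟨h ▸ one_pos, ht.2⟩ θ
    · rw [hFS _ fun h' => h.ne (hone t ht θ h')]
      exact hSγ t ⟨ht.1, h⟩ θ
  · obtain ⟨G, h3, h4, -⟩ := key p
    exact contMDiffAt_of_eventuallyEq_coe h3 h4
  · obtain ⟨G, h3, h4, h5⟩ := key p
    exact injective_mfderiv_comp_coe h3 (h4.differentiableAt (by simp)) h5

theorem capMap_spherePoint {ε : ℝ} (hε : ε ^ 2 = 1) (b z : ℝ → ℝ) (t θ : ℝ) :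
    capMap ε b z (spherePoint t θ) =
      !₂[b (1 - ε * Real.cos (Real.pi * t)) * Real.sin (Real.pi * t) * Real.cos θ,
        b (1 - ε * Real.cos (Real.pi * t)) * Real.sin (Real.pi * t) * Real.sin θ,
        z (1 - ε * Real.cos (Real.pi * t))] := by
  have h2 : (spherePoint t θ : E3) 2 = -Real.cos (Real.pi * t) := by simp [spherePoint]
  have h0 : (spherePoint t θ : E3) 0 = Real.sin (Real.pi * t) * Real.cos θ := by simp [spherePoint]
  have h1 : (spherePoint t θ : E3) 1 = Real.sin (Real.pi * t) * Real.sin θ := by simp [spherePoint]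
  have hw : capHeight ε (spherePoint t θ) = 1 - ε * Real.cos (Real.pi * t) := by
    rw [capHeight_of_mem_sphere hε (spherePoint t θ).2, h2]; ring
  rw [capMap, hw, h0, h1]
  congr 2 <;> ring_nf

/-- The surface of revolution of a minimiser is smooth. -/
theorem generatesSmoothSurface_of_minimal {σ : ℝ} (hσ : 0 < σ) {γ : ℝ → E2} (hγ : γ ∈ Class σ)
    (hmin : willmore γ = beta σ) : GeneratesSmoothSurface γ := by
  obtain ⟨L, r, c, s, κ, k, lam, mu, hp, h⟩ := exists_smoothProfile hσ hγ hmin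
  have hL := hp.length_pos
  have hz := fun t ht => hp.coord_one hγ.1 h.continuous_s (t := t) ht
  -- Each pole has its own base height, `γ 0 1` or `γ 1 1`; the factor `-L` at the north undoes the
  -- reflection in the reversed profile.
  refine generatesSmoothSurface_of_capData (h.capData.affine hL hL.ne' (γ 0 1))
    (h.reverse.capData.affine hL (neg_ne_zero.2 hL.ne') (γ 1 1)) (fun t ht θ => ?_)
    fun t ht θ => ?_
  · have ht' : t ∈ Set.Icc (0 : ℝ) 1 := ⟨ht.1, ht.2.le⟩
    rw [capMap_spherePoint (by norm_num), revolve, one_mul, tau_one_sub_cos ht', mul_assoc L,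
      h.radialFactor_mul_sin ht, ← hp.coord t ht', ← hz t ht']
  · have ht' : t ∈ Set.Icc (0 : ℝ) 1 := ⟨ht.1.le, ht.2⟩
    have ht1 : 1 - t ∈ Set.Ico (0 : ℝ) 1 := ⟨by linarith [ht.2], by linarith [ht.1]⟩
    have e1 : Real.pi * (1 - t) = Real.pi - Real.pi * t := by ring
    have h1 := h.reverse.radialFactor_mul_sin ht1
    have h2 := tau_one_sub_cos (t := 1 - t) ⟨ht1.1, ht1.2.le⟩
    rw [e1, Real.cos_pi_sub] at h1 h2
    rw [Real.sin_pi_sub, sub_sub_cancel] at h1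
    have h3 : γ 1 1 + -L * ∫ x in (0 : ℝ)..1 - t, s (1 - x) = γ t 1 := by
      rw [intervalIntegral.integral_comp_sub_left (fun x => s x) 1, hz t ht',
        hz 1 ⟨zero_le_one, le_rfl⟩, ← intervalIntegral.integral_add_adjacent_intervals
          (h.continuous_s.intervalIntegrable 0 t) (h.continuous_s.intervalIntegrable t 1)]
      simp only [sub_sub_cancel, sub_zero]
      ring
    rw [capMap_spherePoint (by norm_num), revolve, neg_one_mul, h2, mul_assoc L, h1,
      ← hp.coord t ht', h3]

end ProfileCurve

theorem mainTheorem4 (σ : ℝ) (hσ₀ : 0 < σ) (hσ₁ : σ ≤ 1)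
    (γ : ℝ → ProfileCurve.E2) (hγ : γ ∈ ProfileCurve.Class σ)
    (hmin : ProfileCurve.willmore γ = ProfileCurve.beta σ) :
    ProfileCurve.GeneratesSmoothSurface γ :=
  ProfileCurve.generatesSmoothSurface_of_minimal hσ₀ hγ hmin
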